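/- Let $d\in\mathbb N$, $0<\alpha<d$ and $\gamma\ge 2-\alpha/d$ (so $\gamma>1$), and let $\mathbb T^d=(-\tfrac12,\tfrac12)^d$. Functions are defined on $\mathbb R^d$ and have period $1$ in each coordinate. Put $K_\alpha(x)=\frac1{d-\alpha}|x|^{\alpha-d}$, $p(s)=s^\gamma$, $h(s)=\frac1{\gamma-1}s^\gamma$, $h(s|\sigma)=h(s)-h(\sigma)-h'(\sigma)(s-\sigma)$, \[ (K_\alpha*f)(x)=\int_{\mathbb T^d}K_\alpha(y)f(x-y)\,dy,\qquad S_\alpha(f)(x)=\tfrac12\int_0^1\!\int_{\mathbb T^d} f(x+(\theta-1)y)\,f(x+\theta y)\,|y|^{\alpha-d-2}\,y\otimes y\,dy\,d\theta, \] and, for $\kappa\in\mathbb R$, $R_\alpha(f)=p(f)I_d+\kappa S_\alpha(f)$ and $\frac{\delta\mathcal E}{\delta\rho}(f)=h'(f)+\kappa K_\alpha*f$. (1) For every nonnegative periodic $C^1$ function $f$ one has $f\,\nabla\frac{\delta\mathcal E}{\delta\rho}(f)=\nabla\cdot R_\alpha(f)$ (the left side being read as $0$ where $f=0$). Hence the Euler–Riesz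 system with momentum equation $\partial_t(\rho u)+\nabla\cdot(\rho u\otimes u)+\rho\nabla\frac{\delta\mathcal E}{\delta\rho}(\rho)=0$ can be reformulated as \[ \partial_t\rho+\nabla\cdot(\rho u)=0,\qquad \partial_t(\rho u)+\nabla\cdot\big(\rho u\otimes u+R_\alpha(\rho)\big)=0. \tag{ER} \] (2) Let $\bar\delta>0$ and $\bar M,m\in\mathbb R$. There is a constant $C_*>0$, depending only on $d,\alpha,\gamma,\bar\delta,\bar M,m$, such that for all periodic $\rho\in L^\gamma(\mathbb T^d)$ with $\rho\ge0$ and $\int_{\mathbb T^d}\rho\,dx\le m$ and all periodic $\bar\rho\in L^\infty(\mathbb T^d)$ with $\bar\delta\le\bar\rho\le\bar M$, \[ \big\|(\rho-\bar\rho)\,K_\alpha*(\rho-\bar\rho)\big\|_{L^1(\mathbb T^d)}\le C_*\int_{\mathbb T^d}h(\rho|\bar\rho)\,dx. \tag{$*$} \] (3) Let moreover $C_*>0$, $L\in\mathbb R$ and $|\kappa|<2/C_*$. There is a constant $C>0$, depending only on $d,\alpha,\gamma,\kappa,\bar\delta,\bar M,m,L,C_*$, with the following property. Let $T>0$, and let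 $(\rho,u)$ and $(\bar\rho,\bar u)$ be two classical solutions of (ER) (continuous on $[0,T)\times\mathbb R^d$, continuously differentiable on $(0,T)\times\mathbb R^d$, periodic in space, with nonnegative densities; smooth periodic solutions in particular) such that $\bar\delta\le\bar\rho\le\bar M$ on $[0,T)\times\mathbb T^d$, $|\nabla\bar u|\le L$ on $(0,T)\times\mathbb T^d$, $\int_{\mathbb T^d}\rho(0,x)\,dx\le m$, and $C_*$ is a constant for which $(*)$ holds for the pair $(\rho(t,\cdot),\bar\rho(t,\cdot))$ for every $t\in[0,T)$ (any constant as in (2) is one). Then the relative energy \[ \Psi(t)=\int_{\mathbb T^d}\tfrac12\rho|u-\bar u|^2+h(\rho|\bar\rho)+\tfrac\kappa2(\rho-\bar\rho)\big(K_\alpha*(\rho-\bar\rho)\big)\,dx \] satisfies, for every $t\in[0,T)$, \[ \Psi(t)\ge 0,\qquad \int_{\mathbb T^d}\tfrac12\rho|u-\bar u|^2\,dx+\Big(1-\tfrac{|\kappa|C_*}2\Big)\int_{\mathbb T^d}h(\rho|\bar\rho)\,dx\le\Psi(t), \] \[ \sum_{i,j}\int_{\mathbb T^d}\big|S_\alpha(\rho-\bar\rho)_{ij}\big|\,dx\le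 C\int_{\mathbb T^d}h(\rho|\bar\rho)\,dx,\qquad \Psi(t)\le e^{CT}\,\Psi(0). \] -/

import Mathlib

open Set MeasureTheory

namespace EulerRiesz

noncomputable section

/-- The open unit cube `(-1/2, 1/2)^d`, the fundamental cell of the torus. Functions on the torus
are functions on `ℝ^d` with unit period, integrated over this cell. -/
def cell (d : ℕ) : Set (EuclideanSpace ℝ (Fin d)) :=
  {x | ∀ i, x i ∈ Ioo (-(1 / 2) : ℝ) (1 / 2)}

/-- Unit period in every coordinate direction. -/
def UnitPeriodic {d : ℕ} {F : Type*} (f : EuclideanSpace ℝ (Fin d) → F) : Prop :=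
  ∀ (x : EuclideanSpace ℝ (Fin d)) (i : Fin d), f (x + EuclideanSpace.single i (1 : ℝ)) = f x

/-- The partial derivative `∂_i f` in space. -/
def partialX {d : ℕ} (i : Fin d) (f : EuclideanSpace ℝ (Fin d) → ℝ)
    (x : EuclideanSpace ℝ (Fin d)) : ℝ :=
  fderiv ℝ f x (EuclideanSpace.single i (1 : ℝ))

/-- The Riesz kernel `K_α(x) = |x|^(α - d) / (d - α)`. -/
def rieszKernel {d : ℕ} (α : ℝ) (x : EuclideanSpace ℝ (Fin d)) : ℝ :=
  1 / ((d : ℝ) - α) * ‖x‖ ^ (α - (d : ℝ))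

/-- The convolution `K_α ∗ f` on the torus. -/
def rieszConv {d : ℕ} (α : ℝ) (f : EuclideanSpace ℝ (Fin d) → ℝ)
    (x : EuclideanSpace ℝ (Fin d)) : ℝ :=
  ∫ y in cell d, rieszKernel α y * f (x - y)

/-- The entry `(i, j)` of the tensor `S_α(f)` at `x`, on the torus. -/
def rieszTensor {d : ℕ} (α : ℝ) (f : EuclideanSpace ℝ (Fin d) → ℝ)
    (x : EuclideanSpace ℝ (Fin d)) (i j : Fin d) : ℝ :=
  1 / 2 * ∫ θ in (0 : ℝ)..1, ∫ y in cell d,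
    f (x + (θ - 1) • y) * f (x + θ • y) * ‖y‖ ^ (α - (d : ℝ) - 2) * (y i * y j)

/-- The pressure `p(s) = s^γ`. -/
def pressure (γ s : ℝ) : ℝ := s ^ γ

/-- The internal energy `h(s) = s^γ / (γ - 1)`. -/
def internalEnergy (γ s : ℝ) : ℝ := 1 / (γ - 1) * s ^ γ

/-- The derivative `h'(s) = γ s^(γ - 1) / (γ - 1)` of the internal energy. -/
def internalEnergy' (γ s : ℝ) : ℝ := γ / (γ - 1) * s ^ (γ - 1)

theorem hasDerivAt_internalEnergy {γ : ℝ} (hγ : 1 < γ) (s : ℝ) :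
    HasDerivAt (internalEnergy γ) (internalEnergy' γ s) s := by
  have h := (Real.hasDerivAt_rpow_const (x := s) (p := γ) (Or.inr hγ.le)).const_mul (1 / (γ - 1))
  have e : internalEnergy' γ s = 1 / (γ - 1) * (γ * s ^ (γ - 1)) := by
    unfold internalEnergy'; ring
  rw [e]
  exact h

/-- The relative internal energy `h(s | σ) = h(s) - h(σ) - h'(σ) (s - σ)`. -/
def relInternalEnergy (γ s σ : ℝ) : ℝ :=
  internalEnergy γ s - internalEnergy γ σ - internalEnergy' γ σ * (s - σ)

/-- The functional derivative `δℰ/δρ (f) = h'(f) + κ K_α ∗ f` of the potential energy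
`ℰ(f) = ∫ h(f) + κ/2 f (K_α ∗ f)`. -/
def energyVariation {d : ℕ} (α γ κ : ℝ) (f : EuclideanSpace ℝ (Fin d) → ℝ)
    (x : EuclideanSpace ℝ (Fin d)) : ℝ :=
  internalEnergy' γ (f x) + κ * rieszConv α f x

/-- The entry `(i, j)` of the stress tensor `R_α(f) = p(f) I + κ S_α(f)`. -/
def stress {d : ℕ} (α γ κ : ℝ) (f : EuclideanSpace ℝ (Fin d) → ℝ)
    (x : EuclideanSpace ℝ (Fin d)) (i j : Fin d) : ℝ :=
  (if i = j then pressure γ (f x) else 0) + κ * rieszTensor α f x i j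

/-- Space-periodic classical solutions on `[0, T)`, with nonnegative density, of the Euler-Riesz
system `∂ₜρ + ∇·(ρu) = 0`, `∂ₜ(ρu) + ∇·(ρu ⊗ u + R_α(ρ)) = 0` in divergence form. -/
structure IsPeriodicSolution {d : ℕ} (α γ κ T : ℝ)
    (ρ : ℝ → EuclideanSpace ℝ (Fin d) → ℝ)
    (u : ℝ → EuclideanSpace ℝ (Fin d) → EuclideanSpace ℝ (Fin d)) : Prop where
  continuousOn_density : ContinuousOn (fun z : ℝ × EuclideanSpace ℝ (Fin d) => ρ z.1 z.2)
    (Ico 0 T ×ˢ univ)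
  continuousOn_velocity : ContinuousOn (fun z : ℝ × EuclideanSpace ℝ (Fin d) => u z.1 z.2)
    (Ico 0 T ×ˢ univ)
  contDiffOn_density : ContDiffOn ℝ 1 (fun z : ℝ × EuclideanSpace ℝ (Fin d) => ρ z.1 z.2)
    (Ioo 0 T ×ˢ univ)
  contDiffOn_velocity : ContDiffOn ℝ 1 (fun z : ℝ × EuclideanSpace ℝ (Fin d) => u z.1 z.2)
    (Ioo 0 T ×ˢ univ)
  periodic_density : ∀ t ∈ Ico 0 T, UnitPeriodic (ρ t)
  periodic_velocity : ∀ t ∈ Ico 0 T, UnitPeriodic (u t)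
  density_nonneg : ∀ t ∈ Ico 0 T, ∀ x, 0 ≤ ρ t x
  mass : ∀ t ∈ Ioo 0 T, ∀ x,
    deriv (fun s => ρ s x) t + ∑ j, partialX j (fun z => ρ t z * u t z j) x = 0
  momentum : ∀ t ∈ Ioo 0 T, ∀ x, ∀ i,
    deriv (fun s => ρ s x * u s x i) t
      + ∑ j, partialX j (fun z => ρ t z * u t z i * u t z j + stress α γ κ (ρ t) z i j) x = 0

/-- The relative kinetic energy `∫ ½ ρ |u - ū|²` of two states. -/
def relKineticEnergy {d : ℕ} (ρ : EuclideanSpace ℝ (Fin d) → ℝ)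
    (u v : EuclideanSpace ℝ (Fin d) → EuclideanSpace ℝ (Fin d)) : ℝ :=
  ∫ x in cell d, 1 / 2 * ρ x * ‖u x - v x‖ ^ 2

/-- The total relative internal energy `∫ h(ρ | σ)` of two densities. -/
def totalRelInternalEnergy {d : ℕ} (γ : ℝ) (ρ σ : EuclideanSpace ℝ (Fin d) → ℝ) : ℝ :=
  ∫ x in cell d, relInternalEnergy γ (ρ x) (σ x)

/-- The relative energy
`∫ ½ ρ |u - v|² + h(ρ | σ) + κ/2 (ρ - σ) (K_α ∗ (ρ - σ))` of the states `(ρ, u)` and `(σ, v)`. -/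
def relEnergy {d : ℕ} (α γ κ : ℝ) (ρ : EuclideanSpace ℝ (Fin d) → ℝ)
    (u : EuclideanSpace ℝ (Fin d) → EuclideanSpace ℝ (Fin d))
    (σ : EuclideanSpace ℝ (Fin d) → ℝ)
    (v : EuclideanSpace ℝ (Fin d) → EuclideanSpace ℝ (Fin d)) : ℝ :=
  ∫ x in cell d, (1 / 2 * ρ x * ‖u x - v x‖ ^ 2 + relInternalEnergy γ (ρ x) (σ x)
    + κ * (1 / 2) * (ρ x - σ x) * rieszConv α (fun z => ρ z - σ z) x)

/-- `C` is a constant with `‖(ρ - σ) K_α ∗ (ρ - σ)‖_{L¹} ≤ C ∫ h(ρ | σ)`. -/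
def IsInteractionConstant {d : ℕ} (α γ C : ℝ) (ρ σ : EuclideanSpace ℝ (Fin d) → ℝ) : Prop :=
  IntegrableOn (fun x => (ρ x - σ x) * rieszConv α (fun z => ρ z - σ z) x) (cell d) ∧
    ∫ x in cell d, |(ρ x - σ x) * rieszConv α (fun z => ρ z - σ z) x|
      ≤ C * totalRelInternalEnergy γ ρ σ

end

end EulerRiesz

/-! Stress tensor. For the pressure part, `f h''(f) = p'(f)`. For the interaction part, raising `θ`
moves both points `x + (θ-1)y` and `x + θy` with velocity `y`, so contracting `y ⊗ y` with the
`x`-gradient of the two-point product gives `y` times a `θ`-derivative. Integrating over `θ` yields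
`∇·S_α(f)(x) = f(x) · ½ ∫ |y|^(α-d-2) y (f(x+y) - f(x-y)) dy`. The integral, with its factor ½, is
`∇(K_α ∗ f)(x)`: let the derivative fall on `f`, symmetrize under `y ↦ -y` and integrate by parts in
`y`, using `∇K_α = -|y|^(α-d-2) y`. The kernel is not periodic, but it takes equal values on
opposite faces of the cube, so no boundary term survives (`mul_partialX_rieszConv`).

Interaction constant. With `g = ρ - ρ̄`, everything is controlled by `∫∫ |g(x)| |g(x-y)| |y|^(α-d)`.
Since `st ≤ (s+t) min(s,t)`, symmetry reduces this to `2 ∫ |g(x)| ∫ |y|^(α-d) min(|g(x)|, |g(x-y)|)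
dy dx`. Cutting the kernel at a radius adapted to `|g(x)|` and to the mass bounds the inner integral
by `C |g(x)|^(1-α/d)`, while the trivial bound is `C |g(x)|`. So the interaction is at most an
integral of `g²` where `g` is small and of `|g|^(2-α/d) ≤ |g|^γ` where it is large. The relative
internal energy dominates exactly this mixture when `ρ̄` is bounded and bounded away from zero
(`exists_gauge_le_relInternalEnergy`).

Stability. Differentiating `Ψ` and using both systems in divergence form leaves `Ψ' = -∫ ρ
(u-ū)·∇ū(u-ū) - (γ-1) ∫ h(ρ|ρ̄) ∇·ū - κ ∫ ∇ū : S_α(ρ-ρ̄)` (`hasDerivAt_relEnergy`); all other terms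
form the divergence of a periodic flux. By Tonelli and translation invariance the `L¹` norm of
`S_α(g)` is bounded by the same double integral, hence by the relative internal energy. As `|κ| <
2/C_*`, `Ψ` controls the kinetic and internal parts, so `Ψ' ≤ CΨ`, and Grönwall's inequality
concludes. -/

namespace EulerRiesz

/-! ### Periodic functions and the unit cube as a fundamental domain of the integer lattice -/

/-- The integer translations of `ℝ^d`, as a homomorphism. -/
def latticeHom (d : ℕ) : (Fin d → ℤ) →+ EuclideanSpace ℝ (Fin d) where
  toFun n := WithLp.toLp 2 fun i => (n i : ℝ)
  map_zero' := by ext i; simp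
  map_add' m n := by ext i; simp

/-- The integer lattice. -/
abbrev lattice (d : ℕ) : AddSubgroup (EuclideanSpace ℝ (Fin d)) := (latticeHom d).range

instance (d : ℕ) : Countable (lattice d) :=
  (Set.countable_range (latticeHom d)).to_subtype

theorem UnitPeriodic.add_latticeHom {d : ℕ} {F : Type*} {f : EuclideanSpace ℝ (Fin d) → F}
    (hf : UnitPeriodic f) (n : Fin d → ℤ) : ∀ x, f (x + latticeHom d n) = f x := by
  classical
  have hz : ∀ (i : Fin d) (k : ℤ) x, f (x + latticeHom d (Pi.single i k)) = f x := by
    intro i k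
    have hs : ∀ k : ℤ, latticeHom d (Pi.single i (k + 1))
        = latticeHom d (Pi.single i k) + EuclideanSpace.single i (1 : ℝ) := by
      intro k
      rw [Pi.single_add, map_add]
      congr 1
      ext j
      by_cases h : j = i <;> simp [latticeHom, h]
    induction k using Int.induction_on with
    | zero => simp
    | succ k ih => intro x; rw [hs, ← add_assoc, hf, ih]
    | pred k ih =>
      intro x
      rw [← hf, add_assoc, ← hs, sub_add_cancel, ih]
  have hn : n = ∑ i, Pi.single i (n i) := (Finset.univ_sum_single n).symm
  rw [hn]
  generalize hS : (Finset.univ : Finset (Fin d)) = S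
  clear hS hn
  induction S using Finset.induction_on with
  | empty => simp
  | insert i S hi ih => intro x; rw [Finset.sum_insert hi, map_add, ← add_assoc, ih, hz]

theorem UnitPeriodic.vadd {d : ℕ} {F : Type*} {f : EuclideanSpace ℝ (Fin d) → F}
    (hf : UnitPeriodic f) (g : lattice d) (x : EuclideanSpace ℝ (Fin d)) : f (g +ᵥ x) = f x := by
  obtain ⟨_, n, rfl⟩ := g
  change f (latticeHom d n + x) = f x
  rw [add_comm, hf.add_latticeHom]

theorem isOpen_cell (d : ℕ) : IsOpen (cell d) := by
  have : cell d = ⋂ i, (fun x : EuclideanSpace ℝ (Fin d) => x i) ⁻¹' Ioo (-(1 / 2) : ℝ) (1 / 2) := by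
    ext x; simp [cell]
  rw [this]
  exact isOpen_iInter_of_finite fun i => isOpen_Ioo.preimage (by fun_prop)

theorem measurableSet_cell (d : ℕ) : MeasurableSet (cell d) := (isOpen_cell d).measurableSet

/-- The closed unit cube. -/
def closedCell (d : ℕ) : Set (EuclideanSpace ℝ (Fin d)) :=
  {x | ∀ i, x i ∈ Icc (-(1 / 2) : ℝ) (1 / 2)}

theorem cell_subset_closedCell (d : ℕ) : cell d ⊆ closedCell d :=
  fun _ hx i => Ioo_subset_Icc_self (hx i)

theorem isCompact_closedCell (d : ℕ) : IsCompact (closedCell d) := by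
  have : closedCell d = (EuclideanSpace.equiv (Fin d) ℝ).toHomeomorph ⁻¹'
      (univ.pi fun _ => Icc (-(1 / 2) : ℝ) (1 / 2)) := by
    ext x
    simp only [closedCell, mem_ofPred_eq, mem_preimage, mem_pi, mem_univ, true_imp_iff]
    rfl
  rw [this, Homeomorph.isCompact_preimage]
  exact isCompact_univ_pi fun _ => isCompact_Icc

theorem volume_coord_eq_zero {d : ℕ} (i : Fin d) (c : ℝ) :
    volume {x : EuclideanSpace ℝ (Fin d) | x i = c} = 0 := by
  have h := (PiLp.volume_preserving_ofLp (Fin d)).measure_preimage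
    (s := {f : Fin d → ℝ | f i = c}) (measurableSet_eq_fun (by fun_prop) (by fun_prop)).nullMeasurableSet
  have h2 : volume {f : Fin d → ℝ | f i = c} = 0 := by
    rw [volume_pi]; exact Measure.pi_hyperplane (α := fun _ : Fin d => ℝ) (fun _ => volume) i c
  rw [h2] at h
  exact h

/-- Points with no coordinate in `ℤ + 1/2` are brought into the cube by subtracting the floors of
`x_i + 1/2`; the exceptional hyperplanes are countably many null sets. Two translates that meet
differ by integers of absolute value below 1, hence coincide. -/
theorem isAddFundamentalDomain_cell (d : ℕ) :
    IsAddFundamentalDomain (lattice d) (cell d) volume where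
  nullMeasurableSet := (measurableSet_cell d).nullMeasurableSet
  ae_covers := by
    have h : ∀ᵐ x : EuclideanSpace ℝ (Fin d), ∀ (i : Fin d) (n : ℤ), x i ≠ n - 1 / 2 := by
      rw [ae_all_iff]; intro i
      rw [ae_all_iff]; intro n
      have := volume_coord_eq_zero i ((n : ℝ) - 1 / 2)
      rw [ae_iff]
      simpa using this
    filter_upwards [h] with x hx
    refine ⟨⟨latticeHom d (fun i => -⌊x i + 1 / 2⌋), ⟨_, rfl⟩⟩, ?_⟩
    intro i
    have e : ((⟨latticeHom d (fun i => -⌊x i + 1 / 2⌋), ⟨_, rfl⟩⟩ : lattice d) +ᵥ x) i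
        = -(⌊x i + 1 / 2⌋ : ℝ) + x i := by
      change (latticeHom d (fun i => -⌊x i + 1 / 2⌋) + x) i = _
      simp [latticeHom]
    rw [e]
    have h1 := Int.floor_le (x i + 1 / 2)
    have h2 := Int.lt_floor_add_one (x i + 1 / 2)
    have h3 := hx i ⌊x i + 1 / 2⌋
    constructor
    · have : (⌊x i + 1 / 2⌋ : ℝ) ≠ x i + 1 / 2 := fun h => h3 (by linarith)
      have := lt_of_le_of_ne h1 this
      linarith
    · linarith
  aedisjoint := by
    rintro ⟨_, m, rfl⟩ ⟨_, n, rfl⟩ hmn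
    refine Disjoint.aedisjoint (Set.disjoint_left.2 ?_)
    rintro _ ⟨x, hx, rfl⟩ ⟨y, hy, hxy⟩
    apply hmn
    have hxy : latticeHom d n + y = latticeHom d m + x := hxy
    have : n = m := by
      funext i
      have h := congrArg (fun z : EuclideanSpace ℝ (Fin d) => z i) hxy
      simp only [latticeHom, AddMonoidHom.coe_mk, ZeroHom.coe_mk, PiLp.add_apply] at h
      have h1 := hx i
      have h2 := hy i
      have h3 : ((n i - m i : ℤ) : ℝ) < 1 := by push_cast; linarith [h1.1, h1.2, h2.1, h2.2]
      have h4 : (-1 : ℝ) < ((n i - m i : ℤ) : ℝ) := by push_cast; linarith [h1.1, h1.2, h2.1, h2.2]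
      have h3' : n i - m i < 1 := by exact_mod_cast h3
      have h4' : -1 < n i - m i := by exact_mod_cast h4
      omega
    simp [this]

theorem volume_cell_lt_top (d : ℕ) : volume (cell d) < ⊤ :=
  (measure_mono (cell_subset_closedCell d)).trans_lt (isCompact_closedCell d).measure_lt_top

instance (d : ℕ) : IsFiniteMeasure (volume.restrict (cell d)) :=
  ⟨by rw [Measure.restrict_apply_univ]; exact volume_cell_lt_top d⟩

section

open scoped Pointwise

theorem isAddFundamentalDomain_vadd_cell {d : ℕ} (a : EuclideanSpace ℝ (Fin d)) :
    IsAddFundamentalDomain (lattice d) (a +ᵥ cell d) volume :=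
  (isAddFundamentalDomain_cell d).vadd_of_comm a

theorem UnitPeriodic.comp_add {d : ℕ} {F : Type*} {f : EuclideanSpace ℝ (Fin d) → F}
    (hf : UnitPeriodic f) (a : EuclideanSpace ℝ (Fin d)) : UnitPeriodic fun x => f (x + a) :=
  fun x i => by
    change f (x + _ + a) = f (x + a)
    rw [add_right_comm, hf]

theorem UnitPeriodic.map {d : ℕ} {F G : Type*} {f : EuclideanSpace ℝ (Fin d) → F}
    (hf : UnitPeriodic f) (φ : F → G) : UnitPeriodic fun x => φ (f x) :=
  fun x i => congrArg φ (hf x i)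

theorem UnitPeriodic.map₂ {d : ℕ} {F G H : Type*} {f : EuclideanSpace ℝ (Fin d) → F}
    {g : EuclideanSpace ℝ (Fin d) → G} (hf : UnitPeriodic f) (hg : UnitPeriodic g)
    (φ : F → G → H) : UnitPeriodic fun x => φ (f x) (g x) :=
  fun x i => congrArg₂ φ (hf x i) (hg x i)

/-- A translate of the cube is again a fundamental domain, and invariant functions have the same
integral over any two of them. -/
theorem UnitPeriodic.setIntegral_add {d : ℕ} {F : Type*} [NormedAddCommGroup F] [NormedSpace ℝ F]
    {f : EuclideanSpace ℝ (Fin d) → F} (hf : UnitPeriodic f) (a : EuclideanSpace ℝ (Fin d)) :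
    ∫ x in cell d, f (x + a) = ∫ x in cell d, f x := by
  rw [(isAddFundamentalDomain_cell d).setIntegral_eq (isAddFundamentalDomain_vadd_cell a) hf.vadd]
  have e : MeasurableEmbedding (fun x : EuclideanSpace ℝ (Fin d) => x + a) :=
    (Homeomorph.addRight a).measurableEmbedding
  have h := (measurePreserving_add_right (volume : Measure (EuclideanSpace ℝ (Fin d))) a)
    |>.setIntegral_image_emb e f (cell d)
  have : a +ᵥ cell d = (fun x => x + a) '' cell d := by
    ext x; simp only [Set.mem_vadd_set, mem_image, vadd_eq_add, add_comm]
  rw [this, h]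

theorem UnitPeriodic.setLIntegral_add {d : ℕ} {f : EuclideanSpace ℝ (Fin d) → ENNReal}
    (hf : UnitPeriodic f) (a : EuclideanSpace ℝ (Fin d)) :
    ∫⁻ x in cell d, f (x + a) = ∫⁻ x in cell d, f x := by
  rw [(isAddFundamentalDomain_cell d).setLIntegral_eq (isAddFundamentalDomain_vadd_cell a) f hf.vadd]
  have e : MeasurableEmbedding (fun x : EuclideanSpace ℝ (Fin d) => x + a) :=
    (Homeomorph.addRight a).measurableEmbedding
  have h := (measurePreserving_add_right (volume : Measure (EuclideanSpace ℝ (Fin d))) a)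
    |>.setLIntegral_comp_emb e f (cell d)
  have : a +ᵥ cell d = (fun x => x + a) '' cell d := by
    ext x; simp only [Set.mem_vadd_set, mem_image, vadd_eq_add, add_comm]
  rw [this, h]

end

theorem neg_preimage_cell (d : ℕ) :
    (fun x : EuclideanSpace ℝ (Fin d) => -x) ⁻¹' cell d = cell d := by
  ext x
  simp only [cell, mem_preimage, mem_ofPred_eq, PiLp.neg_apply, mem_Ioo]
  refine forall_congr' fun i => ⟨fun h => ⟨by linarith [h.2], by linarith [h.1]⟩,
    fun h => ⟨by linarith [h.2], by linarith [h.1]⟩⟩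

theorem setIntegral_cell_neg {d : ℕ} {F : Type*} [NormedAddCommGroup F] [NormedSpace ℝ F]
    (f : EuclideanSpace ℝ (Fin d) → F) : ∫ x in cell d, f (-x) = ∫ x in cell d, f x := by
  have h := (Measure.measurePreserving_neg (volume : Measure (EuclideanSpace ℝ (Fin d))))
    |>.setIntegral_preimage_emb (Homeomorph.neg _).measurableEmbedding f (cell d)
  rw [neg_preimage_cell] at h
  exact h

theorem setLIntegral_cell_neg {d : ℕ} (f : EuclideanSpace ℝ (Fin d) → ENNReal) :
    ∫⁻ x in cell d, f (-x) = ∫⁻ x in cell d, f x := by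
  have h := (Measure.measurePreserving_neg (volume : Measure (EuclideanSpace ℝ (Fin d))))
    |>.setLIntegral_comp_preimage_emb (Homeomorph.neg _).measurableEmbedding f (cell d)
  rw [neg_preimage_cell] at h
  exact h

/-- Lebesgue measure is the countable sum of its restrictions to the lattice translates of the cube.
Global measurability is needed because `x - y` leaves the cube when `x` and `y` range over it. -/
theorem UnitPeriodic.aestronglyMeasurable {d : ℕ} {f : EuclideanSpace ℝ (Fin d) → ℝ}
    (hf : UnitPeriodic f) (h : AEStronglyMeasurable f (volume.restrict (cell d))) :
    AEStronglyMeasurable f volume := by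
  rw [← (isAddFundamentalDomain_cell d).sum_restrict_of_ac Measure.AbsolutelyContinuous.rfl]
  refine AEStronglyMeasurable.sum_measure fun g => ?_
  exact ((isAddFundamentalDomain_cell d).aestronglyMeasurable_on_iff
    (isAddFundamentalDomain_vadd_cell (g : EuclideanSpace ℝ (Fin d))) hf.vadd).1 h

end EulerRiesz

/-! ### Integrability of the Riesz kernel and the divergence theorem on the cube -/

namespace EulerRiesz

theorem rpow_smul_indicator {d : ℕ} (hd : 0 < d) (α r : ℝ) {y : ℝ} (hy : 0 < y) :
    y ^ (d - 1) • (Iio r).indicator (fun t : ℝ => t ^ (α - (d : ℝ))) y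
      = (Iio r).indicator (fun t : ℝ => t ^ (α - 1)) y := by
  by_cases h : y ∈ Iio r
  · rw [indicator_of_mem h, indicator_of_mem h, smul_eq_mul, ← Real.rpow_natCast,
      ← Real.rpow_add hy, Nat.cast_sub hd]
    congr 1; push_cast; ring
  · rw [indicator_of_notMem h, indicator_of_notMem h, smul_zero]

theorem integrable_indicator_norm_rpow {d : ℕ} {α : ℝ} (hα : 0 < α) (hαd : α < d) (r : ℝ) :
    Integrable (fun x : EuclideanSpace ℝ (Fin d) =>
      (Iio r).indicator (fun t : ℝ => t ^ (α - (d : ℝ))) ‖x‖) := by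
  have hd : 0 < d := by exact_mod_cast hα.trans hαd
  have : Nonempty (Fin d) := ⟨⟨0, hd⟩⟩
  rw [integrable_fun_norm_addHaar, finrank_euclideanSpace_fin,
    integrableOn_congr_fun (fun y (hy : y ∈ Ioi (0 : ℝ)) => rpow_smul_indicator hd α r hy) measurableSet_Ioi,
    IntegrableOn, integrable_indicator_iff measurableSet_Iio, IntegrableOn,
    Measure.restrict_restrict measurableSet_Iio]
  have h := (intervalIntegral.intervalIntegrable_rpow' (a := 0) (b := max r 0) (r := α - 1)
    (by linarith)).1
  exact h.mono_set fun y hy => ⟨hy.2, hy.1.le.trans (le_max_left _ _)⟩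

theorem exists_lintegral_ball_norm_rpow_le {d : ℕ} {α : ℝ} (hα : 0 < α) (hαd : α < d) :
    ∃ c : ℝ, 0 < c ∧ ∀ r : ℝ, 0 < r →
      ∫⁻ y in Metric.ball (0 : EuclideanSpace ℝ (Fin d)) r, ENNReal.ofReal (‖y‖ ^ (α - (d : ℝ)))
        ≤ ENNReal.ofReal (c * r ^ α) := by
  have hd : 0 < d := by exact_mod_cast hα.trans hαd
  have : Nonempty (Fin d) := ⟨⟨0, hd⟩⟩
  set V : ℝ := (volume : Measure (EuclideanSpace ℝ (Fin d))).real (Metric.ball 0 1)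
  have hV : 0 ≤ V := measureReal_nonneg
  -- In polar coordinates the integral equals `d V r^α / α`; the added 1 makes the constant positive
  -- without knowing `V > 0`.
  refine ⟨d * V / α + 1, by positivity, fun r hr => ?_⟩
  have h := integral_fun_norm_addHaar (volume : Measure (EuclideanSpace ℝ (Fin d)))
    ((Iio r).indicator (fun t : ℝ => t ^ (α - (d : ℝ))))
  rw [finrank_euclideanSpace_fin, setIntegral_congr_fun measurableSet_Ioi
    (fun y (hy : y ∈ Ioi (0 : ℝ)) => rpow_smul_indicator hd α r hy), setIntegral_indicator measurableSet_Iio,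
    Ioi_inter_Iio, ← integral_Ioc_eq_integral_Ioo, ← intervalIntegral.integral_of_le hr.le,
    integral_rpow (Or.inl (by linarith))] at h
  have e : ∀ y : EuclideanSpace ℝ (Fin d), (Metric.ball 0 r).indicator
      (fun y => ENNReal.ofReal (‖y‖ ^ (α - (d : ℝ)))) y
      = ENNReal.ofReal ((Iio r).indicator (fun t : ℝ => t ^ (α - (d : ℝ))) ‖y‖) := by
    intro y
    by_cases hy : ‖y‖ < r
    · rw [indicator_of_mem (by simpa using hy), indicator_of_mem (by simpa using hy)]
    · rw [indicator_of_notMem (by simpa using hy), indicator_of_notMem (by simpa using hy)]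
      simp
  rw [← lintegral_indicator Metric.isOpen_ball.measurableSet, lintegral_congr e,
    ← ofReal_integral_eq_lintegral_ofReal (integrable_indicator_norm_rpow hα hαd r), h]
  · apply ENNReal.ofReal_le_ofReal
    rw [sub_add_cancel, Real.zero_rpow hα.ne', sub_zero]
    have : 0 ≤ r ^ α := by positivity
    rw [nsmul_eq_mul, smul_eq_mul]
    have e2 : (d : ℝ) * (V * (r ^ α / α)) = d * V / α * r ^ α := by ring
    rw [e2]
    nlinarith
  · exact Filter.Eventually.of_forall fun y =>
      indicator_apply_nonneg fun _ => by positivity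

theorem norm_le_of_mem_cell {d : ℕ} {x : EuclideanSpace ℝ (Fin d)} (hx : x ∈ closedCell d) :
    ‖x‖ ≤ d := by
  have h1 : ‖x‖ ≤ Real.sqrt (d * 1) := by
    rw [EuclideanSpace.norm_eq]
    apply Real.sqrt_le_sqrt
    calc ∑ i, ‖x i‖ ^ 2 ≤ ∑ i : Fin d, (1 : ℝ) := by
          refine Finset.sum_le_sum fun i _ => ?_
          have := hx i
          rw [Real.norm_eq_abs, sq_abs]
          nlinarith [this.1, this.2]
      _ = d * 1 := by simp
  refine h1.trans ?_
  rw [mul_one]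
  rcases Nat.eq_zero_or_pos d with rfl | hd
  · simp
  · have : (1 : ℝ) ≤ d := by exact_mod_cast hd
    exact Real.sqrt_le_iff.2 ⟨by linarith, by nlinarith⟩

theorem integrableOn_cell_norm_rpow {d : ℕ} {α : ℝ} (hα : 0 < α) (hαd : α < d) :
    IntegrableOn (fun y : EuclideanSpace ℝ (Fin d) => ‖y‖ ^ (α - (d : ℝ))) (cell d) := by
  refine ((integrable_indicator_norm_rpow hα hαd (d + 1)).integrableOn (s := cell d)).congr_fun
    (fun y hy => ?_) (measurableSet_cell d)
  have := norm_le_of_mem_cell (cell_subset_closedCell d hy)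
  exact indicator_of_mem (by simp only [mem_Iio]; linarith) _

theorem integrableOn_cell_rieszKernel {d : ℕ} {α : ℝ} (hα : 0 < α) (hαd : α < d) :
    IntegrableOn (rieszKernel (d := d) α) (cell d) :=
  (integrableOn_cell_norm_rpow hα hαd).const_mul _

/-- The integral of `∂_i F` over the unit cube vanishes if `F` is `C¹` and takes the same values on
the two faces orthogonal to `e_i`. -/
theorem setIntegral_partialX_eq_zero {d : ℕ} {F : EuclideanSpace ℝ (Fin d) → ℝ} (hF : ContDiff ℝ 1 F)
    (i : Fin d) (hf : ∀ x : EuclideanSpace ℝ (Fin d), x i = -(1 / 2) →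
      F (x + EuclideanSpace.single i (1 : ℝ)) = F x) :
    ∫ x in cell d, partialX i F x = 0 := by
  obtain ⟨n, rfl⟩ : ∃ n, d = n + 1 := ⟨d - 1, by have := i.pos; omega⟩
  have hcell : ∫ x in cell (n + 1), partialX i F x
      = ∫ x in univ.pi fun _ : Fin (n + 1) => Ioo (-(1 / 2) : ℝ) (1 / 2),
          partialX i F (WithLp.toLp 2 x) := by
    have h := (PiLp.volume_preserving_toLp (Fin (n + 1))).setIntegral_preimage_emb
      (MeasurableEquiv.toLp 2 (Fin (n + 1) → ℝ)).measurableEmbedding (partialX i F) (cell (n + 1))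
    rw [← h]
    congr 2
    ext x; simp [cell, mem_pi]
  have hIcc : Icc (fun _ : Fin (n + 1) => -(1 / 2) : Fin (n + 1) → ℝ) (fun _ => 1 / 2)
      =ᵐ[volume] univ.pi fun _ : Fin (n + 1) => Ioo (-(1 / 2) : ℝ) (1 / 2) := by
    rw [volume_pi]; exact Measure.univ_pi_Ioo_ae_eq_Icc.symm
  rw [hcell, ← setIntegral_congr_set hIcc]
  set T : (Fin (n + 1) → ℝ) →L[ℝ] EuclideanSpace ℝ (Fin (n + 1)) :=
    (EuclideanSpace.equiv (Fin (n + 1)) ℝ).symm.toContinuousLinearMap with hT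
  have hTx : ∀ x, T x = WithLp.toLp 2 x := fun x => rfl
  have hG : ContDiff ℝ 1 (fun x => F (T x)) := hF.comp T.contDiff
  -- The divergence theorem for the field whose only nonzero component is `F`, in direction `i`:
  -- only the two faces orthogonal to `e_i` contribute, and they cancel by `hf`.
  have key := integral_divergence_of_hasFDerivAt_off_countable'
    (fun _ : Fin (n + 1) => (-(1 / 2) : ℝ)) (fun _ => 1 / 2) (fun _ => by norm_num)
    (fun j x => if j = i then F (T x) else 0)
    (fun j x => if j = i then fderiv ℝ (fun x => F (T x)) x else 0) ∅ countable_empty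
    (fun j => by
      by_cases hj : j = i
      · simp only [hj, if_true]; exact hG.continuous.continuousOn
      · simp only [hj, if_false]; exact continuousOn_const)
    (fun x _ j => by
      by_cases hj : j = i
      · simp only [hj, if_true]; exact (hG.differentiable one_ne_zero x).hasFDerivAt
      · simp only [hj, if_false]; exact hasFDerivAt_const _ _)
  have hsum : ∀ x : Fin (n + 1) → ℝ, ∑ j, (if j = i then fderiv ℝ (fun x => F (T x)) x else 0)
      (Pi.single j 1) = partialX i F (WithLp.toLp 2 x) := by
    intro x
    rw [Finset.sum_eq_single i (fun j _ hj => by simp [hj]) (by simp), if_pos rfl, partialX]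
    have h := (hF.differentiable one_ne_zero (T x)).hasFDerivAt.comp x T.hasFDerivAt
    have h2 : fderiv ℝ (fun x => F (T x)) x = (fderiv ℝ F (T x)).comp T := h.fderiv
    rw [h2]
    rfl
  simp only [hsum] at key
  rw [key]
  · refine Finset.sum_eq_zero fun j _ => ?_
    by_cases hj : j = i
    · subst hj
      simp only [if_true]
      rw [sub_eq_zero]
      congr 1
      funext x
      rw [← hf (T (j.insertNth (-(1 / 2)) x)) (by simp [hTx])]
      congr 1
      ext k
      simp only [hTx, PiLp.add_apply, PiLp.single_apply]
      rcases Fin.eq_self_or_eq_succAbove j k with rfl | ⟨l, rfl⟩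
      · simp; norm_num
      · simp
    · simp [hj]
  · refine ContinuousOn.integrableOn_compact isCompact_Icc (Continuous.continuousOn ?_)
    have h1 : Continuous (fderiv ℝ F) := hF.continuous_fderiv one_ne_zero
    have h2 : Continuous fun x : Fin (n + 1) → ℝ => fderiv ℝ F (T x) := h1.comp T.continuous
    exact h2.clm_apply continuous_const

end EulerRiesz

/-! ### The absolute interaction energy and its bound by a mixed power gauge -/

namespace EulerRiesz

open scoped ENNReal

/-- The homogeneous kernel `|y|^(α - d)`, with values in `[0, ∞]`. -/
noncomputable def singularWeight {d : ℕ} (α : ℝ) (y : EuclideanSpace ℝ (Fin d)) : ℝ≥0∞ :=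
  ENNReal.ofReal (‖y‖ ^ (α - (d : ℝ)))

theorem measurable_singularWeight {d : ℕ} (α : ℝ) : Measurable (singularWeight (d := d) α) := by
  unfold singularWeight
  fun_prop

theorem singularWeight_neg {d : ℕ} (α : ℝ) (y : EuclideanSpace ℝ (Fin d)) :
    singularWeight α (-y) = singularWeight α y := by
  simp [singularWeight]

/-- The interaction energy `∫∫ |g(x)| |g(x - y)| |y|^(α - d) dy dx` on the torus. -/
noncomputable def absInteraction {d : ℕ} (α : ℝ) (g : EuclideanSpace ℝ (Fin d) → ℝ) : ℝ≥0∞ :=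
  ∫⁻ x in cell d, ∫⁻ y in cell d, singularWeight α y * (‖g x‖ₑ * ‖g (x - y)‖ₑ)

theorem lintegral_singularWeight_lt_top {d : ℕ} {α : ℝ} (hα : 0 < α) (hαd : α < d) :
    ∫⁻ y in cell d, singularWeight (d := d) α y < ∞ :=
  (integrableOn_cell_norm_rpow hα hαd).lintegral_lt_top

theorem AEStronglyMeasurable.comp_sub_prod_cell {d : ℕ} {F : Type*} [TopologicalSpace F]
    {g : EuclideanSpace ℝ (Fin d) → F} (hg : AEStronglyMeasurable g volume) :
    AEStronglyMeasurable (fun p : EuclideanSpace ℝ (Fin d) × EuclideanSpace ℝ (Fin d) =>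
      g (p.1 - p.2)) ((volume.restrict (cell d)).prod (volume.restrict (cell d))) := by
  refine hg.comp_quasiMeasurePreserving ?_
  refine (quasiMeasurePreserving_sub volume (volume.restrict (cell d))).mono_left ?_
  exact (Measure.absolutelyContinuous_of_le Measure.restrict_le_self).prod
    Measure.AbsolutelyContinuous.rfl

/-- Substitution `(x, y) ↦ (x - y, -y)` in a double integral over the torus. -/
theorem lintegral_lintegral_sub_swap {d : ℕ} {g : EuclideanSpace ℝ (Fin d) → ℝ}
    (hg : UnitPeriodic g) (hm : AEStronglyMeasurable g volume) (α : ℝ) {φ : ℝ≥0∞ → ℝ≥0∞ → ℝ≥0∞}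
    (hφ : Measurable (Function.uncurry φ)) :
    ∫⁻ x in cell d, ∫⁻ y in cell d, singularWeight α y * φ ‖g (x - y)‖ₑ ‖g x‖ₑ
      = ∫⁻ x in cell d, ∫⁻ y in cell d, singularWeight α y * φ ‖g x‖ₑ ‖g (x - y)‖ₑ := by
  have hm1 : AEMeasurable (fun p : EuclideanSpace ℝ (Fin d) × EuclideanSpace ℝ (Fin d) => ‖g p.1‖ₑ)
      ((volume.restrict (cell d)).prod (volume.restrict (cell d))) :=
    (hm.restrict.comp_quasiMeasurePreserving Measure.quasiMeasurePreserving_fst).enorm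
  have hm2 : AEMeasurable (fun p : EuclideanSpace ℝ (Fin d) × EuclideanSpace ℝ (Fin d) =>
      ‖g (p.1 - p.2)‖ₑ) ((volume.restrict (cell d)).prod (volume.restrict (cell d))) :=
    (AEStronglyMeasurable.comp_sub_prod_cell hm).enorm
  have hk : AEMeasurable (fun p : EuclideanSpace ℝ (Fin d) × EuclideanSpace ℝ (Fin d) =>
      singularWeight α p.2) ((volume.restrict (cell d)).prod (volume.restrict (cell d))) :=
    ((measurable_singularWeight α).comp measurable_snd).aemeasurable
  rw [lintegral_lintegral_swap
      (f := fun x y => singularWeight α y * φ ‖g (x - y)‖ₑ ‖g x‖ₑ)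
      (hk.mul (hφ.comp_aemeasurable (hm2.prodMk hm1))),
    lintegral_lintegral_swap
      (f := fun x y => singularWeight α y * φ ‖g x‖ₑ ‖g (x - y)‖ₑ)
      (hk.mul (hφ.comp_aemeasurable (hm1.prodMk hm2))),
    ← setLIntegral_cell_neg]
  refine lintegral_congr fun y => ?_
  have hp : UnitPeriodic fun x => singularWeight α y * φ ‖g x‖ₑ ‖g (x - y)‖ₑ := by
    refine hg.map₂ (hg.comp_add (-y)) (fun a b => singularWeight α y * φ ‖a‖ₑ ‖b‖ₑ)
  rw [← hp.setLIntegral_add y]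
  refine lintegral_congr fun x => ?_
  rw [singularWeight_neg, sub_neg_eq_add, add_sub_cancel_right]

/-- Write `st = max(s,t) min(s,t) ≤ s min(s,t) + t min(s,t)`; the two resulting double integrals
agree by `lintegral_lintegral_sub_swap`. -/
theorem absInteraction_le {d : ℕ} {g : EuclideanSpace ℝ (Fin d) → ℝ}
    (hg : UnitPeriodic g) (hm : AEStronglyMeasurable g volume) (α : ℝ) :
    absInteraction α g ≤ 2 * ∫⁻ x in cell d, ‖g x‖ₑ *
      ∫⁻ y in cell d, singularWeight α y * min ‖g x‖ₑ ‖g (x - y)‖ₑ := by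
  have hφ : Measurable (Function.uncurry fun s t : ℝ≥0∞ => s * min s t) := by
    unfold Function.uncurry; fun_prop
  have hm1 : AEMeasurable (fun p : EuclideanSpace ℝ (Fin d) × EuclideanSpace ℝ (Fin d) => ‖g p.1‖ₑ)
      ((volume.restrict (cell d)).prod (volume.restrict (cell d))) :=
    (hm.restrict.comp_quasiMeasurePreserving Measure.quasiMeasurePreserving_fst).enorm
  have hm2 : AEMeasurable (fun p : EuclideanSpace ℝ (Fin d) × EuclideanSpace ℝ (Fin d) =>
      ‖g (p.1 - p.2)‖ₑ) ((volume.restrict (cell d)).prod (volume.restrict (cell d))) :=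
    (AEStronglyMeasurable.comp_sub_prod_cell hm).enorm
  have hk : AEMeasurable (fun p : EuclideanSpace ℝ (Fin d) × EuclideanSpace ℝ (Fin d) =>
      singularWeight α p.2) ((volume.restrict (cell d)).prod (volume.restrict (cell d))) :=
    ((measurable_singularWeight α).comp measurable_snd).aemeasurable
  have hF : AEMeasurable (fun p : EuclideanSpace ℝ (Fin d) × EuclideanSpace ℝ (Fin d) =>
      singularWeight α p.2 * (‖g p.1‖ₑ * min ‖g p.1‖ₑ ‖g (p.1 - p.2)‖ₑ))
      ((volume.restrict (cell d)).prod (volume.restrict (cell d))) :=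
    hk.mul (hφ.comp_aemeasurable (hm1.prodMk hm2))
  have hF' : AEMeasurable (fun p : EuclideanSpace ℝ (Fin d) × EuclideanSpace ℝ (Fin d) =>
      singularWeight α p.2 * (‖g (p.1 - p.2)‖ₑ * min ‖g (p.1 - p.2)‖ₑ ‖g p.1‖ₑ))
      ((volume.restrict (cell d)).prod (volume.restrict (cell d))) :=
    hk.mul (hφ.comp_aemeasurable (hm2.prodMk hm1))
  calc absInteraction α g
      ≤ ∫⁻ p, (singularWeight α p.2 * (‖g p.1‖ₑ * min ‖g p.1‖ₑ ‖g (p.1 - p.2)‖ₑ)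
          + singularWeight α p.2 * (‖g (p.1 - p.2)‖ₑ * min ‖g (p.1 - p.2)‖ₑ ‖g p.1‖ₑ))
          ∂((volume.restrict (cell d)).prod (volume.restrict (cell d))) := by
        rw [absInteraction, lintegral_lintegral (hk.mul (hm1.mul hm2))]
        refine lintegral_mono fun p => ?_
        rw [← mul_add]
        gcongr
        rw [min_comm ‖g (p.1 - p.2)‖ₑ, ← add_mul]
        rw [← max_mul_min]
        gcongr
        exact max_le le_self_add le_add_self
    _ = (∫⁻ x in cell d, ∫⁻ y in cell d,
            singularWeight α y * (‖g x‖ₑ * min ‖g x‖ₑ ‖g (x - y)‖ₑ))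
          + ∫⁻ x in cell d, ∫⁻ y in cell d,
            singularWeight α y * (‖g (x - y)‖ₑ * min ‖g (x - y)‖ₑ ‖g x‖ₑ) := by
        rw [lintegral_add_left' hF, lintegral_prod _ hF, lintegral_prod _ hF']
    _ = 2 * ∫⁻ x in cell d, ∫⁻ y in cell d,
            singularWeight α y * (‖g x‖ₑ * min ‖g x‖ₑ ‖g (x - y)‖ₑ) := by
        rw [two_mul]
        congr 1
        exact lintegral_lintegral_sub_swap hg hm α hφ
    _ = _ := by
        congr 1
        refine lintegral_congr fun x => ?_
        rw [← lintegral_const_mul' _ _ (by simp)]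
        refine lintegral_congr fun y => ?_
        ring

/-- Splitting the kernel at the radius `r`. -/
theorem exists_lintegral_min_le {d : ℕ} {α : ℝ} (hα : 0 < α) (hαd : α < d) :
    ∃ c : ℝ, 0 < c ∧ ∀ (g : EuclideanSpace ℝ (Fin d) → ℝ) (N s : ℝ), UnitPeriodic g → 0 < N → 0 < s →
      ∫⁻ x in cell d, ‖g x‖ₑ ≤ ENNReal.ofReal N → ∀ x,
      ∫⁻ y in cell d, singularWeight α y * min (ENNReal.ofReal s) ‖g (x - y)‖ₑ
        ≤ ENNReal.ofReal (c * N ^ (α / (d : ℝ)) * s ^ (1 - α / (d : ℝ))) := by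
  obtain ⟨c, hc, hball⟩ := exists_lintegral_ball_norm_rpow_le hα hαd
  have hd : (0 : ℝ) < d := hα.trans hαd
  refine ⟨c + 1, by linarith, fun g N s hg hN hs hgN x => ?_⟩
  -- With `r^d = N / s` the near part `r^α s` and the far part `r^(α-d) N` both equal `N^(α/d)
  -- s^(1-α/d)`.
  set r : ℝ := (N / s) ^ (1 / (d : ℝ)) with hr
  have hr0 : 0 < r := by positivity
  have hshift : ∫⁻ y in cell d, ‖g (x - y)‖ₑ = ∫⁻ y in cell d, ‖g y‖ₑ := by
    rw [← setLIntegral_cell_neg, ← (hg.map (fun a => ‖a‖ₑ)).setLIntegral_add x]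
    simp only [sub_neg_eq_add, add_comm x]
  have hpt : ∀ y, singularWeight α y * min (ENNReal.ofReal s) ‖g (x - y)‖ₑ
      ≤ (Metric.ball (0 : EuclideanSpace ℝ (Fin d)) r).indicator (singularWeight α) y
          * ENNReal.ofReal s + ENNReal.ofReal (r ^ (α - (d : ℝ))) * ‖g (x - y)‖ₑ := by
    intro y
    by_cases hy : y ∈ Metric.ball (0 : EuclideanSpace ℝ (Fin d)) r
    · rw [indicator_of_mem hy]
      exact (mul_le_mul_right (min_le_left _ _) _).trans le_self_add
    · refine le_trans ?_ le_add_self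
      gcongr
      · apply ENNReal.ofReal_le_ofReal
        have : r ≤ ‖y‖ := by simpa using hy
        exact Real.rpow_le_rpow_of_nonpos hr0 this (by linarith)
      · exact min_le_right _ _
  calc _ ≤ _ := lintegral_mono hpt
    _ = (∫⁻ y in cell d, (Metric.ball (0 : EuclideanSpace ℝ (Fin d)) r).indicator
          (singularWeight α) y) * ENNReal.ofReal s
        + ENNReal.ofReal (r ^ (α - (d : ℝ))) * ∫⁻ y in cell d, ‖g y‖ₑ := by
        rw [lintegral_add_left, lintegral_mul_const, lintegral_const_mul' _ _ (by simp), hshift]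
        · exact (measurable_singularWeight α).indicator measurableSet_ball
        · exact ((measurable_singularWeight α).indicator measurableSet_ball).mul_const _
    _ ≤ ENNReal.ofReal (c * r ^ α) * ENNReal.ofReal s
        + ENNReal.ofReal (r ^ (α - (d : ℝ))) * ENNReal.ofReal N := by
        gcongr
        refine (setLIntegral_le_lintegral _ _).trans ?_
        rw [lintegral_indicator measurableSet_ball]
        exact hball r hr0
    _ = _ := by
        rw [← ENNReal.ofReal_mul (by positivity), ← ENNReal.ofReal_mul (by positivity),
          ← ENNReal.ofReal_add (by positivity) (by positivity)]
        congr 1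
        have h1 : r ^ α = N ^ (α / (d : ℝ)) * s ^ (-(α / (d : ℝ))) := by
          rw [hr, ← Real.rpow_mul (by positivity), Real.div_rpow hN.le hs.le, Real.rpow_neg hs.le,
            div_eq_mul_inv]
          congr 2 <;> ring_nf
        have h2 : r ^ (α - (d : ℝ)) = N ^ (α / (d : ℝ)) * s ^ (-(α / (d : ℝ))) * (s / N) := by
          rw [Real.rpow_sub hr0, h1, Real.rpow_natCast]
          have : r ^ d = N / s := by
            rw [hr, ← Real.rpow_natCast, ← Real.rpow_mul (by positivity),
              one_div_mul_cancel hd.ne', Real.rpow_one]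
          rw [this]
          field_simp
        have h3 : s ^ (1 - α / (d : ℝ)) = s * s ^ (-(α / (d : ℝ))) := by
          rw [sub_eq_add_neg, Real.rpow_add hs, Real.rpow_one]
        rw [h1, h2, h3]
        field_simp

/-- The gauge equal to `s²` for `s ≤ R` and to `s^γ` for `s > R`. -/
noncomputable def gauge (γ R s : ℝ) : ℝ := if s ≤ R then s ^ 2 else s ^ γ

/-- After `absInteraction_le` the bound is pointwise in `x`. For `|g x| ≤ R` the minimum is replaced
by `|g x|`, which gives a multiple of `|g x|²`. For `|g x| > R` the truncated kernel estimate at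
height `s = |g x|` gives a multiple of `|g x|^(2-α/d)`. -/
theorem exists_absInteraction_le_gauge {d : ℕ} {α γ : ℝ} (hα : 0 < α) (hαd : α < d)
    (hγ : 2 - α / (d : ℝ) ≤ γ) {N R : ℝ} (hN : 0 < N) (hR : 1 ≤ R) :
    ∃ C : ℝ, 0 < C ∧ ∀ g : EuclideanSpace ℝ (Fin d) → ℝ, UnitPeriodic g →
      AEStronglyMeasurable g volume → ∫⁻ x in cell d, ‖g x‖ₑ ≤ ENNReal.ofReal N →
      absInteraction α g ≤ ∫⁻ x in cell d, ENNReal.ofReal (C * gauge γ R |g x|) := by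
  obtain ⟨c, hc, hmin⟩ := exists_lintegral_min_le hα hαd
  set A := (∫⁻ y in cell d, singularWeight (d := d) α y).toReal
  have hA : ∫⁻ y in cell d, singularWeight (d := d) α y = ENNReal.ofReal A :=
    (ENNReal.ofReal_toReal (lintegral_singularWeight_lt_top hα hαd).ne).symm
  have hA0 : 0 ≤ A := ENNReal.toReal_nonneg
  set B := c * N ^ (α / (d : ℝ))
  have hB : 0 < B := by positivity
  refine ⟨2 * (A + B), by linarith, fun g hg hm hgN => (absInteraction_le hg hm α).trans ?_⟩
  rw [← lintegral_const_mul' _ _ (by simp)]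
  refine lintegral_mono fun x => ?_
  have hgx : ‖g x‖ₑ = ENNReal.ofReal |g x| := by rw [← Real.norm_eq_abs, ofReal_norm]
  have hkey : ‖g x‖ₑ * ∫⁻ y in cell d, singularWeight α y * min ‖g x‖ₑ ‖g (x - y)‖ₑ
      ≤ ENNReal.ofReal ((A + B) * gauge γ R |g x|) := by
    rcases (abs_nonneg (g x)).eq_or_lt with h0 | h0
    · rw [hgx, ← h0]; simp
    by_cases hle : |g x| ≤ R
    · calc _ ≤ ‖g x‖ₑ * ∫⁻ y in cell d, singularWeight α y * ‖g x‖ₑ := by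
            gcongr; exact min_le_left _ _
        _ = ENNReal.ofReal (A * |g x| ^ 2) := by
            rw [lintegral_mul_const' _ _ (by simp), hA, hgx, ← ENNReal.ofReal_mul hA0,
              ← ENNReal.ofReal_mul h0.le]
            congr 1; ring
        _ ≤ _ := by
            apply ENNReal.ofReal_le_ofReal
            rw [gauge, if_pos hle]
            have := sq_nonneg |g x|
            nlinarith
    -- Since the base exceeds `R ≥ 1`, the exponent `2 - α/d` may be raised to `γ`: this is where
    -- the lower bound on `γ` enters.
    · have h1 : 1 ≤ |g x| := by linarith
      calc _ ≤ ENNReal.ofReal |g x| * ENNReal.ofReal (B * |g x| ^ (1 - α / (d : ℝ))) := by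
            rw [hgx]; gcongr; exact hmin g N |g x| hg hN h0 hgN x
        _ = ENNReal.ofReal (B * |g x| ^ (2 - α / (d : ℝ))) := by
            rw [← ENNReal.ofReal_mul h0.le]
            congr 1
            rw [show 2 - α / (d : ℝ) = 1 + (1 - α / (d : ℝ)) by ring, Real.rpow_add h0, Real.rpow_one]
            ring
        _ ≤ _ := by
            apply ENNReal.ofReal_le_ofReal
            rw [gauge, if_neg hle]
            have h2 := Real.rpow_le_rpow_of_exponent_le h1 hγ
            have h3 : 0 ≤ |g x| ^ γ := by positivity
            nlinarith
  calc _ ≤ 2 * ENNReal.ofReal ((A + B) * gauge γ R |g x|) := by gcongr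
    _ = _ := by
      rw [← ENNReal.ofReal_ofNat, ← ENNReal.ofReal_mul (by norm_num)]
      congr 1; ring

end EulerRiesz

/-! ### Coercivity of the relative internal energy -/

namespace EulerRiesz

theorem relInternalEnergy_eq (γ s σ : ℝ) :
    relInternalEnergy γ s σ = 1 / (γ - 1) * (s ^ γ - σ ^ γ - γ * σ ^ (γ - 1) * (s - σ)) := by
  unfold relInternalEnergy internalEnergy internalEnergy'
  ring

/-- On a compact interval away from zero the second derivative of `x^γ` has a positive minimum,
called `2c`. Hence `x^γ - c x²` is convex there, and its tangent line inequality at `σ` is the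
claim. -/
theorem exists_sq_le_rpow_sub_tangent {γ a b : ℝ} (hγ : 1 < γ) (ha : 0 < a) (hab : a ≤ b) :
    ∃ c : ℝ, 0 < c ∧ ∀ σ ∈ Icc a b, ∀ μ ∈ Icc a b,
      c * (μ - σ) ^ 2 ≤ μ ^ γ - σ ^ γ - γ * σ ^ (γ - 1) * (μ - σ) := by
  obtain ⟨c, hc, hcle⟩ : ∃ c : ℝ, 0 < c ∧ ∀ x ∈ Icc a b, 2 * c ≤ γ * (γ - 1) * x ^ (γ - 1 - 1) := by
    have hcont : ContinuousOn (fun x : ℝ => γ * (γ - 1) * x ^ (γ - 1 - 1)) (Icc a b) :=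
      continuousOn_const.mul (continuousOn_id.rpow_const
        fun x hx => Or.inl (ha.trans_le hx.1).ne')
    obtain ⟨x0, hx0, hmin⟩ := isCompact_Icc.exists_isMinOn (nonempty_Icc.2 hab) hcont
    have hx00 : 0 < x0 := ha.trans_le hx0.1
    have hg : 0 < γ - 1 := by linarith
    have hpos : 0 < γ * (γ - 1) * x0 ^ (γ - 1 - 1) := by positivity
    exact ⟨_, half_pos hpos, fun x hx => by rw [mul_div_cancel₀ _ two_ne_zero]; exact hmin hx⟩
  refine ⟨c, hc, ?_⟩
  have hd : ∀ x : ℝ, HasDerivAt (fun x : ℝ => x ^ γ - c * x ^ 2) (γ * x ^ (γ - 1) - c * (2 * x)) x := by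
    intro x
    have h1 := Real.hasDerivAt_rpow_const (x := x) (p := γ) (Or.inr hγ.le)
    have h2 := (hasDerivAt_pow 2 x).const_mul c
    simp only [Nat.cast_ofNat, Nat.add_one_sub_one, pow_one] at h2
    exact h1.sub h2
  have hconv : ConvexOn ℝ (Icc a b) fun x : ℝ => x ^ γ - c * x ^ 2 := by
    refine convexOn_of_hasDerivWithinAt2_nonneg (convex_Icc a b)
      (f' := fun x => γ * x ^ (γ - 1) - c * (2 * x))
      (f'' := fun x => γ * (γ - 1) * x ^ (γ - 1 - 1) - 2 * c)
      (fun x _ => (hd x).continuousAt.continuousWithinAt)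
      (fun x _ => (hd x).hasDerivWithinAt) (fun x hx => ?_) (fun x hx => ?_)
    · have hx0 : x ≠ 0 := (ha.trans_le (interior_subset hx).1).ne'
      have h1 := (Real.hasDerivAt_rpow_const (x := x) (p := γ - 1) (Or.inl hx0)).const_mul γ
      have h2 := ((hasDerivAt_id x).const_mul 2).const_mul c
      refine HasDerivAt.hasDerivWithinAt ((h1.sub h2).congr_deriv ?_)
      ring
    · linarith [hcle x (interior_subset hx)]
  intro σ hσ μ hμ
  rcases lt_trichotomy σ μ with h | h | h
  · have h1 := hconv.le_slope_of_hasDerivAt hσ hμ h (hd σ)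
    rw [slope_def_field, le_div_iff₀ (by linarith)] at h1
    nlinarith
  · subst h; simp
  · have h1 := hconv.slope_le_of_hasDerivAt hμ hσ h (hd σ)
    rw [slope_def_field, div_le_iff₀ (by linarith)] at h1
    nlinarith

/-- For `|s - σ| ≤ R` the difficulty is that `s` may approach zero, where `h''` degenerates if `γ >
2`; comparing at the midpoint of `s` and `σ`, which is at least `δ/2`, avoids it. For `|s - σ| > R`
necessarily `s` is much larger than `σ`, and the term `s^γ` absorbs the linear term. -/
theorem exists_gauge_le_relInternalEnergy {γ δ M : ℝ} (hγ : 1 < γ) (hδ : 0 < δ) :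
    ∃ R c : ℝ, 1 ≤ R ∧ 0 < c ∧ ∀ s σ : ℝ, 0 ≤ s → δ ≤ σ → σ ≤ M →
      c * gauge γ R |s - σ| ≤ relInternalEnergy γ s σ := by
  have hg : 0 < γ - 1 := by linarith
  -- Chosen so that `σ ≤ s / z` gives `γ σ^(γ-1) s ≤ s^γ / 2`; the threshold `R ≥ z |M|` then forces
  -- `σ ≤ s / z`.
  set z : ℝ := (2 * γ) ^ (1 / (γ - 1)) with hz
  have hz0 : 0 < z := by positivity
  have hzp : z ^ (γ - 1) = 2 * γ := by
    rw [hz, ← Real.rpow_mul (by positivity), one_div_mul_cancel hg.ne', Real.rpow_one]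
  set R : ℝ := z * |M| + |M| + 1 with hR
  have hzM : 0 ≤ z * |M| := by positivity
  have hR1 : 1 ≤ R := by linarith [abs_nonneg M]
  obtain ⟨c, hc, hquad⟩ := exists_sq_le_rpow_sub_tangent (a := δ / 2) (b := δ + |M| + R) hγ
    (by linarith) (by linarith [abs_nonneg M])
  refine ⟨R, min (1 / (γ - 1) * (c / 2)) (1 / (γ - 1) * (1 / 2)), hR1, by positivity,
    fun s σ hs hδσ hσM => ?_⟩
  have hσ : 0 < σ := hδ.trans_le hδσ
  have hM : 0 < M := hσ.trans_le hσM
  rw [abs_of_pos hM] at hR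
  rw [abs_of_pos hM] at hquad hzM
  rw [relInternalEnergy_eq, gauge]
  split_ifs with h
  -- With `D(s) = s^γ - σ^γ - γ σ^(γ-1)(s - σ)` and midpoint `μ`, convexity gives `D(s) ≥ 2 D(μ) ≥
  -- 2c ((s-σ)/2)²`, whence the constant `c/2`.
  · have hm := hquad σ ⟨by linarith, by linarith⟩ ((s + σ) / 2)
      ⟨by linarith, by linarith [(abs_le.1 h).2]⟩
    have hcv := (convexOn_rpow hγ.le).2 (mem_Ici.2 hs) (mem_Ici.2 hσ.le)
      (show (0 : ℝ) ≤ 1 / 2 by norm_num) (show (0 : ℝ) ≤ 1 / 2 by norm_num) (by norm_num)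
    simp only [smul_eq_mul] at hcv
    rw [show 1 / 2 * s + 1 / 2 * σ = (s + σ) / 2 by ring] at hcv
    rw [sq_abs]
    calc _ ≤ 1 / (γ - 1) * (c / 2) * (s - σ) ^ 2 := by gcongr; exact min_le_left _ _
      _ = 1 / (γ - 1) * (c / 2 * (s - σ) ^ 2) := by ring
      _ ≤ _ := by
        gcongr
        have e : ((s + σ) / 2 - σ) = (s - σ) / 2 := by ring
        rw [e] at hm
        linarith
  · have h' : R < |s - σ| := not_le.1 h
    -- If `s ≤ σ` then `|s - σ| ≤ σ ≤ M < R`, a contradiction.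
    have hpos : 0 < s - σ := by
      by_contra hneg
      rw [abs_of_nonpos (not_lt.1 hneg)] at h'
      linarith
    rw [abs_of_pos hpos] at h' ⊢
    have hs0 : 0 < s := by linarith
    have hσs : σ ≤ s / z := by
      rw [le_div_iff₀ hz0]
      nlinarith
    calc _ ≤ 1 / (γ - 1) * (1 / 2) * (s - σ) ^ γ := by gcongr; exact min_le_right _ _
      _ ≤ 1 / (γ - 1) * (1 / 2 * s ^ γ) := by
        rw [mul_assoc]; gcongr; linarith
      _ ≤ _ := by
        gcongr
        have h1 : σ ^ (γ - 1) ≤ (s / z) ^ (γ - 1) := Real.rpow_le_rpow hσ.le hσs hg.le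
        rw [Real.div_rpow hs0.le hz0.le, hzp] at h1
        have e1 : s ^ γ = s ^ (γ - 1) * s := by
          rw [← Real.rpow_add_one hs0.ne', sub_add_cancel]
        have e2 : σ ^ γ = σ ^ (γ - 1) * σ := by
          rw [← Real.rpow_add_one hσ.ne', sub_add_cancel]
        have h2 : γ * σ ^ (γ - 1) * s ≤ 1 / 2 * s ^ γ := by
          rw [e1]
          calc γ * σ ^ (γ - 1) * s ≤ γ * (s ^ (γ - 1) / (2 * γ)) * s := by gcongr
            _ = _ := by field_simp
        have h3 : 0 ≤ (γ - 1) * σ ^ γ := by positivity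
        rw [e2] at h3 ⊢
        nlinarith

/-- The gauge bound with both bounds on the reference density taken equal to `σ`. -/
theorem relInternalEnergy_nonneg {γ : ℝ} (hγ : 1 < γ) {s σ : ℝ} (hs : 0 ≤ s) (hσ : 0 < σ) :
    0 ≤ relInternalEnergy γ s σ := by
  obtain ⟨R, c, _, hc, h⟩ := exists_gauge_le_relInternalEnergy (M := σ) hγ hσ
  refine le_trans (mul_nonneg hc.le ?_) (h s σ hs le_rfl le_rfl)
  unfold gauge
  split_ifs <;> positivity

end EulerRiesz

/-! ### Existence of the interaction constant -/

namespace EulerRiesz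

theorem integrableOn_relInternalEnergy {d : ℕ} {γ δ M : ℝ} (hγ : 1 < γ) (hδ : 0 < δ)
    {ρ σ : EuclideanSpace ℝ (Fin d) → ℝ}
    (hρ : MemLp ρ (ENNReal.ofReal γ) (volume.restrict (cell d)))
    (hσ : MemLp σ ⊤ (volume.restrict (cell d))) (hρ0 : ∀ x, 0 ≤ ρ x)
    (hσM : ∀ x, δ ≤ σ x ∧ σ x ≤ M) :
    IntegrableOn (fun x => relInternalEnergy γ (ρ x) (σ x)) (cell d) := by
  have hρ1 : Integrable ρ (volume.restrict (cell d)) :=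
    hρ.integrable (by rw [← ENNReal.ofReal_one]; exact ENNReal.ofReal_le_ofReal hγ.le)
  have hσ1 : Integrable σ (volume.restrict (cell d)) := hσ.integrable le_top
  have hργ : Integrable (fun x => ρ x ^ γ) (volume.restrict (cell d)) := by
    have h := hρ.integrable_norm_rpow (by simp; linarith) ENNReal.ofReal_ne_top
    rw [ENNReal.toReal_ofReal (by linarith)] at h
    refine h.congr (Filter.Eventually.of_forall fun x => ?_)
    simp only [Real.norm_eq_abs, abs_of_nonneg (hρ0 x)]
  have hpow : ∀ p : ℝ, 0 ≤ p → AEStronglyMeasurable (fun x => σ x ^ p) (volume.restrict (cell d)) ∧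
      ∀ x, ‖σ x ^ p‖ ≤ M ^ p := by
    intro p hp
    refine ⟨(hσ1.aemeasurable.pow_const p).aestronglyMeasurable, fun x => ?_⟩
    have h0 : 0 ≤ σ x := hδ.le.trans (hσM x).1
    rw [Real.norm_eq_abs, abs_of_nonneg (by positivity)]
    exact Real.rpow_le_rpow h0 (hσM x).2 hp
  have hσγ : Integrable (fun x => σ x ^ γ) (volume.restrict (cell d)) :=
    Integrable.of_bound (hpow γ (by linarith)).1 _
      (Filter.Eventually.of_forall (hpow γ (by linarith)).2)
  have hmix : Integrable (fun x => σ x ^ (γ - 1) * (ρ x - σ x)) (volume.restrict (cell d)) :=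
    (hρ1.sub hσ1).bdd_mul (hpow (γ - 1) (by linarith)).1
      (Filter.Eventually.of_forall (hpow (γ - 1) (by linarith)).2)
  refine (((hργ.sub hσγ).sub (hmix.const_mul γ)).const_mul (1 / (γ - 1))).congr
    (Filter.Eventually.of_forall fun x => ?_)
  simp only [Pi.sub_apply, relInternalEnergy_eq]
  ring

/-- The interaction energy of `ρ - σ` is controlled by the relative internal energy. -/
theorem exists_absInteraction_le {d : ℕ} {α γ δ : ℝ} (hα : 0 < α) (hαd : α < d)
    (hγ : 2 - α / (d : ℝ) ≤ γ) (M m : ℝ) (hδ : 0 < δ) :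
    ∃ C : ℝ, 0 < C ∧ ∀ ρ σ : EuclideanSpace ℝ (Fin d) → ℝ,
      UnitPeriodic ρ → UnitPeriodic σ →
      MemLp ρ (ENNReal.ofReal γ) (volume.restrict (cell d)) →
      MemLp σ ⊤ (volume.restrict (cell d)) →
      (∀ x, 0 ≤ ρ x) → (∀ x, δ ≤ σ x ∧ σ x ≤ M) → ∫ x in cell d, ρ x ≤ m →
      absInteraction α (fun x => ρ x - σ x)
        ≤ ENNReal.ofReal (C * totalRelInternalEnergy γ ρ σ) := by
  have hd : (0 : ℝ) < d := hα.trans hαd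
  have hγ1 : 1 < γ := by
    have : α / d < 1 := (div_lt_one hd).2 hαd
    linarith
  obtain ⟨R, c, hR, hc, hgauge⟩ := exists_gauge_le_relInternalEnergy (M := M) hγ1 hδ
  -- A bound for the `L¹` norm of `ρ - σ`, from `|ρ - σ| ≤ ρ + |M|`; the added 1 makes it positive.
  set N : ℝ := |m| + |M| * volume.real (cell d) + 1
  have hN : 0 < N := by
    have : 0 ≤ |M| * volume.real (cell d) := by positivity
    linarith [abs_nonneg m]
  obtain ⟨C, hC, hint⟩ := exists_absInteraction_le_gauge hα hαd hγ hN hR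
  refine ⟨C / c, by positivity, fun ρ σ hρp hσp hρ hσ hρ0 hσM hm => ?_⟩
  have hρ1 : Integrable ρ (volume.restrict (cell d)) :=
    hρ.integrable (by rw [← ENNReal.ofReal_one]; exact ENNReal.ofReal_le_ofReal hγ1.le)
  have hσ1 : Integrable σ (volume.restrict (cell d)) := hσ.integrable le_top
  have hgp : UnitPeriodic fun x => ρ x - σ x := hρp.map₂ hσp (· - ·)
  have hgm : AEStronglyMeasurable (fun x => ρ x - σ x) volume :=
    hgp.aestronglyMeasurable (hρ1.sub hσ1).aestronglyMeasurable
  have hgN : ∫⁻ x in cell d, ‖ρ x - σ x‖ₑ ≤ ENNReal.ofReal N := by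
    have h1 := ofReal_integral_norm_eq_lintegral_enorm (hρ1.sub hσ1)
    simp only [Pi.sub_apply] at h1
    rw [← h1]
    apply ENNReal.ofReal_le_ofReal
    calc ∫ x in cell d, ‖ρ x - σ x‖ ≤ ∫ x in cell d, (ρ x + |M|) := by
          refine integral_mono (hρ1.sub hσ1).norm (hρ1.add (integrable_const _)) fun x => ?_
          have h0 : 0 ≤ σ x := hδ.le.trans (hσM x).1
          have h2 := (hσM x).2.trans (le_abs_self M)
          exact abs_le.2 ⟨by linarith [hρ0 x], by linarith [abs_nonneg M]⟩
      _ = (∫ x in cell d, ρ x) + |M| * volume.real (cell d) := by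
          rw [integral_add hρ1 (integrable_const _), setIntegral_const, smul_eq_mul, mul_comm]
      _ ≤ N := by linarith [le_abs_self m]
  refine (hint _ hgp hgm hgN).trans ?_
  rw [totalRelInternalEnergy, ← integral_const_mul, ofReal_integral_eq_lintegral_ofReal]
  · refine lintegral_mono fun x => ENNReal.ofReal_le_ofReal ?_
    have := hgauge (ρ x) (σ x) (hρ0 x) (hσM x).1 (hσM x).2
    calc C * gauge γ R |ρ x - σ x| = C / c * (c * gauge γ R |ρ x - σ x|) := by field_simp
      _ ≤ _ := by gcongr
  · exact (integrableOn_relInternalEnergy hγ1 hδ hρ hσ hρ0 hσM).const_mul _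
  · refine Filter.Eventually.of_forall fun x => ?_
    have := relInternalEnergy_nonneg hγ1 (hρ0 x) (hδ.trans_le (hσM x).1)
    positivity

/-- Moving absolute values inside the convolution costs only the factor `1/(d-α)` of the kernel. The
estimate is made for the extended nonnegative integral, so its finiteness also supplies the
integrability clause. -/
theorem isInteractionConstant_of_absInteraction_le {d : ℕ} {α γ C : ℝ} (hαd : α < d)
    {ρ σ : EuclideanSpace ℝ (Fin d) → ℝ} (hp : UnitPeriodic fun x => ρ x - σ x)
    (hm : AEStronglyMeasurable (fun x => ρ x - σ x) (volume.restrict (cell d)))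
    (hC : 0 ≤ C * totalRelInternalEnergy γ ρ σ)
    (h : absInteraction α (fun x => ρ x - σ x)
      ≤ ENNReal.ofReal (C * totalRelInternalEnergy γ ρ σ)) :
    IsInteractionConstant α γ (C / (d - α)) ρ σ := by
  have hda : 0 < (d : ℝ) - α := by linarith
  set g : EuclideanSpace ℝ (Fin d) → ℝ := fun x => ρ x - σ x
  have hgm : AEStronglyMeasurable g volume := hp.aestronglyMeasurable hm
  have hle : ∫⁻ x in cell d, ‖g x * rieszConv α g x‖ₑ
      ≤ ENNReal.ofReal (C / (d - α) * totalRelInternalEnergy γ ρ σ) := by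
    calc ∫⁻ x in cell d, ‖g x * rieszConv α g x‖ₑ
        ≤ ∫⁻ x in cell d, ENNReal.ofReal (1 / (d - α)) *
            ∫⁻ y in cell d, singularWeight α y * (‖g x‖ₑ * ‖g (x - y)‖ₑ) := by
          refine lintegral_mono fun x => ?_
          rw [enorm_mul]
          refine (mul_le_mul_right (enorm_integral_le_lintegral_enorm _) _).trans_eq ?_
          rw [← lintegral_const_mul' _ _ (by simp), ← lintegral_const_mul' _ _ (by simp)]
          refine lintegral_congr fun y => ?_
          rw [enorm_mul, rieszKernel, enorm_mul, singularWeight,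
            Real.enorm_of_nonneg (one_div_pos.2 hda).le,
            Real.enorm_of_nonneg (Real.rpow_nonneg (norm_nonneg y) _)]
          ring
      _ = ENNReal.ofReal (1 / (d - α)) * absInteraction α g := by
          rw [lintegral_const_mul' _ _ (by simp)]; rfl
      _ ≤ ENNReal.ofReal (1 / (d - α)) * ENNReal.ofReal (C * totalRelInternalEnergy γ ρ σ) := by
          gcongr
      _ = _ := by
          rw [← ENNReal.ofReal_mul (by positivity)]
          congr 1; ring
  have hmeas : AEStronglyMeasurable (fun x => g x * rieszConv α g x) (volume.restrict (cell d)) := by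
    refine hm.mul ?_
    have hk : AEStronglyMeasurable
        (fun p : EuclideanSpace ℝ (Fin d) × EuclideanSpace ℝ (Fin d) => rieszKernel α p.2)
        ((volume.restrict (cell d)).prod (volume.restrict (cell d))) := by
      unfold rieszKernel
      exact Measurable.aestronglyMeasurable (by fun_prop)
    exact (hk.mul (AEStronglyMeasurable.comp_sub_prod_cell hgm)).integral_prod_right'
  have hint : IntegrableOn (fun x => g x * rieszConv α g x) (cell d) :=
    ⟨hmeas, hle.trans_lt ENNReal.ofReal_lt_top⟩
  refine ⟨hint, ?_⟩
  rw [← ENNReal.ofReal_le_ofReal_iff (by rw [div_mul_eq_mul_div]; positivity)]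
  refine le_trans (le_of_eq ?_) hle
  exact ofReal_integral_norm_eq_lintegral_enorm hint

theorem totalRelInternalEnergy_nonneg {d : ℕ} {γ δ : ℝ} (hγ : 1 < γ) (hδ : 0 < δ)
    {ρ σ : EuclideanSpace ℝ (Fin d) → ℝ} (hρ0 : ∀ x, 0 ≤ ρ x) (hσ : ∀ x, δ ≤ σ x) :
    0 ≤ totalRelInternalEnergy γ ρ σ :=
  integral_nonneg fun x => relInternalEnergy_nonneg hγ (hρ0 x) (hδ.trans_le (hσ x))

theorem exists_isInteractionConstant {d : ℕ} {α γ δ : ℝ} (hα : 0 < α) (hαd : α < d)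
    (hγ : 2 - α / (d : ℝ) ≤ γ) (M m : ℝ) (hδ : 0 < δ) :
    ∃ C : ℝ, 0 < C ∧ ∀ ρ σ : EuclideanSpace ℝ (Fin d) → ℝ,
      UnitPeriodic ρ → UnitPeriodic σ →
      MemLp ρ (ENNReal.ofReal γ) (volume.restrict (cell d)) →
      MemLp σ ⊤ (volume.restrict (cell d)) →
      (∀ x, 0 ≤ ρ x) → (∀ x, δ ≤ σ x ∧ σ x ≤ M) → ∫ x in cell d, ρ x ≤ m →
      IsInteractionConstant α γ C ρ σ := by
  have hd : (0 : ℝ) < d := hα.trans hαd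
  have hγ1 : 1 < γ := by
    have : α / d < 1 := (div_lt_one hd).2 hαd
    linarith
  obtain ⟨C, hC, h⟩ := exists_absInteraction_le hα hαd hγ M m hδ
  refine ⟨C / (d - α), div_pos hC (by linarith), fun ρ σ hρp hσp hρ hσ hρ0 hσM hm => ?_⟩
  refine isInteractionConstant_of_absInteraction_le hαd (hρp.map₂ hσp (· - ·))
    (hρ.aestronglyMeasurable.sub hσ.aestronglyMeasurable) ?_
    (h ρ σ hρp hσp hρ hσ hρ0 hσM hm)
  exact mul_nonneg hC.le (totalRelInternalEnergy_nonneg hγ1 hδ hρ0 fun x => (hσM x).1)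

end EulerRiesz

/-! ### Integrals with a singular weight: continuity and differentiation in a parameter -/

namespace EulerRiesz

open scoped Topology

theorem exists_compact_nhdsWithin_of_isOpen {X : Type*} [NormedAddCommGroup X] [NormedSpace ℝ X]
    [FiniteDimensional ℝ X] {U : Set X} (hU : IsOpen U) :
    ∀ x ∈ U, ∃ K ∈ 𝓝[U] x, IsCompact K ∧ K ⊆ U := by
  have := FiniteDimensional.proper_real X
  intro x hx
  obtain ⟨K, hKx, hKU, hK⟩ := local_compact_nhds (hU.mem_nhds hx)
  exact ⟨K, mem_nhdsWithin_of_mem_nhds hKx, hK, hKU⟩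

theorem hasFDerivAt_left_of_contDiffOn {X Z : Type*} [NormedAddCommGroup X] [NormedSpace ℝ X]
    [NormedAddCommGroup Z] [NormedSpace ℝ Z] {U : Set X} {φ : X → Z → ℝ} (hU : IsOpen U)
    (hφ : ContDiffOn ℝ 1 (Function.uncurry φ) (U ×ˢ univ)) {x : X} (hx : x ∈ U) (z : Z) :
    HasFDerivAt (fun x => φ x z)
      ((fderiv ℝ (Function.uncurry φ) (x, z)).comp (ContinuousLinearMap.inl ℝ X Z)) x := by
  have h1 : HasFDerivAt (Function.uncurry φ) (fderiv ℝ (Function.uncurry φ) (x, z)) (x, z) :=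
    ((hφ.contDiffAt ((hU.prod isOpen_univ).mem_nhds ⟨hx, mem_univ z⟩)).differentiableAt
      one_ne_zero).hasFDerivAt
  exact HasFDerivAt.comp (f := fun y => (y, z)) x h1 (hasFDerivAt_prodMk_left x z)

theorem continuousOn_fderiv_left {X Z : Type*} [NormedAddCommGroup X] [NormedSpace ℝ X]
    [NormedAddCommGroup Z] [NormedSpace ℝ Z] {U : Set X} {φ : X → Z → ℝ} (hU : IsOpen U)
    (hφ : ContDiffOn ℝ 1 (Function.uncurry φ) (U ×ˢ univ)) :
    ContinuousOn (Function.uncurry fun x z => fderiv ℝ (fun x => φ x z) x) (U ×ˢ univ) := by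
  have h := hφ.continuousOn_fderiv_of_isOpen (hU.prod isOpen_univ) le_rfl
  have h2 : ContinuousOn (fun p : X × Z => (fderiv ℝ (Function.uncurry φ) p).comp
      (ContinuousLinearMap.inl ℝ X Z)) (U ×ˢ univ) := h.clm_comp continuousOn_const
  refine h2.congr fun p hp => ?_
  exact (hasFDerivAt_left_of_contDiffOn hU hφ hp.1 p.2).fderiv

theorem continuous_fderiv_left {X Z : Type*} [NormedAddCommGroup X] [NormedSpace ℝ X]
    [NormedAddCommGroup Z] [NormedSpace ℝ Z] {U : Set X} {φ : X → Z → ℝ} (hU : IsOpen U)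
    (hφ : ContDiffOn ℝ 1 (Function.uncurry φ) (U ×ˢ univ)) {x : X} (hx : x ∈ U) :
    Continuous fun z => fderiv ℝ (fun x => φ x z) x := by
  rw [← continuousOn_univ]
  exact (continuousOn_fderiv_left hU hφ).comp (f := fun z => (x, z)) (by fun_prop)
    fun z _ => ⟨hx, mem_univ _⟩

section ParametricIntegral

variable {Z : Type*} [NormedAddCommGroup Z] [MeasurableSpace Z] [BorelSpace Z]
  [SecondCountableTopology Z] {ν : Measure Z} {k : Z → ℝ} {C : Set Z}

theorem integrable_smul_of_ae_mem_compact {F : Type*} [NormedAddCommGroup F] [NormedSpace ℝ F]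
    (hk : Integrable k ν) (hC : IsCompact C) (hνC : ∀ᵐ z ∂ν, z ∈ C) {ψ : Z → F}
    (hψ : Continuous ψ) : Integrable (fun z => k z • ψ z) ν := by
  obtain ⟨B, hB⟩ := hC.exists_bound_of_continuousOn hψ.continuousOn
  refine (hk.norm.mul_const B).mono' (hk.aestronglyMeasurable.smul hψ.aestronglyMeasurable) ?_
  filter_upwards [hνC] with z hz
  rw [norm_smul]
  gcongr
  exact hB z hz

/-- The weight `k` carries the singularity and does not depend on the parameter, while `φ` is
bounded on `K × C`; so `‖k‖` times that bound dominates near `x`. Requiring only compact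
neighbourhoods within `S` covers both open sets and the time interval `[0, T)`. -/
theorem continuousOn_integral_smul_of_ae_mem_compact {X F : Type*} [TopologicalSpace X]
    [FirstCountableTopology X] [NormedAddCommGroup F] [NormedSpace ℝ F]
    (hk : Integrable k ν) (hC : IsCompact C) (hνC : ∀ᵐ z ∂ν, z ∈ C) {S : Set X}
    (hS : ∀ x ∈ S, ∃ K ∈ 𝓝[S] x, IsCompact K ∧ K ⊆ S) {φ : X → Z → F}
    (hφ : ContinuousOn (Function.uncurry φ) (S ×ˢ univ)) :
    ContinuousOn (fun x => ∫ z, k z • φ x z ∂ν) S := by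
  have hz : ∀ x ∈ S, Continuous (φ x) := fun x hx => by
    rw [← continuousOn_univ]
    exact hφ.comp (f := fun z => (x, z)) (by fun_prop) fun z _ => ⟨hx, mem_univ _⟩
  intro x hx
  obtain ⟨K, hKx, hK, hKS⟩ := hS x hx
  obtain ⟨B, hB⟩ := (hK.prod hC).exists_bound_of_continuousOn
    (hφ.mono (prod_mono hKS (subset_univ C)))
  refine continuousWithinAt_of_dominated (bound := fun z => ‖k z‖ * B) ?_ ?_
    (hk.norm.mul_const B) ?_
  · filter_upwards [self_mem_nhdsWithin] with y hy
    exact hk.aestronglyMeasurable.smul (hz y hy).aestronglyMeasurable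
  · filter_upwards [hKx] with y hy
    filter_upwards [hνC] with z hz
    rw [norm_smul]
    gcongr
    exact hB (y, z) ⟨hy, hz⟩
  · refine Filter.Eventually.of_forall fun z => ContinuousWithinAt.const_smul ?_ _
    exact (hφ (x, z) ⟨hx, mem_univ _⟩).comp (f := fun y => (y, z))
      (by fun_prop) fun y hy => ⟨hy, mem_univ _⟩

variable [NormedSpace ℝ Z] {X : Type*} [NormedAddCommGroup X] [NormedSpace ℝ X]
  {U : Set X} {φ : X → Z → ℝ}

variable [FiniteDimensional ℝ X]

/-- The derivative falls on `φ` only and is bounded on `K × C`, so the singular weight is never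
differentiated. The convolution, the tensor and the time derivatives of the energies are all
instances. -/
theorem hasFDerivAt_integral_mul_of_ae_mem_compact
    (hk : Integrable k ν) (hC : IsCompact C) (hνC : ∀ᵐ z ∂ν, z ∈ C) (hU : IsOpen U)
    (hφ : ContDiffOn ℝ 1 (Function.uncurry φ) (U ×ˢ univ)) {x : X} (hx : x ∈ U) :
    HasFDerivAt (fun x => ∫ z, k z * φ x z ∂ν) (∫ z, k z • fderiv ℝ (fun x => φ x z) x ∂ν) x := by
  have hz : ∀ x ∈ U, Continuous (φ x) := fun x hx => by
    rw [← continuousOn_univ]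
    exact hφ.continuousOn.comp (f := fun z => (x, z)) (by fun_prop) fun z _ => ⟨hx, mem_univ _⟩
  obtain ⟨K, hKx, hK, hKU⟩ := exists_compact_nhdsWithin_of_isOpen hU x hx
  rw [hU.nhdsWithin_eq hx] at hKx
  obtain ⟨B, hB⟩ := (hK.prod hC).exists_bound_of_continuousOn
    ((continuousOn_fderiv_left hU hφ).mono (prod_mono hKU (subset_univ C)))
  refine hasFDerivAt_integral_of_dominated_of_fderiv_le
    (F' := fun x z => k z • fderiv ℝ (fun x => φ x z) x) (bound := fun z => ‖k z‖ * B) hKx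
    ?_ ?_ ?_ ?_ (hk.norm.mul_const B) ?_
  · filter_upwards [hU.mem_nhds hx] with y hy
    exact hk.aestronglyMeasurable.mul (hz y hy).aestronglyMeasurable
  · exact integrable_smul_of_ae_mem_compact hk hC hνC (hz x hx)
  · exact hk.aestronglyMeasurable.smul (continuous_fderiv_left hU hφ hx).aestronglyMeasurable
  · filter_upwards [hνC] with z hz y hy
    rw [norm_smul]
    gcongr
    exact hB (y, z) ⟨hy, hz⟩
  · refine Filter.Eventually.of_forall fun z y hy => ?_
    exact (hasFDerivAt_left_of_contDiffOn hU hφ (hKU hy) z).differentiableAt.hasFDerivAt.const_mul _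

theorem contDiffOn_integral_mul_of_ae_mem_compact
    (hk : Integrable k ν) (hC : IsCompact C) (hνC : ∀ᵐ z ∂ν, z ∈ C) (hU : IsOpen U)
    (hφ : ContDiffOn ℝ 1 (Function.uncurry φ) (U ×ˢ univ)) :
    ContDiffOn ℝ 1 (fun x => ∫ z, k z * φ x z ∂ν) U := by
  have h := fun x (hx : x ∈ U) => hasFDerivAt_integral_mul_of_ae_mem_compact hk hC hνC hU hφ hx
  rw [show (1 : WithTop ℕ∞) = 0 + 1 by rfl, contDiffOn_succ_iff_fderiv_of_isOpen hU]
  refine ⟨fun x hx => (h x hx).differentiableAt.differentiableWithinAt, by simp, ?_⟩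
  rw [contDiffOn_zero]
  refine (continuousOn_integral_smul_of_ae_mem_compact hk hC hνC
    (exists_compact_nhdsWithin_of_isOpen hU) (continuousOn_fderiv_left hU hφ)).congr ?_
  exact fun x hx => (h x hx).fderiv

theorem fderiv_integral_mul_apply
    (hk : Integrable k ν) (hC : IsCompact C) (hνC : ∀ᵐ z ∂ν, z ∈ C) (hU : IsOpen U)
    (hφ : ContDiffOn ℝ 1 (Function.uncurry φ) (U ×ˢ univ)) {x : X} (hx : x ∈ U) (v : X) :
    fderiv ℝ (fun x => ∫ z, k z * φ x z ∂ν) x v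
      = ∫ z, k z * fderiv ℝ (fun x => φ x z) x v ∂ν := by
  rw [(hasFDerivAt_integral_mul_of_ae_mem_compact hk hC hνC hU hφ hx).fderiv,
    ContinuousLinearMap.integral_apply]
  · rfl
  · exact integrable_smul_of_ae_mem_compact hk hC hνC (continuous_fderiv_left hU hφ hx)

end ParametricIntegral

end EulerRiesz

/-! ### Regularity of the Riesz potential -/

namespace EulerRiesz

open scoped Topology

theorem ae_mem_closedCell (d : ℕ) : ∀ᵐ y ∂volume.restrict (cell d), y ∈ closedCell d :=
  (ae_restrict_mem (measurableSet_cell d)).mono fun _ hy => cell_subset_closedCell d hy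

theorem partialX_comp_sub {d : ℕ} (f : EuclideanSpace ℝ (Fin d) → ℝ) (i : Fin d)
    (x y : EuclideanSpace ℝ (Fin d)) : partialX i (fun x => f (x - y)) x = partialX i f (x - y) := by
  simp only [partialX, sub_eq_add_neg]
  rw [fderiv_comp_add_right]

section RieszConv

variable {d : ℕ} {α : ℝ} {f : EuclideanSpace ℝ (Fin d) → ℝ}

theorem continuous_rieszConv (hα : 0 < α) (hαd : α < d) (hf : Continuous f) :
    Continuous (rieszConv α f) := by
  rw [← continuousOn_univ]
  exact continuousOn_integral_smul_of_ae_mem_compact (φ := fun x y => f (x - y))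
    (integrableOn_cell_rieszKernel hα hαd) (isCompact_closedCell d) (ae_mem_closedCell d)
    (exists_compact_nhdsWithin_of_isOpen isOpen_univ)
    (Continuous.continuousOn (hf.comp (by fun_prop)))

theorem contDiffOn_sub_uncurry (hf : ContDiff ℝ 1 f) :
    ContDiffOn ℝ 1 (Function.uncurry fun x y => f (x - y)) (univ ×ˢ univ) :=
  (hf.comp (contDiff_fst.sub contDiff_snd)).contDiffOn

theorem contDiff_rieszConv (hα : 0 < α) (hαd : α < d) (hf : ContDiff ℝ 1 f) :
    ContDiff ℝ 1 (rieszConv α f) := by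
  rw [← contDiffOn_univ]
  exact contDiffOn_integral_mul_of_ae_mem_compact (φ := fun x y => f (x - y))
    (integrableOn_cell_rieszKernel hα hαd) (isCompact_closedCell d) (ae_mem_closedCell d)
    isOpen_univ (contDiffOn_sub_uncurry hf)

theorem partialX_rieszConv (hα : 0 < α) (hαd : α < d) (hf : ContDiff ℝ 1 f) (i : Fin d)
    (x : EuclideanSpace ℝ (Fin d)) : partialX i (rieszConv α f) x = rieszConv α (partialX i f) x := by
  refine (fderiv_integral_mul_apply (φ := fun x y => f (x - y))
    (integrableOn_cell_rieszKernel hα hαd) (isCompact_closedCell d) (ae_mem_closedCell d)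
    isOpen_univ (contDiffOn_sub_uncurry hf) (mem_univ x) (EuclideanSpace.single i 1)).trans ?_
  refine integral_congr_ae (Filter.Eventually.of_forall fun y => ?_)
  exact congrArg (rieszKernel α y * ·) (partialX_comp_sub f i x y)

theorem UnitPeriodic.rieszConv (hf : UnitPeriodic f) : UnitPeriodic (rieszConv α f) := by
  intro x i
  unfold EulerRiesz.rieszConv
  congr 1
  funext y
  rw [add_sub_right_comm, hf]

theorem rieszKernel_neg (y : EuclideanSpace ℝ (Fin d)) : rieszKernel α (-y) = rieszKernel α y := by
  rw [rieszKernel, rieszKernel, norm_neg]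

end RieszConv

/-! ### Integration by parts against the Riesz kernel -/

section IntegrationByParts

variable {d : ℕ} {α : ℝ}

/-- The regularized kernel `(|y|² + ε)^((α - d) / 2) / (d - α)`. -/
noncomputable def regKernel (α ε : ℝ) (y : EuclideanSpace ℝ (Fin d)) : ℝ :=
  1 / ((d : ℝ) - α) * (‖y‖ ^ 2 + ε) ^ ((α - d) / 2)

theorem hasFDerivAt_regKernel (hαd : α < d) {ε : ℝ} (hε : 0 < ε) (y : EuclideanSpace ℝ (Fin d)) :
    HasFDerivAt (regKernel α ε)
      (-(‖y‖ ^ 2 + ε) ^ ((α - d) / 2 - 1) • innerSL ℝ y) y := by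
  have h1 : HasFDerivAt (fun y : EuclideanSpace ℝ (Fin d) => ‖y‖ ^ 2 + ε) (2 • innerSL ℝ y) y :=
    ((hasStrictFDerivAt_norm_sq y).hasFDerivAt).add_const ε
  have hpos : ‖y‖ ^ 2 + ε ≠ 0 := by positivity
  have h2 := ((h1.rpow_const (p := (α - d) / 2) (Or.inl hpos)).const_mul (1 / ((d : ℝ) - α)))
  refine h2.congr_fderiv ?_
  have : (d : ℝ) - α ≠ 0 := by linarith
  ext v
  simp
  field_simp
  ring

theorem contDiff_regKernel {ε : ℝ} (hε : 0 < ε) : ContDiff ℝ 1 (regKernel (d := d) α ε) := by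
  unfold regKernel
  refine contDiff_const.mul (ContDiff.rpow_const_of_ne ?_ fun y => ?_)
  · exact (contDiff_norm_sq ℝ).add contDiff_const
  · positivity

theorem inner_single_right (y : EuclideanSpace ℝ (Fin d)) (i : Fin d) :
    innerSL ℝ y (EuclideanSpace.single i (1 : ℝ)) = y i := by
  simp [EuclideanSpace.inner_single_right]

theorem partialX_mul {f g : EuclideanSpace ℝ (Fin d) → ℝ} {x : EuclideanSpace ℝ (Fin d)}
    (hf : DifferentiableAt ℝ f x) (hg : DifferentiableAt ℝ g x) (i : Fin d) :
    partialX i (fun x => f x * g x) x = partialX i f x * g x + f x * partialX i g x := by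
  have := (hf.hasFDerivAt.mul hg.hasFDerivAt).fderiv
  rw [partialX, partialX, partialX]
  rw [show (fun x => f x * g x) = f * g from rfl, this]
  simp
  ring

theorem continuous_partialX {f : EuclideanSpace ℝ (Fin d) → ℝ} (hf : ContDiff ℝ 1 f) (i : Fin d) :
    Continuous (partialX i f) :=
  (hf.continuous_fderiv one_ne_zero).clm_apply continuous_const

theorem ae_ne_zero_cell (hd : 0 < d) : ∀ᵐ y ∂volume.restrict (cell d), y ≠ 0 := by
  refine ae_restrict_of_ae ?_
  have : {y : EuclideanSpace ℝ (Fin d) | ¬ y ≠ 0} ⊆ {y | y ⟨0, hd⟩ = 0} := by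
    intro y hy
    have : y = 0 := not_not.1 hy
    simp [this]
  exact measure_mono_null this (volume_coord_eq_zero _ 0)

/-- On the face `x_i = -1/2` the shift by `e_i` only flips the sign of one coordinate. Radial
kernels, although not periodic, thus agree on opposite faces, which removes the boundary terms. -/
theorem norm_add_single_of_coord_eq {x : EuclideanSpace ℝ (Fin d)} {i : Fin d} (hx : x i = -(1 / 2)) :
    ‖x + EuclideanSpace.single i (1 : ℝ)‖ = ‖x‖ := by
  rw [← sq_eq_sq₀ (norm_nonneg _) (norm_nonneg _), norm_add_sq_real,
    EuclideanSpace.inner_single_right]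
  simp [hx]

theorem abs_coord_le_norm (y : EuclideanSpace ℝ (Fin d)) (i : Fin d) : |y i| ≤ ‖y‖ :=
  PiLp.norm_apply_le y i

theorem tendsto_regularized_rpow {y : EuclideanSpace ℝ (Fin d)} (hy : y ≠ 0) (p : ℝ) :
    Filter.Tendsto (fun n : ℕ => (‖y‖ ^ 2 + 1 / ((n : ℝ) + 1)) ^ (p / 2)) Filter.atTop
      (𝓝 (‖y‖ ^ p)) := by
  have hy0 : 0 < ‖y‖ := norm_pos_iff.2 hy
  have h1 : Filter.Tendsto (fun n : ℕ => ‖y‖ ^ 2 + 1 / ((n : ℝ) + 1)) Filter.atTop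
      (𝓝 (‖y‖ ^ 2 + 0)) := tendsto_const_nhds.add tendsto_one_div_add_atTop_nhds_zero_nat
  have h2 := h1.rpow_const (p := p / 2) (Or.inl (by positivity))
  convert h2 using 2
  rw [add_zero, ← Real.rpow_natCast, ← Real.rpow_mul hy0.le]
  congr 1; push_cast; ring

theorem regularized_rpow_le {y : EuclideanSpace ℝ (Fin d)} (hy : y ≠ 0) {p ε : ℝ} (hp : p ≤ 0)
    (hε : 0 < ε) : (‖y‖ ^ 2 + ε) ^ (p / 2) ≤ ‖y‖ ^ p := by
  have hy0 : 0 < ‖y‖ := norm_pos_iff.2 hy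
  calc (‖y‖ ^ 2 + ε) ^ (p / 2) ≤ (‖y‖ ^ 2) ^ (p / 2) :=
        Real.rpow_le_rpow_of_nonpos (by positivity) (by linarith) (by linarith)
    _ = _ := by
        rw [← Real.rpow_natCast, ← Real.rpow_mul hy0.le]
        congr 1; push_cast; ring

/-- Integration by parts against the Riesz kernel on the unit cube, for functions that vanish at
the singularity and agree on opposite faces. -/
theorem setIntegral_rieszKernel_mul_partialX (hα : 0 < α) (hαd : α < d)
    {g : EuclideanSpace ℝ (Fin d) → ℝ} (hg : ContDiff ℝ 1 g) (i : Fin d)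
    (hgp : ∀ x, g (x + EuclideanSpace.single i (1 : ℝ)) = g x)
    {L : ℝ} (hL : ∀ y ∈ closedCell d, |g y| ≤ L * ‖y‖) :
    ∫ y in cell d, rieszKernel α y * partialX i g y
      = ∫ y in cell d, ‖y‖ ^ (α - (d : ℝ) - 2) * y i * g y := by
  have hd : 0 < d := by exact_mod_cast hα.trans hαd
  have hda : 0 < (d : ℝ) - α := by linarith
  -- For the smooth kernel the product with `g` has equal values on opposite faces, so its partial
  -- derivative integrates to zero. The passage `ε → 0` is then made on each side.
  have hreg : ∀ ε : ℝ, 0 < ε → ∫ y in cell d, regKernel α ε y * partialX i g y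
      = ∫ y in cell d, (‖y‖ ^ 2 + ε) ^ ((α - d - 2) / 2) * y i * g y := by
    intro ε hε
    have hK := contDiff_regKernel (d := d) (α := α) hε
    have h0 := setIntegral_partialX_eq_zero (hK.mul hg) i (fun x hx => by
      rw [hgp, regKernel, regKernel, norm_add_single_of_coord_eq hx])
    have hpt : ∀ y, partialX i (fun y => regKernel α ε y * g y) y
        = regKernel α ε y * partialX i g y - (‖y‖ ^ 2 + ε) ^ ((α - d - 2) / 2) * y i * g y := by
      intro y
      rw [partialX_mul (hK.differentiable one_ne_zero y) (hg.differentiable one_ne_zero y),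
        partialX, (hasFDerivAt_regKernel hαd hε y).fderiv, smul_apply,
        inner_single_right, smul_eq_mul,
        show (α - d - 2) / 2 = (α - (d : ℝ)) / 2 - 1 by ring]
      ring
    simp only [hpt] at h0
    rw [integral_sub, sub_eq_zero] at h0
    · exact h0
    · exact ((hK.continuous.mul (continuous_partialX hg i)).continuousOn.integrableOn_compact
        (isCompact_closedCell d)).mono_set (cell_subset_closedCell d)
    · refine (Continuous.continuousOn ?_ |>.integrableOn_compact
        (isCompact_closedCell d)).mono_set (cell_subset_closedCell d)
      refine Continuous.mul (Continuous.mul (Continuous.rpow_const (by fun_prop) fun y =>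
        Or.inl (by positivity)) (by fun_prop)) hg.continuous
  have hae := ae_ne_zero_cell hd
  obtain ⟨B, hB⟩ := (isCompact_closedCell d).exists_bound_of_continuousOn
    (continuous_partialX hg i).continuousOn
  have hlim1 : Filter.Tendsto (fun n : ℕ => ∫ y in cell d,
      regKernel α (1 / ((n : ℝ) + 1)) y * partialX i g y) Filter.atTop
      (𝓝 (∫ y in cell d, rieszKernel α y * partialX i g y)) := by
    refine tendsto_integral_of_dominated_convergence (fun y => rieszKernel α y * B) (fun n => ?_)
      ((integrableOn_cell_rieszKernel hα hαd).mul_const B) (fun n => ?_) ?_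
    · exact ((contDiff_regKernel (by positivity)).continuous.mul
        (continuous_partialX hg i)).aestronglyMeasurable
    · filter_upwards [hae, ae_mem_closedCell d] with y hy hyc
      rw [norm_mul, regKernel, rieszKernel, norm_mul, Real.norm_of_nonneg (one_div_pos.2 hda).le,
        Real.norm_of_nonneg (by positivity)]
      have := hB y hyc
      have h1 := regularized_rpow_le hy (p := α - d) (by linarith)
        (show 0 < 1 / ((n : ℝ) + 1) by positivity)
      have h2 := (one_div_pos.2 hda).le
      gcongr
    · filter_upwards [hae] with y hy
      exact ((tendsto_regularized_rpow hy (α - d)).const_mul _).mul_const _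
  -- The kernel gradient alone is of order `|y|^(α-d-1)`, which need not be integrable; the bound
  -- `|g y| ≤ L |y|` gains one power and makes `L |y|^(α-d)` a dominating function.
  have hlim2 : Filter.Tendsto (fun n : ℕ => ∫ y in cell d,
      (‖y‖ ^ 2 + 1 / ((n : ℝ) + 1)) ^ ((α - d - 2) / 2) * y i * g y) Filter.atTop
      (𝓝 (∫ y in cell d, ‖y‖ ^ (α - (d : ℝ) - 2) * y i * g y)) := by
    refine tendsto_integral_of_dominated_convergence (fun y => L * ‖y‖ ^ (α - (d : ℝ))) (fun n => ?_)
      ((integrableOn_cell_norm_rpow hα hαd).const_mul L) (fun n => ?_) ?_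
    · refine Continuous.aestronglyMeasurable ?_
      exact Continuous.mul (Continuous.mul (Continuous.rpow_const (by fun_prop) fun y =>
        Or.inl (by positivity)) (by fun_prop)) hg.continuous
    · filter_upwards [hae, ae_mem_closedCell d] with y hy hyc
      have hy0 : 0 < ‖y‖ := norm_pos_iff.2 hy
      rw [norm_mul, norm_mul, Real.norm_of_nonneg (by positivity), Real.norm_eq_abs,
        Real.norm_eq_abs]
      have h1 := regularized_rpow_le hy (p := α - d - 2) (by linarith)
        (show 0 < 1 / ((n : ℝ) + 1) by positivity)
      calc _ ≤ ‖y‖ ^ (α - (d : ℝ) - 2) * ‖y‖ * (L * ‖y‖) := by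
            gcongr
            · exact abs_coord_le_norm y i
            · exact hL y hyc
        _ = L * (‖y‖ ^ (α - (d : ℝ) - 2) * ‖y‖ ^ (2 : ℝ)) := by rw [Real.rpow_two]; ring
        _ = _ := by rw [← Real.rpow_add hy0]; congr 2; ring
    · filter_upwards [hae] with y hy
      exact ((tendsto_regularized_rpow hy (α - d - 2)).mul_const _).mul_const _
  refine tendsto_nhds_unique hlim1 (hlim2.congr fun n => ?_)
  exact (hreg _ (by positivity)).symm

end IntegrationByParts

end EulerRiesz

/-! ### The tensor `S_α` and the identity `f ∇(K_α ∗ f) = ∇·S_α(f)` -/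

namespace EulerRiesz

open scoped Topology

variable {d : ℕ} {α : ℝ} {f : EuclideanSpace ℝ (Fin d) → ℝ}

/-- The measure `dθ dy` on `(0, 1] × (-1/2, 1/2)^d`. -/
noncomputable def stripMeasure (d : ℕ) : Measure (ℝ × EuclideanSpace ℝ (Fin d)) :=
  (volume.restrict (Ioc (0 : ℝ) 1)).prod (volume.restrict (cell d))

/-- The kernel of `S_α`. -/
noncomputable def tensorKernel (α : ℝ) (i j : Fin d) (y : EuclideanSpace ℝ (Fin d)) : ℝ :=
  ‖y‖ ^ (α - (d : ℝ) - 2) * (y i * y j)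

theorem measurable_tensorKernel (α : ℝ) (i j : Fin d) : Measurable (tensorKernel (d := d) α i j) := by
  unfold tensorKernel
  fun_prop

/-- At `y = 0` both sides are zero by the convention for zero to a nonzero power. -/
theorem rpow_sub_two_mul_sq {α : ℝ} (hαd : α < d) (y : EuclideanSpace ℝ (Fin d)) :
    ‖y‖ ^ (α - (d : ℝ) - 2) * ‖y‖ ^ 2 = ‖y‖ ^ (α - (d : ℝ)) := by
  rcases (norm_nonneg y).eq_or_lt with h | h
  · rw [← h, Real.zero_rpow (by linarith), Real.zero_rpow (by linarith)]; simp
  · rw [← Real.rpow_two, ← Real.rpow_add h, sub_add_cancel]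

theorem abs_tensorKernel_le (hαd : α < d) (i j : Fin d) (y : EuclideanSpace ℝ (Fin d)) :
    |tensorKernel α i j y| ≤ ‖y‖ ^ (α - (d : ℝ)) := by
  rw [tensorKernel, abs_mul, abs_of_nonneg (by positivity), abs_mul, ← rpow_sub_two_mul_sq hαd, sq]
  gcongr <;> exact abs_coord_le_norm _ _

theorem integrableOn_tensorKernel (hα : 0 < α) (hαd : α < d) (i j : Fin d) :
    IntegrableOn (tensorKernel (d := d) α i j) (cell d) :=
  (integrableOn_cell_norm_rpow hα hαd).mono' (measurable_tensorKernel α i j).aestronglyMeasurable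
    (Filter.Eventually.of_forall fun y => abs_tensorKernel_le hαd i j y)

theorem integrable_tensorKernel_strip (hα : 0 < α) (hαd : α < d) (i j : Fin d) :
    Integrable (fun z : ℝ × EuclideanSpace ℝ (Fin d) => tensorKernel α i j z.2) (stripMeasure d) :=
  (integrableOn_tensorKernel hα hαd i j).comp_snd _

theorem isCompact_strip (d : ℕ) : IsCompact (Icc (0 : ℝ) 1 ×ˢ closedCell d) :=
  isCompact_Icc.prod (isCompact_closedCell d)

theorem ae_mem_strip (d : ℕ) : ∀ᵐ z ∂stripMeasure d, z ∈ Icc (0 : ℝ) 1 ×ˢ closedCell d := by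
  rw [stripMeasure, Measure.prod_restrict]
  refine (ae_restrict_mem (measurableSet_Ioc.prod (measurableSet_cell d))).mono fun z hz => ?_
  exact ⟨Ioc_subset_Icc_self hz.1, cell_subset_closedCell d hz.2⟩

/-- The two-point function in the definition of `S_α`. -/
def twoPoint (f : EuclideanSpace ℝ (Fin d) → ℝ) (x : EuclideanSpace ℝ (Fin d))
    (z : ℝ × EuclideanSpace ℝ (Fin d)) : ℝ :=
  f (x + (z.1 - 1) • z.2) * f (x + z.1 • z.2)

theorem continuous_twoPoint (hf : Continuous f) : Continuous (Function.uncurry (twoPoint f)) := by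
  unfold twoPoint Function.uncurry
  fun_prop

theorem contDiff_twoPoint (hf : ContDiff ℝ 1 f) :
    ContDiff ℝ 1 (Function.uncurry (twoPoint f)) := by
  unfold twoPoint Function.uncurry
  fun_prop

/-- Fubini turns the iterated integral into one weighted integral over a strip, the form required by
the lemmas on parametric integrals. -/
theorem rieszTensor_eq (hα : 0 < α) (hαd : α < d) (hf : Continuous f)
    (x : EuclideanSpace ℝ (Fin d)) (i j : Fin d) :
    rieszTensor α f x i j
      = 1 / 2 * ∫ z, tensorKernel α i j z.2 * twoPoint f x z ∂stripMeasure d := by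
  have hint : Integrable (fun z => tensorKernel α i j z.2 * twoPoint f x z) (stripMeasure d) :=
    integrable_smul_of_ae_mem_compact (integrable_tensorKernel_strip hα hαd i j) (isCompact_strip d)
      (ae_mem_strip d) ((continuous_twoPoint hf).comp (Continuous.prodMk_right x))
  rw [rieszTensor, intervalIntegral.integral_of_le zero_le_one, stripMeasure,
    integral_prod _ hint]
  congr 2
  funext θ
  congr 1
  funext y
  simp only [tensorKernel, twoPoint]
  ring

theorem continuous_rieszTensor (hα : 0 < α) (hαd : α < d) (hf : Continuous f) (i j : Fin d) :
    Continuous fun x => rieszTensor α f x i j := by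
  simp only [rieszTensor_eq hα hαd hf]
  refine continuous_const.mul ?_
  rw [← continuousOn_univ]
  exact continuousOn_integral_smul_of_ae_mem_compact (φ := twoPoint f)
    (integrable_tensorKernel_strip hα hαd i j) (isCompact_strip d) (ae_mem_strip d)
    (exists_compact_nhdsWithin_of_isOpen isOpen_univ) (continuous_twoPoint hf).continuousOn

theorem contDiff_rieszTensor (hα : 0 < α) (hαd : α < d) (hf : ContDiff ℝ 1 f) (i j : Fin d) :
    ContDiff ℝ 1 fun x => rieszTensor α f x i j := by
  simp only [rieszTensor_eq hα hαd hf.continuous]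
  refine contDiff_const.mul ?_
  rw [← contDiffOn_univ]
  exact contDiffOn_integral_mul_of_ae_mem_compact (φ := twoPoint f)
    (integrable_tensorKernel_strip hα hαd i j) (isCompact_strip d) (ae_mem_strip d) isOpen_univ
    (contDiff_twoPoint hf).contDiffOn

theorem UnitPeriodic.rieszTensor (hf : UnitPeriodic f) (i j : Fin d) :
    UnitPeriodic fun x => rieszTensor α f x i j := by
  intro x k
  simp only [EulerRiesz.rieszTensor]
  congr 3
  funext θ
  congr 1
  funext y
  rw [add_right_comm, hf, add_right_comm, hf]

theorem partialX_rieszTensor (hα : 0 < α) (hαd : α < d) (hf : ContDiff ℝ 1 f)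
    (x : EuclideanSpace ℝ (Fin d)) (i j k : Fin d) :
    partialX k (fun x => rieszTensor α f x i j) x
      = 1 / 2 * ∫ z, tensorKernel α i j z.2 *
          fderiv ℝ (fun x => twoPoint f x z) x (EuclideanSpace.single k 1) ∂stripMeasure d := by
  simp only [rieszTensor_eq hα hαd hf.continuous, partialX]
  have hd := (hasFDerivAt_integral_mul_of_ae_mem_compact (φ := twoPoint f)
    (integrable_tensorKernel_strip hα hαd i j) (isCompact_strip d) (ae_mem_strip d) isOpen_univ
    (contDiff_twoPoint hf).contDiffOn (mem_univ x)).differentiableAt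
  rw [fderiv_const_mul hd, smul_apply, smul_eq_mul]
  congr 1
  exact fderiv_integral_mul_apply (φ := twoPoint f)
    (integrable_tensorKernel_strip hα hαd i j) (isCompact_strip d) (ae_mem_strip d) isOpen_univ
    (contDiff_twoPoint hf).contDiffOn (mem_univ x) _

/-- Both arguments move with velocity `y` as `θ` grows, so the `θ`-derivative is the directional
derivative in `x` along `y`. -/
theorem hasDerivAt_twoPoint (hf : ContDiff ℝ 1 f) (x y : EuclideanSpace ℝ (Fin d)) (θ : ℝ) :
    HasDerivAt (fun θ => twoPoint f x (θ, y)) (fderiv ℝ (fun x => twoPoint f x (θ, y)) x y) θ := by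
  have hf' : ∀ w, HasFDerivAt f (fderiv ℝ f w) w := fun w =>
    (hf.differentiable one_ne_zero w).hasFDerivAt
  have h1 : ∀ w : EuclideanSpace ℝ (Fin d), HasFDerivAt (fun x => f (x + w)) (fderiv ℝ f (x + w)) x :=
    fun w => HasFDerivAt.comp (f := fun x => x + w) x (hf' (x + w)) ((hasFDerivAt_id x).add_const w)
  have h2 := ((h1 ((θ - 1) • y)).mul (h1 (θ • y))).fderiv
  have h3 : HasDerivAt (fun θ : ℝ => x + (θ - 1) • y) y θ := by
    simpa using (((hasDerivAt_id θ).sub_const 1).smul_const y).const_add x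
  have h4 : HasDerivAt (fun θ : ℝ => x + θ • y) y θ := by
    simpa using ((hasDerivAt_id θ).smul_const y).const_add x
  have h5 := ((hf' _).comp_hasDerivAt θ h3).mul ((hf' _).comp_hasDerivAt θ h4)
  refine h5.congr_deriv ?_
  change _ = fderiv ℝ ((fun x => f (x + (θ - 1) • y)) * (fun x => f (x + θ • y))) x y
  rw [h2]
  simp
  ring

theorem sum_smul_single (y : EuclideanSpace ℝ (Fin d)) :
    ∑ j, y j • EuclideanSpace.single j (1 : ℝ) = y := by
  ext k
  simp [Finset.sum_apply, Pi.single_apply]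

/-- The divergence of `S_α(f)`, as a symmetrized singular integral. -/
theorem sum_partialX_rieszTensor (hα : 0 < α) (hαd : α < d) (hf : ContDiff ℝ 1 f)
    (x : EuclideanSpace ℝ (Fin d)) (i : Fin d) :
    ∑ j, partialX j (fun x => rieszTensor α f x i j) x
      = f x * (1 / 2 * ∫ y in cell d, ‖y‖ ^ (α - (d : ℝ) - 2) * y i * (f (x + y) - f (x - y))) := by
  simp only [partialX_rieszTensor hα hαd hf]
  have hcont : ∀ v, Continuous fun z => fderiv ℝ (fun x => twoPoint f x z) x v := fun v =>
    (continuous_fderiv_left isOpen_univ (contDiff_twoPoint hf).contDiffOn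
      (mem_univ x)).clm_apply continuous_const
  have hint : ∀ j, Integrable (fun z => tensorKernel α i j z.2 *
      fderiv ℝ (fun x => twoPoint f x z) x (EuclideanSpace.single j 1)) (stripMeasure d) := fun j =>
    integrable_smul_of_ae_mem_compact (integrable_tensorKernel_strip hα hαd i j) (isCompact_strip d)
      (ae_mem_strip d) (hcont _)
  -- Summing `y_j ∂_j` over `j` turns the divergence into the derivative along `y`, hence into a
  -- `θ`-derivative.
  have hsum : ∀ z : ℝ × EuclideanSpace ℝ (Fin d), ∑ j, tensorKernel α i j z.2 *
      fderiv ℝ (fun x => twoPoint f x z) x (EuclideanSpace.single j 1)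
      = ‖z.2‖ ^ (α - (d : ℝ) - 2) * z.2 i * fderiv ℝ (fun x => twoPoint f x z) x z.2 := by
    intro z
    conv_rhs => rw [← sum_smul_single z.2]
    rw [map_sum, Finset.mul_sum]
    refine Finset.sum_congr rfl fun j _ => ?_
    rw [map_smul, sum_smul_single, tensorKernel, smul_eq_mul]
    ring
  rw [← Finset.mul_sum, ← integral_finsetSum _ fun j _ => hint j]
  have hint2 := integrable_finsetSum Finset.univ fun j _ => hint j
  simp only [hsum] at hint2 ⊢
  rw [stripMeasure, integral_prod_symm _ hint2, mul_left_comm, ← integral_const_mul (f x)]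
  congr 2
  funext y
  dsimp only
  -- The fundamental theorem of calculus in `θ` leaves `f(x) f(x+y) - f(x-y) f(x)`.
  rw [integral_const_mul, ← intervalIntegral.integral_of_le zero_le_one,
    intervalIntegral.integral_eq_sub_of_hasDerivAt fun θ _ => hasDerivAt_twoPoint hf x y θ]
  · simp only [twoPoint, sub_self, zero_smul, one_smul, add_zero, zero_sub, neg_smul,
      ← sub_eq_add_neg]
    ring
  · refine Continuous.intervalIntegrable ?_ _ _
    exact (hcont y).comp (Continuous.prodMk_left y)

/-- The gradient of the Riesz potential, as a symmetrized singular integral. -/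
theorem partialX_rieszConv_eq (hα : 0 < α) (hαd : α < d) (hf : ContDiff ℝ 1 f) (hp : UnitPeriodic f)
    (x : EuclideanSpace ℝ (Fin d)) (i : Fin d) :
    partialX i (rieszConv α f) x
      = 1 / 2 * ∫ y in cell d, ‖y‖ ^ (α - (d : ℝ) - 2) * y i * (f (x + y) - f (x - y)) := by
  set g : EuclideanSpace ℝ (Fin d) → ℝ := fun y => f (x + y) - f (x - y) with hg
  have hgc : ContDiff ℝ 1 g := by
    rw [hg]; fun_prop
  have hgi : ∀ y, partialX i g y = partialX i f (x + y) + partialX i f (x - y) := by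
    intro y
    have hf' : ∀ w, HasFDerivAt f (fderiv ℝ f w) w := fun w =>
      (hf.differentiable one_ne_zero w).hasFDerivAt
    have h1 := (HasFDerivAt.comp (f := fun y => x + y) y (hf' (x + y)) ((hasFDerivAt_id y).const_add x)).sub
      (HasFDerivAt.comp (f := fun y => x - y) y (hf' (x - y)) ((hasFDerivAt_id y).const_sub x))
    have h2 : fderiv ℝ g y = _ := h1.fderiv
    rw [partialX, h2]
    simp [partialX]
  -- As `g(0) = 0`, the mean value inequality on the convex closed cube gives the linear bound that
  -- compensates the singularity.
  obtain ⟨L, hL⟩ : ∃ L : ℝ, ∀ y ∈ closedCell d, |g y| ≤ L * ‖y‖ := by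
    obtain ⟨L, hL⟩ := (isCompact_closedCell d).exists_bound_of_continuousOn
      (hgc.continuous_fderiv one_ne_zero).continuousOn
    have hconv : Convex ℝ (closedCell d) := by
      have : closedCell d = ⋂ i, (EuclideanSpace.proj i : EuclideanSpace ℝ (Fin d) →L[ℝ] ℝ) ⁻¹'
          Icc (-(1 / 2) : ℝ) (1 / 2) := by
        ext x
        simp only [closedCell, mem_ofPred_eq, mem_iInter, mem_preimage]
        rfl
      rw [this]
      exact convex_iInter fun i => (convex_Icc _ _).linear_preimage _
    have h0 : (0 : EuclideanSpace ℝ (Fin d)) ∈ closedCell d := fun i => by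
      constructor <;> norm_num
    refine ⟨L, fun y hy => ?_⟩
    have h := hconv.norm_image_sub_le_of_norm_fderiv_le
      (fun w _ => hgc.differentiable one_ne_zero w) hL h0 hy
    simpa [hg] using h
  have hgp : ∀ y, g (y + EuclideanSpace.single i (1 : ℝ)) = g y := by
    intro y
    simp only [hg]
    rw [← add_assoc, hp, ← hp (x - (y + _)) i, ← sub_sub, sub_add_cancel]
  have key := setIntegral_rieszKernel_mul_partialX hα hαd hgc i hgp hL
  simp only [hgi] at key
  have hint : ∀ s : EuclideanSpace ℝ (Fin d) → EuclideanSpace ℝ (Fin d), Continuous s →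
      IntegrableOn (fun y => rieszKernel α y * partialX i f (s y)) (cell d) := fun s hs =>
    integrable_smul_of_ae_mem_compact (integrableOn_cell_rieszKernel hα hαd) (isCompact_closedCell d)
      (ae_mem_closedCell d) ((continuous_partialX hf i).comp hs)
  -- Reflecting `y` shows that the two halves of the symmetrized integral are equal, which accounts
  -- for the factor ½.
  have hsymm : ∫ y in cell d, rieszKernel α y * partialX i f (x + y)
      = ∫ y in cell d, rieszKernel α y * partialX i f (x - y) := by
    rw [← setIntegral_cell_neg]
    simp only [rieszKernel_neg, sub_eq_add_neg]
  simp only [mul_add] at key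
  rw [integral_add (hint _ (by fun_prop)) (hint _ (by fun_prop)), hsymm] at key
  rw [partialX_rieszConv hα hαd hf, ← key, rieszConv]
  ring

/-- `f ∇(K_α ∗ f) = ∇ · S_α(f)`. -/
theorem mul_partialX_rieszConv (hα : 0 < α) (hαd : α < d) (hf : ContDiff ℝ 1 f) (hp : UnitPeriodic f)
    (x : EuclideanSpace ℝ (Fin d)) (i : Fin d) :
    f x * partialX i (rieszConv α f) x = ∑ j, partialX j (fun x => rieszTensor α f x i j) x := by
  rw [sum_partialX_rieszTensor hα hαd hf, partialX_rieszConv_eq hα hαd hf hp]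

end EulerRiesz

/-! ### Divergence form of the momentum equation -/

namespace EulerRiesz

variable {d : ℕ} {α : ℝ}

theorem one_lt_of_two_sub_div_le {γ : ℝ} (hα : 0 < α) (hαd : α < d) (hγ : 2 - α / (d : ℝ) ≤ γ) :
    1 < γ := by
  have : α / d < 1 := (div_lt_one (hα.trans hαd)).2 hαd
  linarith

theorem hasDerivAt_pressure {γ : ℝ} (hγ : 1 < γ) (s : ℝ) :
    HasDerivAt (pressure γ) (γ * s ^ (γ - 1)) s :=
  Real.hasDerivAt_rpow_const (Or.inr hγ.le)

theorem contDiff_pressure {γ : ℝ} (hγ : 1 < γ) : ContDiff ℝ 1 (pressure γ) :=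
  Real.contDiff_rpow_const_of_le (by exact_mod_cast hγ.le)

theorem partialX_comp {φ : ℝ → ℝ} {φ' : ℝ} {f : EuclideanSpace ℝ (Fin d) → ℝ}
    {x : EuclideanSpace ℝ (Fin d)} (hφ : HasDerivAt φ φ' (f x)) (hf : DifferentiableAt ℝ f x)
    (i : Fin d) : partialX i (fun x => φ (f x)) x = φ' * partialX i f x := by
  have h := (hφ.comp_hasFDerivAt x hf.hasFDerivAt).fderiv
  rw [partialX, show (fun x => φ (f x)) = φ ∘ f from rfl, h, smul_apply, smul_eq_mul, partialX]

theorem partialX_add {f g : EuclideanSpace ℝ (Fin d) → ℝ} {x : EuclideanSpace ℝ (Fin d)}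
    (hf : DifferentiableAt ℝ f x) (hg : DifferentiableAt ℝ g x) (i : Fin d) :
    partialX i (fun x => f x + g x) x = partialX i f x + partialX i g x := by
  rw [partialX, fderiv_fun_add hf hg]; rfl

theorem partialX_sub {f g : EuclideanSpace ℝ (Fin d) → ℝ} {x : EuclideanSpace ℝ (Fin d)}
    (hf : DifferentiableAt ℝ f x) (hg : DifferentiableAt ℝ g x) (i : Fin d) :
    partialX i (fun x => f x - g x) x = partialX i f x - partialX i g x := by
  rw [partialX, fderiv_fun_sub hf hg]; rfl

theorem partialX_const_mul {f : EuclideanSpace ℝ (Fin d) → ℝ} {x : EuclideanSpace ℝ (Fin d)}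
    (hf : DifferentiableAt ℝ f x) (c : ℝ) (i : Fin d) :
    partialX i (fun x => c * f x) x = c * partialX i f x := by
  rw [partialX, fderiv_const_mul hf]; rfl

theorem contDiff_stress {γ κ : ℝ} (hα : 0 < α) (hαd : α < d) (hγ : 1 < γ)
    {f : EuclideanSpace ℝ (Fin d) → ℝ} (hf : ContDiff ℝ 1 f) (i j : Fin d) :
    ContDiff ℝ 1 fun x => stress α γ κ f x i j := by
  unfold stress
  refine ContDiff.add ?_ (contDiff_const.mul (contDiff_rieszTensor hα hαd hf i j))
  split_ifs
  · exact (contDiff_pressure hγ).comp hf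
  · exact contDiff_const

/-- The divergence of the stress tensor. -/
theorem sum_partialX_stress {γ κ : ℝ} (hα : 0 < α) (hαd : α < d) (hγ : 1 < γ)
    {f : EuclideanSpace ℝ (Fin d) → ℝ} (hf : ContDiff ℝ 1 f) (hp : UnitPeriodic f)
    (x : EuclideanSpace ℝ (Fin d)) (i : Fin d) :
    ∑ j, partialX j (fun z => stress α γ κ f z i j) x
      = γ * f x ^ (γ - 1) * partialX i f x + κ * (f x * partialX i (rieszConv α f) x) := by
  have hfd := hf.differentiable one_ne_zero x
  have hS : ∀ j, DifferentiableAt ℝ (fun z => rieszTensor α f z i j) x := fun j =>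
    (contDiff_rieszTensor hα hαd hf i j).differentiable one_ne_zero x
  have hterm : ∀ j, partialX j (fun z => stress α γ κ f z i j) x
      = (if i = j then γ * f x ^ (γ - 1) * partialX i f x else 0)
        + κ * partialX j (fun z => rieszTensor α f z i j) x := by
    intro j
    unfold stress
    split_ifs with hij
    · subst hij
      rw [partialX_add (f := fun z => pressure γ (f z)) ((hasDerivAt_pressure hγ (f x)).comp_hasFDerivAt x hfd.hasFDerivAt
        |>.differentiableAt) ((hS i).const_mul κ), partialX_const_mul (hS i),
        partialX_comp (hasDerivAt_pressure hγ (f x)) hfd]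
    · rw [partialX_add (differentiableAt_const _) ((hS j).const_mul κ), partialX_const_mul (hS j)]
      simp [partialX]
  simp only [hterm]
  rw [Finset.sum_add_distrib, ← Finset.mul_sum, mul_partialX_rieszConv hα hαd hf hp]
  simp

theorem hasDerivAt_internalEnergy' {γ s : ℝ} (hγ : 1 < γ) (hs : 0 < s) :
    HasDerivAt (internalEnergy' γ) (γ * s ^ (γ - 2)) s := by
  have h := (Real.hasDerivAt_rpow_const (x := s) (p := γ - 1) (Or.inl hs.ne')).const_mul
    (γ / (γ - 1))
  refine h.congr_deriv ?_
  have : γ - 1 ≠ 0 := by linarith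
  rw [show γ - 1 - 1 = γ - 2 by ring]
  field_simp

/-- Where `f > 0` this is `f h''(f) = p'(f)` together with the identity for `S_α`. Where `f = 0` the
left side vanishes by its factor `f`, whatever value the derivative of `h'(f)` takes, and the right
side vanishes because `γ > 1`. -/
theorem mul_partialX_energyVariation {γ : ℝ} (hα : 0 < α) (hαd : α < d)
    (hγ : 1 < γ) (κ : ℝ) {f : EuclideanSpace ℝ (Fin d) → ℝ} (hf : ContDiff ℝ 1 f)
    (hp : UnitPeriodic f) (hf0 : ∀ x, 0 ≤ f x) (x : EuclideanSpace ℝ (Fin d)) (i : Fin d) :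
    f x * partialX i (energyVariation α γ κ f) x
      = ∑ j, partialX j (fun z => stress α γ κ f z i j) x := by
  rw [sum_partialX_stress hα hαd hγ hf hp]
  rcases (hf0 x).eq_or_lt with h0 | h0
  · rw [← h0, Real.zero_rpow (by linarith)]; simp
  · have hfd := hf.differentiable one_ne_zero x
    have hK := (contDiff_rieszConv hα hαd hf).differentiable one_ne_zero x
    unfold energyVariation
    rw [partialX_add (f := fun z => internalEnergy' γ (f z)) ((hasDerivAt_internalEnergy' hγ h0).comp_hasFDerivAt x hfd.hasFDerivAt
      |>.differentiableAt) (hK.const_mul κ), partialX_const_mul hK,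
      partialX_comp (hasDerivAt_internalEnergy' hγ h0) hfd]
    have : f x ^ (γ - 1) = f x * f x ^ (γ - 2) := by
      rw [show γ - 1 = 1 + (γ - 2) by ring, Real.rpow_add h0, Real.rpow_one]
    rw [this]
    ring

end EulerRiesz

/-! ### The algebra behind the relative energy identity -/

namespace EulerRiesz

/-- The pointwise relative energy identity, as an identity between the values of two solutions and
of their first derivatives. Here `a = ρ^(γ - 1)`, `b = σ^(γ - 2)` and `q = γ / (γ - 1)`. -/
theorem relative_energy_algebra {ι : Type*} [Fintype ι] {γ κ q r s a b rt st N φ : ℝ}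
    {r' s' u v ut vt P Q φ' : ι → ℝ} {Du Dv S DS : ι → ι → ℝ} (hq : q * (γ - 1) = γ)
    (hmass₁ : rt + ∑ j, (r' j * u j + r * Du j j) = 0)
    (hmass₂ : st + ∑ j, (s' j * v j + s * Dv j j) = 0)
    (hmom₁ : ∀ i, r * ut i + r * ∑ j, Du i j * u j + γ * a * r' i + κ * (r * P i) = 0)
    (hmom₂ : ∀ i, vt i + ∑ j, Dv i j * v j + γ * b * s' i + κ * Q i = 0)
    (hφ : ∀ i, φ' i = P i - Q i) (hS : ∀ i, ∑ j, DS i j = (r - s) * φ' i) :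
    (1 / 2 * rt * N + r * ∑ i, (u i - v i) * (ut i - vt i) + q * (a - s * b) * rt
        - γ * b * st * (r - s)) + κ * ((rt - st) * φ)
      + ∑ j, (1 / 2 * (r' j * u j + r * Du j j) * N
          + r * u j * ∑ i, (u i - v i) * (Du i j - Dv i j)
          + γ * a * r' j * (q * u j - v j) + r * a * (q * Du j j - Dv j j)
          - (γ * b * s' j * (r * u j) + q * (s * b) * (r' j * u j + r * Du j j))
          + (Dv j j * (s * s * b) + v j * (γ * (s * b) * s' j))
          + κ * ((r' j * u j + r * Du j j - (s' j * v j + s * Dv j j)) * φ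
              + (r * u j - s * v j) * φ' j)
          - κ * ∑ i, (Dv i j * S i j + v i * DS i j))
      = -(r * ∑ i, (u i - v i) * ∑ j, Dv i j * (u j - v j))
        - (r * a - s * s * b - γ * (s * b) * (r - s)) * ∑ j, Dv j j
        - κ * ∑ i, ∑ j, Dv i j * S i j := by
  -- The equation for `u` is tested with `u - v`, and that for `v` with `r (u - v)`. Writing `Du u -
  -- Dv v = (Du - Dv) u + Dv (u - v)` isolates transport from the term quadratic in `u - v`.
  have hkin : r * ∑ i, (u i - v i) * (ut i - vt i)
        + r * ∑ j, u j * ∑ i, (u i - v i) * (Du i j - Dv i j)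
      = -(r * ∑ i, (u i - v i) * ∑ j, Dv i j * (u j - v j))
        - γ * a * (∑ i, r' i * u i - ∑ i, r' i * v i)
        + γ * b * r * (∑ i, s' i * u i - ∑ i, s' i * v i)
        - κ * r * ∑ i, (u i - v i) * φ' i := by
    have h1 : ∑ j, u j * ∑ i, (u i - v i) * (Du i j - Dv i j)
        = ∑ i, (u i - v i) * ∑ j, (Du i j - Dv i j) * u j := by
      simp only [Finset.mul_sum]
      rw [Finset.sum_comm]
      exact Finset.sum_congr rfl fun i _ => Finset.sum_congr rfl fun j _ => by ring
    rw [h1]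
    have h2 : ∀ i, r * ((u i - v i) * (ut i - vt i))
          + r * ((u i - v i) * ∑ j, (Du i j - Dv i j) * u j)
        = -(r * ((u i - v i) * ∑ j, Dv i j * (u j - v j))) - γ * a * (r' i * u i - r' i * v i)
          + γ * b * r * (s' i * u i - s' i * v i) - κ * r * ((u i - v i) * φ' i) := by
      intro i
      have e1 : ∑ j, (Du i j - Dv i j) * u j
          = ∑ j, Du i j * u j - ∑ j, Dv i j * (u j - v j) - ∑ j, Dv i j * v j := by
        rw [← Finset.sum_sub_distrib, ← Finset.sum_sub_distrib]
        exact Finset.sum_congr rfl fun j _ => by ring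
      rw [e1, hφ]
      linear_combination (u i - v i) * hmom₁ i - r * (u i - v i) * hmom₂ i
    simp only [Finset.mul_sum (s := Finset.univ) (f := fun i => (u i - v i) * _),
      ← Finset.sum_add_distrib, ← Finset.sum_sub_distrib] at h2 ⊢
    simp only [Finset.mul_sum, mul_sub, ← Finset.sum_add_distrib, ← Finset.sum_sub_distrib,
      ← Finset.sum_neg_distrib] at h2 ⊢
    exact Finset.sum_congr rfl fun i _ => h2 i
  -- The divergence of `S` turns `v · ∇·S` into `(r - s) v · φ'`; subtracting this from the flux
  -- terms leaves `r (u - v) · φ'`, which cancels the force in `hkin`.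
  have hJ : ∑ j, ∑ i, (Dv i j * S i j + v i * DS i j)
      = ∑ i, ∑ j, Dv i j * S i j + (r - s) * ∑ i, v i * φ' i := by
    rw [Finset.sum_comm, Finset.mul_sum, ← Finset.sum_add_distrib]
    refine Finset.sum_congr rfl fun i _ => ?_
    rw [Finset.sum_add_distrib, ← Finset.mul_sum, hS]
    ring
  have hflux : ∑ j, (1 / 2 * (r' j * u j + r * Du j j) * N
          + r * u j * ∑ i, (u i - v i) * (Du i j - Dv i j)
          + γ * a * r' j * (q * u j - v j) + r * a * (q * Du j j - Dv j j)
          - (γ * b * s' j * (r * u j) + q * (s * b) * (r' j * u j + r * Du j j))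
          + (Dv j j * (s * s * b) + v j * (γ * (s * b) * s' j))
          + κ * ((r' j * u j + r * Du j j - (s' j * v j + s * Dv j j)) * φ
              + (r * u j - s * v j) * φ' j)
          - κ * ∑ i, (Dv i j * S i j + v i * DS i j))
      = 1 / 2 * N * ∑ j, (r' j * u j + r * Du j j)
        + r * ∑ j, u j * ∑ i, (u i - v i) * (Du i j - Dv i j)
        + γ * a * q * ∑ j, r' j * u j - γ * a * ∑ j, r' j * v j
        + r * a * q * ∑ j, Du j j - r * a * ∑ j, Dv j j
        - γ * b * r * ∑ j, s' j * u j - q * (s * b) * ∑ j, (r' j * u j + r * Du j j)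
        + s * s * b * ∑ j, Dv j j + γ * (s * b) * ∑ j, s' j * v j
        + κ * φ * ∑ j, (r' j * u j + r * Du j j) - κ * φ * ∑ j, (s' j * v j + s * Dv j j)
        + κ * r * ∑ j, u j * φ' j - κ * s * ∑ j, v j * φ' j
        - κ * ∑ j, ∑ i, (Dv i j * S i j + v i * DS i j) := by
    rw [Finset.mul_sum, Finset.mul_sum, Finset.mul_sum, Finset.mul_sum, Finset.mul_sum,
      Finset.mul_sum, Finset.mul_sum, Finset.mul_sum, Finset.mul_sum, Finset.mul_sum,
      Finset.mul_sum, Finset.mul_sum, Finset.mul_sum, Finset.mul_sum, Finset.mul_sum]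
    simp only [← Finset.sum_add_distrib, ← Finset.sum_sub_distrib]
    exact Finset.sum_congr rfl fun j _ => by ring
  have hwφ : ∑ i, (u i - v i) * φ' i = ∑ i, u i * φ' i - ∑ i, v i * φ' i := by
    rw [← Finset.sum_sub_distrib]
    exact Finset.sum_congr rfl fun j _ => by ring
  have hA₁ : ∑ j, (r' j * u j + r * Du j j) = ∑ j, r' j * u j + r * ∑ j, Du j j := by
    rw [Finset.sum_add_distrib, Finset.mul_sum]
  have hA₂ : ∑ j, (s' j * v j + s * Dv j j) = ∑ j, s' j * v j + s * ∑ j, Dv j j := by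
    rw [Finset.sum_add_distrib, Finset.mul_sum]
  rw [hwφ] at hkin
  rw [hflux, hJ]
  rw [hA₁] at hmass₁ ⊢
  rw [hA₂] at hmass₂ ⊢
  -- The mass equations are weighted by the variations of the relative energy: `½N + κφ + h'(r) -
  -- h'(s)` in `r`, and `-κφ - h''(s)(r - s)` in `s`.
  linear_combination hkin + (1 / 2 * N + κ * φ + q * (a - s * b)) * hmass₁
    - (κ * φ + γ * b * (r - s)) * hmass₂ + a * (∑ j, r' j * u j) * hq

end EulerRiesz

/-! ### Pointwise consequences of the equations, and the relative energy density -/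

namespace EulerRiesz

open scoped Topology

variable {d : ℕ} {α γ κ T : ℝ}

theorem contDiff_coord {n : WithTop ℕ∞} (i : Fin d) :
    ContDiff ℝ n fun x : EuclideanSpace ℝ (Fin d) => x i :=
  (EuclideanSpace.proj i : EuclideanSpace ℝ (Fin d) →L[ℝ] ℝ).contDiff

theorem contDiff_slice {F : Type*} [NormedAddCommGroup F] [NormedSpace ℝ F]
    {w : ℝ → EuclideanSpace ℝ (Fin d) → F}
    (hw : ContDiffOn ℝ 1 (fun z : ℝ × EuclideanSpace ℝ (Fin d) => w z.1 z.2) (Ioo 0 T ×ˢ univ))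
    {t : ℝ} (ht : t ∈ Ioo 0 T) : ContDiff ℝ 1 (w t) := by
  rw [← contDiffOn_univ]
  exact hw.comp (s := univ) (f := fun x => (t, x)) (by fun_prop) fun x _ => ⟨ht, mem_univ x⟩

theorem continuous_slice {F : Type*} [TopologicalSpace F] {w : ℝ → EuclideanSpace ℝ (Fin d) → F}
    (hw : ContinuousOn (fun z : ℝ × EuclideanSpace ℝ (Fin d) => w z.1 z.2) (Ico 0 T ×ˢ univ))
    {t : ℝ} (ht : t ∈ Ico 0 T) : Continuous (w t) := by
  rw [← continuousOn_univ]
  exact hw.comp (s := univ) (f := fun x => (t, x)) (by fun_prop) fun x _ => ⟨ht, mem_univ x⟩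

theorem differentiableAt_time {F : Type*} [NormedAddCommGroup F] [NormedSpace ℝ F]
    {w : ℝ → EuclideanSpace ℝ (Fin d) → F}
    (hw : ContDiffOn ℝ 1 (fun z : ℝ × EuclideanSpace ℝ (Fin d) => w z.1 z.2) (Ioo 0 T ×ˢ univ))
    {t : ℝ} (ht : t ∈ Ioo 0 T) (x : EuclideanSpace ℝ (Fin d)) :
    DifferentiableAt ℝ (fun s => w s x) t := by
  have h : ContDiffOn ℝ 1 (fun s => w s x) (Ioo 0 T) :=
    hw.comp (f := fun s => (s, x)) (by fun_prop) fun s hs => ⟨hs, mem_univ x⟩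
  exact (h.contDiffAt (isOpen_Ioo.mem_nhds ht)).differentiableAt one_ne_zero

/-- The derivative along a coordinate line. -/
theorem hasDerivAt_line {f : EuclideanSpace ℝ (Fin d) → ℝ} {x : EuclideanSpace ℝ (Fin d)}
    (hf : DifferentiableAt ℝ f x) (i : Fin d) :
    HasDerivAt (fun s : ℝ => f (x + s • EuclideanSpace.single i (1 : ℝ))) (partialX i f x) 0 := by
  have h1 : HasDerivAt (fun s : ℝ => x + s • EuclideanSpace.single i (1 : ℝ))
      (EuclideanSpace.single i (1 : ℝ)) 0 := by
    simpa using ((hasDerivAt_id (0 : ℝ)).smul_const (EuclideanSpace.single i (1 : ℝ))).const_add x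
  have h2 : HasFDerivAt f (fderiv ℝ f x) (x + (0 : ℝ) • EuclideanSpace.single i (1 : ℝ)) := by
    simpa using hf.hasFDerivAt
  exact h2.comp_hasDerivAt 0 h1

namespace IsPeriodicSolution

variable {ρ : ℝ → EuclideanSpace ℝ (Fin d) → ℝ}
  {u : ℝ → EuclideanSpace ℝ (Fin d) → EuclideanSpace ℝ (Fin d)}

theorem contDiff_density (h : IsPeriodicSolution α γ κ T ρ u) {t : ℝ} (ht : t ∈ Ioo 0 T) :
    ContDiff ℝ 1 (ρ t) := contDiff_slice h.contDiffOn_density ht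

theorem contDiff_velocity (h : IsPeriodicSolution α γ κ T ρ u) {t : ℝ} (ht : t ∈ Ioo 0 T)
    (i : Fin d) : ContDiff ℝ 1 fun x => u t x i :=
  (contDiff_coord i).comp (contDiff_slice h.contDiffOn_velocity ht)

theorem hasDerivAt_density (h : IsPeriodicSolution α γ κ T ρ u) {t : ℝ} (ht : t ∈ Ioo 0 T)
    (x : EuclideanSpace ℝ (Fin d)) :
    HasDerivAt (fun s => ρ s x) (deriv (fun s => ρ s x) t) t :=
  (differentiableAt_time h.contDiffOn_density ht x).hasDerivAt

theorem hasDerivAt_velocity (h : IsPeriodicSolution α γ κ T ρ u) {t : ℝ} (ht : t ∈ Ioo 0 T)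
    (x : EuclideanSpace ℝ (Fin d)) (i : Fin d) :
    HasDerivAt (fun s => u s x i) (deriv (fun s => u s x i) t) t :=
  (DifferentiableAt.comp (g := fun y : EuclideanSpace ℝ (Fin d) => y i) t
    ((contDiff_coord (n := 1) i).differentiable one_ne_zero (u t x))
    (differentiableAt_time h.contDiffOn_velocity ht x)).hasDerivAt

theorem mass_expanded (h : IsPeriodicSolution α γ κ T ρ u) {t : ℝ} (ht : t ∈ Ioo 0 T)
    (x : EuclideanSpace ℝ (Fin d)) :
    deriv (fun s => ρ s x) t + ∑ j, (partialX j (ρ t) x * u t x j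
      + ρ t x * partialX j (fun z => u t z j) x) = 0 := by
  rw [← h.mass t ht x]
  congr 1
  refine Finset.sum_congr rfl fun j _ => ?_
  rw [partialX_mul ((h.contDiff_density ht).differentiable one_ne_zero x)
    ((h.contDiff_velocity ht j).differentiable one_ne_zero x)]

/-- The momentum equation in nonconservative form. -/
theorem momentum_expanded (h : IsPeriodicSolution α γ κ T ρ u) (hα : 0 < α) (hαd : α < d)
    (hγ : 1 < γ) {t : ℝ} (ht : t ∈ Ioo 0 T) (x : EuclideanSpace ℝ (Fin d)) (i : Fin d) :
    ρ t x * deriv (fun s => u s x i) t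
      + ρ t x * ∑ j, partialX j (fun z => u t z i) x * u t x j
      + γ * ρ t x ^ (γ - 1) * partialX i (ρ t) x
      + κ * (ρ t x * partialX i (rieszConv α (ρ t)) x) = 0 := by
  have hρ := (h.contDiff_density ht).differentiable one_ne_zero x
  have hu := fun j => (h.contDiff_velocity ht j).differentiable one_ne_zero x
  have hm := h.momentum t ht x i
  have hterm : ∀ j, partialX j (fun z => ρ t z * u t z i * u t z j + stress α γ κ (ρ t) z i j) x
      = u t x i * (partialX j (ρ t) x * u t x j + ρ t x * partialX j (fun z => u t z j) x)
        + ρ t x * (partialX j (fun z => u t z i) x * u t x j)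
        + partialX j (fun z => stress α γ κ (ρ t) z i j) x := by
    intro j
    rw [partialX_add ((hρ.fun_mul (hu i)).fun_mul (hu j))
      ((contDiff_stress hα hαd hγ (h.contDiff_density ht) i j).differentiable one_ne_zero x),
      partialX_mul (hρ.fun_mul (hu i)) (hu j), partialX_mul hρ (hu i)]
    ring
  simp only [hterm] at hm
  rw [Finset.sum_add_distrib, Finset.sum_add_distrib, ← Finset.mul_sum, ← Finset.mul_sum,
    sum_partialX_stress hα hαd hγ (h.contDiff_density ht)
      (h.periodic_density t (Ioo_subset_Ico_self ht)),
    ((h.hasDerivAt_density ht x).fun_mul (h.hasDerivAt_velocity ht x i)).deriv] at hm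
  -- Subtracting `u_i` times the mass equation leaves the nonconservative form. The factor `ρ` is
  -- kept, so no positivity is required.
  linear_combination hm - u t x i * h.mass_expanded ht x

/-- The momentum equation where the density is positive. -/
theorem velocity_equation (h : IsPeriodicSolution α γ κ T ρ u) (hα : 0 < α) (hαd : α < d)
    (hγ : 1 < γ) {t : ℝ} (ht : t ∈ Ioo 0 T) {x : EuclideanSpace ℝ (Fin d)} (hpos : 0 < ρ t x)
    (i : Fin d) :
    deriv (fun s => u s x i) t + ∑ j, partialX j (fun z => u t z i) x * u t x j
      + γ * ρ t x ^ (γ - 2) * partialX i (ρ t) x + κ * partialX i (rieszConv α (ρ t)) x = 0 := by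
  have hm := h.momentum_expanded hα hαd hγ ht x i
  have e : ρ t x ^ (γ - 1) = ρ t x * ρ t x ^ (γ - 2) := by
    rw [show γ - 1 = 1 + (γ - 2) by ring, Real.rpow_add hpos, Real.rpow_one]
  rw [e] at hm
  apply mul_left_cancel₀ hpos.ne'
  linear_combination hm

end IsPeriodicSolution

/-- The density of kinetic and internal relative energy. -/
noncomputable def relEnergyDensity (γ : ℝ) (r : ℝ) (u : EuclideanSpace ℝ (Fin d)) (s : ℝ)
    (v : EuclideanSpace ℝ (Fin d)) : ℝ :=
  1 / 2 * r * ‖u - v‖ ^ 2 + relInternalEnergy γ r s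

/-- The flux of the relative energy. -/
noncomputable def relEnergyFlux (α γ κ : ℝ) (ρ : EuclideanSpace ℝ (Fin d) → ℝ)
    (u : EuclideanSpace ℝ (Fin d) → EuclideanSpace ℝ (Fin d)) (σ : EuclideanSpace ℝ (Fin d) → ℝ)
    (v : EuclideanSpace ℝ (Fin d) → EuclideanSpace ℝ (Fin d)) (j : Fin d)
    (x : EuclideanSpace ℝ (Fin d)) : ℝ :=
  1 / 2 * (ρ x * u x j) * ‖u x - v x‖ ^ 2 + pressure γ (ρ x) * (γ / (γ - 1) * u x j - v x j)
    - internalEnergy' γ (σ x) * (ρ x * u x j) + v x j * pressure γ (σ x)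
    + κ * ((ρ x * u x j - σ x * v x j) * rieszConv α (fun z => ρ z - σ z) x)
    - κ * ∑ i, v x i * rieszTensor α (fun z => ρ z - σ z) x i j

theorem norm_sub_sq_eq_sum (u v : EuclideanSpace ℝ (Fin d)) :
    ‖u - v‖ ^ 2 = ∑ i, (u i - v i) ^ 2 := by
  rw [EuclideanSpace.real_norm_sq_eq]
  rfl

theorem hasDerivAt_sum_sq_sub {u v : ℝ → EuclideanSpace ℝ (Fin d)} {u' v' : Fin d → ℝ} {t : ℝ}
    (hu : ∀ i, HasDerivAt (fun s => u s i) (u' i) t)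
    (hv : ∀ i, HasDerivAt (fun s => v s i) (v' i) t) :
    HasDerivAt (fun s => ‖u s - v s‖ ^ 2) (2 * ∑ i, (u t i - v t i) * (u' i - v' i)) t := by
  simp only [norm_sub_sq_eq_sum]
  have h := HasDerivAt.fun_sum (u := Finset.univ) fun i _ => ((hu i).sub (hv i)).fun_pow 2
  refine h.congr_deriv ?_
  rw [Finset.mul_sum]
  refine Finset.sum_congr rfl fun i _ => ?_
  simp
  ring

/-- The first density enters through `h` alone, which is differentiable also at zero; `h''` is
evaluated only at the positive reference density. -/
theorem hasDerivAt_relEnergyDensity (hγ : 1 < γ) {r σ : ℝ → ℝ} {u v : ℝ → EuclideanSpace ℝ (Fin d)}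
    {r' σ' : ℝ} {u' v' : Fin d → ℝ} {t : ℝ} (hr : HasDerivAt r r' t) (hσ : HasDerivAt σ σ' t)
    (hu : ∀ i, HasDerivAt (fun s => u s i) (u' i) t)
    (hv : ∀ i, HasDerivAt (fun s => v s i) (v' i) t) (hpos : 0 < σ t) :
    HasDerivAt (fun s => relEnergyDensity γ (r s) (u s) (σ s) (v s))
      (1 / 2 * r' * ‖u t - v t‖ ^ 2 + r t * ∑ i, (u t i - v t i) * (u' i - v' i)
        + γ / (γ - 1) * (r t ^ (γ - 1) - σ t * σ t ^ (γ - 2)) * r'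
        - γ * σ t ^ (γ - 2) * σ' * (r t - σ t)) t := by
  have h1 := (hr.const_mul (1 / 2)).mul (hasDerivAt_sum_sq_sub hu hv)
  have h2 := ((hasDerivAt_internalEnergy hγ (r t)).comp t hr).sub
    ((hasDerivAt_internalEnergy hγ (σ t)).comp t hσ)
  have h3 := ((hasDerivAt_internalEnergy' hγ hpos).comp t hσ).mul (hr.sub hσ)
  refine (h1.add (h2.sub h3)).congr_deriv ?_
  have e : σ t ^ (γ - 1) = σ t * σ t ^ (γ - 2) := by
    rw [show γ - 1 = 1 + (γ - 2) by ring, Real.rpow_add hpos, Real.rpow_one]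
  simp only [internalEnergy', Function.comp, e, Pi.sub_apply]
  ring

end EulerRiesz

/-! ### The relative energy flux and the local identity -/

namespace EulerRiesz

open scoped Topology

variable {d : ℕ} {α γ κ : ℝ} {ρ σ : EuclideanSpace ℝ (Fin d) → ℝ}
  {u v : EuclideanSpace ℝ (Fin d) → EuclideanSpace ℝ (Fin d)}

theorem contDiff_sub_norm_sq (hu : ∀ i, ContDiff ℝ 1 fun x => u x i)
    (hv : ∀ i, ContDiff ℝ 1 fun x => v x i) : ContDiff ℝ 1 fun x => ‖u x - v x‖ ^ 2 := by
  simp only [norm_sub_sq_eq_sum]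
  exact ContDiff.sum fun i _ => ((hu i).sub (hv i)).pow 2

/-- The flux stays `C¹` where `ρ` vanishes because `ρ h'(ρ)` is written as `γ/(γ-1) p(ρ)`; the
possibly singular `h'` is applied only to `σ > 0`. -/
theorem contDiff_relEnergyFlux (hα : 0 < α) (hαd : α < d) (hγ : 1 < γ) (hρ : ContDiff ℝ 1 ρ)
    (hσ : ContDiff ℝ 1 σ) (hu : ∀ i, ContDiff ℝ 1 fun x => u x i)
    (hv : ∀ i, ContDiff ℝ 1 fun x => v x i) (hpos : ∀ x, 0 < σ x) (j : Fin d) :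
    ContDiff ℝ 1 (relEnergyFlux α γ κ ρ u σ v j) := by
  have h1 := contDiff_sub_norm_sq hu hv
  have h2 : ContDiff ℝ 1 fun x => pressure γ (ρ x) := (contDiff_pressure hγ).comp hρ
  have h3 : ContDiff ℝ 1 fun x => pressure γ (σ x) := (contDiff_pressure hγ).comp hσ
  have h4 : ContDiff ℝ 1 fun x => internalEnergy' γ (σ x) :=
    contDiff_const.mul (hσ.rpow_const_of_ne fun x => (hpos x).ne')
  have h5 := contDiff_rieszConv hα hαd (hρ.sub hσ)
  have h6 : ContDiff ℝ 1 fun x => ∑ i, v x i * rieszTensor α (fun z => ρ z - σ z) x i j :=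
    ContDiff.sum fun i _ => (hv i).mul (contDiff_rieszTensor hα hαd (hρ.sub hσ) i j)
  have hu' := hu j
  have hv' := hv j
  unfold relEnergyFlux
  exact ((((((contDiff_const.mul (hρ.mul hu')).mul h1).add
    (h2.mul ((contDiff_const.mul hu').sub hv'))).sub (h4.mul (hρ.mul hu'))).add (hv'.mul h3)).add
    (contDiff_const.mul (((hρ.mul hu').sub (hσ.mul hv')).mul h5))).sub (contDiff_const.mul h6)

theorem UnitPeriodic.relEnergyFlux (hρ : UnitPeriodic ρ) (hσ : UnitPeriodic σ)
    (hu : UnitPeriodic u) (hv : UnitPeriodic v) (j : Fin d) :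
    UnitPeriodic (relEnergyFlux α γ κ ρ u σ v j) := by
  have hg : UnitPeriodic fun z => ρ z - σ z := hρ.map₂ hσ (· - ·)
  intro x k
  have h1 : ∀ i, EulerRiesz.rieszTensor α (fun z => ρ z - σ z) (x + EuclideanSpace.single k 1) i j
      = EulerRiesz.rieszTensor α (fun z => ρ z - σ z) x i j := fun i => hg.rieszTensor i j x k
  simp only [EulerRiesz.relEnergyFlux, hρ x k, hσ x k, hu x k, hv x k, hg.rieszConv x k, h1]

/-- Each factor is differentiated along the line `x + s e_j`, and uniqueness of the derivative
identifies the result. Powers are reduced to `ρ^(γ-1)` and `σ^(γ-2)`, the atoms of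
`relative_energy_algebra`. -/
theorem partialX_relEnergyFlux (hα : 0 < α) (hαd : α < d) (hγ : 1 < γ) (hρ : ContDiff ℝ 1 ρ)
    (hσ : ContDiff ℝ 1 σ) (hu : ∀ i, ContDiff ℝ 1 fun x => u x i)
    (hv : ∀ i, ContDiff ℝ 1 fun x => v x i) (hρ0 : ∀ x, 0 ≤ ρ x) (hpos : ∀ x, 0 < σ x) (j : Fin d)
    (x : EuclideanSpace ℝ (Fin d)) :
    partialX j (relEnergyFlux α γ κ ρ u σ v j) x
      = 1 / 2 * (partialX j ρ x * u x j + ρ x * partialX j (fun z => u z j) x) * ‖u x - v x‖ ^ 2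
          + ρ x * u x j * ∑ i, (u x i - v x i)
            * (partialX j (fun z => u z i) x - partialX j (fun z => v z i) x)
          + γ * ρ x ^ (γ - 1) * partialX j ρ x * (γ / (γ - 1) * u x j - v x j)
          + ρ x * ρ x ^ (γ - 1)
            * (γ / (γ - 1) * partialX j (fun z => u z j) x - partialX j (fun z => v z j) x)
          - (γ * σ x ^ (γ - 2) * partialX j σ x * (ρ x * u x j)
            + γ / (γ - 1) * (σ x * σ x ^ (γ - 2))
              * (partialX j ρ x * u x j + ρ x * partialX j (fun z => u z j) x))
          + (partialX j (fun z => v z j) x * (σ x * σ x * σ x ^ (γ - 2))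
            + v x j * (γ * (σ x * σ x ^ (γ - 2)) * partialX j σ x))
          + κ * ((partialX j ρ x * u x j + ρ x * partialX j (fun z => u z j) x
                - (partialX j σ x * v x j + σ x * partialX j (fun z => v z j) x))
                * rieszConv α (fun z => ρ z - σ z) x
              + (ρ x * u x j - σ x * v x j) * partialX j (rieszConv α (fun z => ρ z - σ z)) x)
          - κ * ∑ i, (partialX j (fun z => v z i) x * rieszTensor α (fun z => ρ z - σ z) x i j
              + v x i * partialX j (fun y => rieszTensor α (fun z => ρ z - σ z) y i j) x) := by
  have D : ∀ {f : EuclideanSpace ℝ (Fin d) → ℝ}, ContDiff ℝ 1 f →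
      HasDerivAt (fun s : ℝ => f (x + s • EuclideanSpace.single j (1 : ℝ))) (partialX j f x) 0 :=
    fun hf => hasDerivAt_line (hf.differentiable one_ne_zero x) j
  have e0 : x + (0 : ℝ) • EuclideanSpace.single j (1 : ℝ) = x := by simp
  have hN := hasDerivAt_sum_sq_sub (fun i => D (hu i)) (fun i => D (hv i))
  have hp₁ := (hasDerivAt_pressure hγ _).comp 0 (D hρ)
  have hp₂ := (hasDerivAt_pressure hγ _).comp 0 (D hσ)
  have hh := (hasDerivAt_internalEnergy' hγ (hpos (x + (0 : ℝ) • EuclideanSpace.single j 1))).comp 0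
    (D hσ)
  have hΦ := D (contDiff_rieszConv hα hαd (hρ.sub hσ))
  have hS := HasDerivAt.fun_sum (u := Finset.univ) fun i _ =>
    (D (hv i)).fun_mul (D (contDiff_rieszTensor hα hαd (hρ.sub hσ) i j))
  have hru := (D hρ).fun_mul (D (hu j))
  have hsv := (D hσ).fun_mul (D (hv j))
  have key := ((((((hru.const_mul (1 / 2)).fun_mul hN).fun_add
    (hp₁.fun_mul (((D (hu j)).const_mul (γ / (γ - 1))).fun_sub (D (hv j))))).fun_sub
    (hh.fun_mul hru)).fun_add ((D (hv j)).fun_mul hp₂)).fun_add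
    (((hru.fun_sub hsv).fun_mul hΦ).const_mul κ)).fun_sub (hS.const_mul κ)
  have hflux := D (contDiff_relEnergyFlux (κ := κ) hα hαd hγ hρ hσ hu hv hpos j)
  refine (hflux.unique key).trans ?_
  have eσ : σ x ^ (γ - 1) = σ x * σ x ^ (γ - 2) := by
    rw [show γ - 1 = 1 + (γ - 2) by ring, Real.rpow_add (hpos x), Real.rpow_one]
  have eσ' : σ x ^ γ = σ x * σ x * σ x ^ (γ - 2) := by
    rw [mul_assoc, ← eσ]
    nth_rewrite 2 [← Real.rpow_one (σ x)]
    rw [← Real.rpow_add (hpos x)]; congr 1; ring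
  have eρ : ρ x ^ γ = ρ x * ρ x ^ (γ - 1) := by
    rcases (hρ0 x).eq_or_lt with h | h
    · rw [← h, Real.zero_rpow (by linarith), Real.zero_rpow (by linarith)]; simp
    · nth_rewrite 2 [← Real.rpow_one (ρ x)]
      rw [← Real.rpow_add h]; congr 1; ring
  simp only [Function.comp, e0, internalEnergy', pressure, eσ, eσ', eρ]
  ring

/-- The right-hand side of the local relative energy identity. -/
noncomputable def relEnergyRate (α γ κ : ℝ) (ρ : EuclideanSpace ℝ (Fin d) → ℝ)
    (u : EuclideanSpace ℝ (Fin d) → EuclideanSpace ℝ (Fin d)) (σ : EuclideanSpace ℝ (Fin d) → ℝ)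
    (v : EuclideanSpace ℝ (Fin d) → EuclideanSpace ℝ (Fin d)) (x : EuclideanSpace ℝ (Fin d)) : ℝ :=
  -(ρ x * ∑ i, (u x i - v x i) * ∑ j, partialX j (fun z => v z i) x * (u x j - v x j))
    - (γ - 1) * relInternalEnergy γ (ρ x) (σ x) * ∑ j, partialX j (fun z => v z j) x
    - κ * ∑ i, ∑ j, partialX j (fun z => v z i) x * rieszTensor α (fun z => ρ z - σ z) x i j

/-- Since `p = (γ-1) h`, the left side is the relative pressure, which is what multiplies `∇·v` in
the algebraic identity. -/
theorem relInternalEnergy_mul (hγ : 1 < γ) {r s : ℝ} (hr : 0 ≤ r) (hs : 0 < s) :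
    (γ - 1) * relInternalEnergy γ r s
      = r * r ^ (γ - 1) - s * s * s ^ (γ - 2) - γ * (s * s ^ (γ - 2)) * (r - s) := by
  have es : s ^ (γ - 1) = s * s ^ (γ - 2) := by
    rw [show γ - 1 = 1 + (γ - 2) by ring, Real.rpow_add hs, Real.rpow_one]
  have es' : s ^ γ = s * s * s ^ (γ - 2) := by
    rw [mul_assoc, ← es]
    nth_rewrite 2 [← Real.rpow_one s]
    rw [← Real.rpow_add hs]; congr 1; ring
  have er : r ^ γ = r * r ^ (γ - 1) := by
    rcases hr.eq_or_lt with h | h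
    · rw [← h, Real.zero_rpow (by linarith), Real.zero_rpow (by linarith)]; simp
    · nth_rewrite 2 [← Real.rpow_one r]
      rw [← Real.rpow_add h]; congr 1; ring
  have : γ - 1 ≠ 0 := by linarith
  rw [relInternalEnergy_eq, es, es', er]
  field_simp

/-- The local relative energy identity. -/
theorem deriv_relEnergyDensity_add_div_flux {T : ℝ} {ρ σ : ℝ → EuclideanSpace ℝ (Fin d) → ℝ}
    {u v : ℝ → EuclideanSpace ℝ (Fin d) → EuclideanSpace ℝ (Fin d)} (hα : 0 < α) (hαd : α < d)
    (hγ : 1 < γ) (h₁ : IsPeriodicSolution α γ κ T ρ u) (h₂ : IsPeriodicSolution α γ κ T σ v)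
    {t : ℝ} (ht : t ∈ Ioo 0 T) (hpos : ∀ x, 0 < σ t x) (x : EuclideanSpace ℝ (Fin d)) :
    deriv (fun s => relEnergyDensity γ (ρ s x) (u s x) (σ s x) (v s x)) t
      + κ * (deriv (fun s => ρ s x - σ s x) t * rieszConv α (fun z => ρ t z - σ t z) x)
      + ∑ j, partialX j (relEnergyFlux α γ κ (ρ t) (u t) (σ t) (v t) j) x
      = relEnergyRate α γ κ (ρ t) (u t) (σ t) (v t) x := by
  have ht' := Ioo_subset_Ico_self ht
  have hγ' : γ - 1 ≠ 0 := by linarith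
  have hρ := h₁.contDiff_density ht
  have hσ := h₂.contDiff_density ht
  have hρp := h₁.periodic_density t ht'
  have hσp := h₂.periodic_density t ht'
  have hg : ContDiff ℝ 1 fun z => ρ t z - σ t z := hρ.sub hσ
  have hgp : UnitPeriodic fun z => ρ t z - σ t z := hρp.map₂ hσp (· - ·)
  have hdiff : ∀ i, partialX i (rieszConv α fun z => ρ t z - σ t z) x
      = partialX i (rieszConv α (ρ t)) x - partialX i (rieszConv α (σ t)) x := by
    intro i
    have hc : rieszConv α (fun z => ρ t z - σ t z)
        = fun x => rieszConv α (ρ t) x - rieszConv α (σ t) x := by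
      funext y
      simp only [rieszConv, mul_sub]
      have hint : ∀ {f : EuclideanSpace ℝ (Fin d) → ℝ}, Continuous f →
          IntegrableOn (fun z => rieszKernel α z * f (y - z)) (cell d) := fun hf =>
        integrable_smul_of_ae_mem_compact (integrableOn_cell_rieszKernel hα hαd)
          (isCompact_closedCell d) (ae_mem_closedCell d) (hf.comp (by fun_prop))
      exact integral_sub (hint hρ.continuous) (hint hσ.continuous)
    rw [hc, partialX_sub ((contDiff_rieszConv hα hαd hρ).differentiable one_ne_zero x)
      ((contDiff_rieszConv hα hαd hσ).differentiable one_ne_zero x)]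
  rw [(hasDerivAt_relEnergyDensity hγ (h₁.hasDerivAt_density ht x) (h₂.hasDerivAt_density ht x)
      (h₁.hasDerivAt_velocity ht x) (h₂.hasDerivAt_velocity ht x) (hpos x)).deriv,
    ((h₁.hasDerivAt_density ht x).fun_sub (h₂.hasDerivAt_density ht x)).deriv, relEnergyRate,
    relInternalEnergy_mul hγ (h₁.density_nonneg t ht' x) (hpos x)]
  simp only [partialX_relEnergyFlux hα hαd hγ hρ hσ (h₁.contDiff_velocity ht)
    (h₂.contDiff_velocity ht) (h₁.density_nonneg t ht') hpos]
  have hq : γ / (γ - 1) * (γ - 1) = γ := by field_simp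
  -- The first solution enters through its momentum equation with the factor `ρ`, so vacuum is
  -- allowed; only the second one is divided by its density.
  have key := relative_energy_algebra (N := ‖u t x - v t x‖ ^ 2)
    (φ := rieszConv α (fun z => ρ t z - σ t z) x)
    (S := rieszTensor α (fun z => ρ t z - σ t z) x) hq (h₁.mass_expanded ht x) (h₂.mass_expanded ht x)
    (h₁.momentum_expanded hα hαd hγ ht x) (h₂.velocity_equation hα hαd hγ ht (hpos x)) hdiff
    (fun i => (mul_partialX_rieszConv hα hαd hg hgp x i).symm)
  exact key

end EulerRiesz

/-! ### Time dependence of the integrated energies -/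

namespace EulerRiesz

open scoped Topology

variable {d : ℕ} {α γ κ T : ℝ}

theorem integrableOn_cell_of_continuous {F : Type*} [NormedAddCommGroup F]
    {f : EuclideanSpace ℝ (Fin d) → F} (hf : Continuous f) : IntegrableOn f (cell d) :=
  (hf.continuousOn.integrableOn_compact (isCompact_closedCell d)).mono_set
    (cell_subset_closedCell d)

/-- Lebesgue measure on the product of two unit cubes. -/
noncomputable def pairMeasure (d : ℕ) :
    Measure (EuclideanSpace ℝ (Fin d) × EuclideanSpace ℝ (Fin d)) :=
  (volume.restrict (cell d)).prod (volume.restrict (cell d))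

theorem isCompact_pair (d : ℕ) : IsCompact (closedCell d ×ˢ closedCell d) :=
  (isCompact_closedCell d).prod (isCompact_closedCell d)

theorem ae_mem_pair (d : ℕ) : ∀ᵐ z ∂pairMeasure d, z ∈ closedCell d ×ˢ closedCell d := by
  rw [pairMeasure, Measure.prod_restrict]
  refine (ae_restrict_mem ((measurableSet_cell d).prod (measurableSet_cell d))).mono fun z hz => ?_
  exact ⟨cell_subset_closedCell d hz.1, cell_subset_closedCell d hz.2⟩

theorem integrable_rieszKernel_pair (hα : 0 < α) (hαd : α < d) :
    Integrable (fun z : EuclideanSpace ℝ (Fin d) × EuclideanSpace ℝ (Fin d) => rieszKernel α z.2)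
      (pairMeasure d) :=
  Integrable.comp_snd (f := rieszKernel α) (integrableOn_cell_rieszKernel hα hαd) _

section Potential

variable {a b : EuclideanSpace ℝ (Fin d) → ℝ}

theorem integrable_pair_interaction (hα : 0 < α) (hαd : α < d) (ha : Continuous a)
    (hb : Continuous b) :
    Integrable (fun z : EuclideanSpace ℝ (Fin d) × EuclideanSpace ℝ (Fin d) =>
      rieszKernel α z.2 * (a z.1 * b (z.1 - z.2))) (pairMeasure d) :=
  integrable_smul_of_ae_mem_compact (integrable_rieszKernel_pair hα hαd) (isCompact_pair d)
    (ae_mem_pair d) (by fun_prop)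

theorem setIntegral_mul_rieszConv_eq (hα : 0 < α) (hαd : α < d) (ha : Continuous a)
    (hb : Continuous b) : ∫ x in cell d, a x * rieszConv α b x
      = ∫ z, rieszKernel α z.2 * (a z.1 * b (z.1 - z.2)) ∂pairMeasure d := by
  rw [pairMeasure, integral_prod _ (integrable_pair_interaction hα hαd ha hb)]
  refine integral_congr_ae (Filter.Eventually.of_forall fun x => ?_)
  simp only [rieszConv]
  rw [← integral_const_mul]
  refine integral_congr_ae (Filter.Eventually.of_forall fun y => ?_)
  simp only
  ring

/-- The substitution `(x, y) ↦ (x - y, -y)`, by evenness of the kernel and periodicity. -/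
theorem setIntegral_mul_rieszConv_comm (hα : 0 < α) (hαd : α < d) (ha : Continuous a)
    (hb : Continuous b) (hap : UnitPeriodic a) (hbp : UnitPeriodic b) :
    ∫ x in cell d, a x * rieszConv α b x = ∫ x in cell d, b x * rieszConv α a x := by
  rw [setIntegral_mul_rieszConv_eq hα hαd ha hb, setIntegral_mul_rieszConv_eq hα hαd hb ha,
    pairMeasure, integral_prod_symm _ (integrable_pair_interaction hα hαd ha hb),
    integral_prod_symm _ (integrable_pair_interaction hα hαd hb ha), ← setIntegral_cell_neg]
  refine integral_congr_ae (Filter.Eventually.of_forall fun y => ?_)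
  have hp : UnitPeriodic fun x => rieszKernel α y * (b x * a (x - y)) :=
    hbp.map₂ (hap.comp_add (-y)) fun s t => rieszKernel α y * (s * t)
  simp only
  rw [← hp.setIntegral_add y]
  refine integral_congr_ae (Filter.Eventually.of_forall fun x => ?_)
  simp only [rieszKernel_neg, sub_neg_eq_add, add_sub_cancel_right]
  ring

end Potential

/-- This lets the dominated continuity lemma reach the initial time, where the solutions are only
assumed continuous. -/
theorem exists_compact_nhdsWithin_Ico : ∀ t ∈ Ico 0 T, ∃ K ∈ 𝓝[Ico 0 T] t, IsCompact K ∧ K ⊆ Ico 0 T := by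
  intro t ht
  refine ⟨Icc 0 ((t + T) / 2), ?_, isCompact_Icc, fun s hs => ⟨hs.1, by linarith [hs.2, ht.2]⟩⟩
  refine mem_nhdsWithin.2 ⟨Iio ((t + T) / 2), isOpen_Iio, by simp only [mem_Iio]; linarith [ht.2],
    fun s hs => ⟨hs.2.1, (mem_Iio.1 hs.1).le⟩⟩

section Pair

variable {ρ σ : ℝ → EuclideanSpace ℝ (Fin d) → ℝ}
  {u v : ℝ → EuclideanSpace ℝ (Fin d) → EuclideanSpace ℝ (Fin d)}

theorem relEnergy_eq_add (hα : 0 < α) (hαd : α < d) {r s : EuclideanSpace ℝ (Fin d) → ℝ}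
    {w z : EuclideanSpace ℝ (Fin d) → EuclideanSpace ℝ (Fin d)} (hr : Continuous r)
    (hs : Continuous s) (he : Continuous fun x => relEnergyDensity γ (r x) (w x) (s x) (z x)) :
    relEnergy α γ κ r w s z = (∫ x in cell d, relEnergyDensity γ (r x) (w x) (s x) (z x))
      + κ * (1 / 2) * ∫ x in cell d, (r x - s x) * rieszConv α (fun z => r z - s z) x := by
  rw [← integral_const_mul, ← integral_add (integrableOn_cell_of_continuous he)]
  · unfold relEnergy relEnergyDensity
    congr 1
    funext x
    ring
  · exact integrableOn_cell_of_continuous (continuous_const.mul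
      ((hr.sub hs).mul (continuous_rieszConv hα hαd (hr.sub hs))))

theorem continuousOn_relEnergyDensity (hγ : 1 < γ) (h₁ : IsPeriodicSolution α γ κ T ρ u)
    (h₂ : IsPeriodicSolution α γ κ T σ v) :
    ContinuousOn (Function.uncurry fun t x => relEnergyDensity γ (ρ t x) (u t x) (σ t x) (v t x))
      (Ico 0 T ×ˢ univ) := by
  have h1 := h₁.continuousOn_density
  have h2 := h₂.continuousOn_density
  have h3 := h₁.continuousOn_velocity.sub h₂.continuousOn_velocity
  unfold relEnergyDensity relInternalEnergy internalEnergy internalEnergy'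
  refine ((continuousOn_const.mul h1).mul (h3.norm.pow 2)).add
    (((continuousOn_const.mul (h1.rpow_const fun _ _ => Or.inr (by linarith))).sub
      (continuousOn_const.mul (h2.rpow_const fun _ _ => Or.inr (by linarith)))).sub
      ((continuousOn_const.mul (h2.rpow_const fun _ _ => Or.inr (by linarith))).mul (h1.sub h2)))

/-- Positivity of `σ` is needed for `σ^(γ-1)`, whose exponent may lie below 1. -/
theorem contDiffOn_relEnergyDensity (hγ : 1 < γ) (h₁ : IsPeriodicSolution α γ κ T ρ u)
    (h₂ : IsPeriodicSolution α γ κ T σ v) (hpos : ∀ t ∈ Ioo 0 T, ∀ x, 0 < σ t x) :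
    ContDiffOn ℝ 1 (Function.uncurry fun t x =>
      relEnergyDensity γ (ρ t x) (u t x) (σ t x) (v t x)) (Ioo 0 T ×ˢ univ) := by
  have h1 := h₁.contDiffOn_density
  have h2 := h₂.contDiffOn_density
  have h3 := h₁.contDiffOn_velocity.sub h₂.contDiffOn_velocity
  have hp : ContDiff ℝ 1 fun s : ℝ => s ^ γ :=
    Real.contDiff_rpow_const_of_le (by exact_mod_cast hγ.le)
  unfold relEnergyDensity relInternalEnergy internalEnergy internalEnergy'
  refine ((contDiffOn_const.mul h1).mul (h3.norm_sq ℝ)).add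
    (((contDiffOn_const.mul (hp.comp_contDiffOn h1)).sub
      (contDiffOn_const.mul (hp.comp_contDiffOn h2))).sub
      ((contDiffOn_const.mul (h2.rpow_const_of_ne fun z hz => (hpos z.1 hz.1 z.2).ne')).mul
        (h1.sub h2)))

theorem continuous_deriv_time {w : ℝ → EuclideanSpace ℝ (Fin d) → ℝ}
    (hw : ContDiffOn ℝ 1 (Function.uncurry w) (Ioo 0 T ×ˢ univ)) {t : ℝ} (ht : t ∈ Ioo 0 T) :
    Continuous fun x => deriv (fun s => w s x) t :=
  (continuous_fderiv_left isOpen_Ioo hw ht).clm_apply continuous_const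

theorem unitPeriodic_deriv_time {w : ℝ → EuclideanSpace ℝ (Fin d) → ℝ}
    (hw : ∀ t ∈ Ioo 0 T, UnitPeriodic (w t)) {t : ℝ} (ht : t ∈ Ioo 0 T) :
    UnitPeriodic fun x => deriv (fun s => w s x) t := by
  intro x i
  refine Filter.EventuallyEq.deriv_eq ?_
  filter_upwards [isOpen_Ioo.mem_nhds ht] with s hs
  exact hw s hs x i

theorem hasDerivAt_setIntegral_time {w : ℝ → EuclideanSpace ℝ (Fin d) → ℝ}
    (hw : ContDiffOn ℝ 1 (Function.uncurry w) (Ioo 0 T ×ˢ univ)) {t : ℝ} (ht : t ∈ Ioo 0 T) :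
    HasDerivAt (fun s => ∫ x in cell d, w s x) (∫ x in cell d, deriv (fun s => w s x) t) t := by
  have hk : Integrable (fun _ : EuclideanSpace ℝ (Fin d) => (1 : ℝ)) (volume.restrict (cell d)) :=
    integrable_const _
  have h := (hasFDerivAt_integral_mul_of_ae_mem_compact hk (isCompact_closedCell d)
    (ae_mem_closedCell d) isOpen_Ioo hw ht).differentiableAt.hasDerivAt
  have h2 := fderiv_integral_mul_apply hk (isCompact_closedCell d)
    (ae_mem_closedCell d) isOpen_Ioo hw ht 1
  simp only [one_mul] at h h2
  rw [← fderiv_apply_one_eq_deriv, h2] at h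
  exact h

theorem continuousOn_setIntegral_time {w : ℝ → EuclideanSpace ℝ (Fin d) → ℝ}
    (hw : ContinuousOn (Function.uncurry w) (Ico 0 T ×ˢ univ)) :
    ContinuousOn (fun s => ∫ x in cell d, w s x) (Ico 0 T) := by
  have h := continuousOn_integral_smul_of_ae_mem_compact
    (integrable_const (1 : ℝ) : Integrable _ (volume.restrict (cell d))) (isCompact_closedCell d)
    (ae_mem_closedCell d) exists_compact_nhdsWithin_Ico hw
  simpa only [one_smul] using h

theorem continuousOn_potential {g : ℝ → EuclideanSpace ℝ (Fin d) → ℝ} (hα : 0 < α) (hαd : α < d)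
    (hg : ContinuousOn (fun z : ℝ × EuclideanSpace ℝ (Fin d) => g z.1 z.2) (Ico 0 T ×ˢ univ)) :
    ContinuousOn (fun t => ∫ x in cell d, g t x * rieszConv α (g t) x) (Ico 0 T) := by
  have hc : ContinuousOn (Function.uncurry fun t
      (z : EuclideanSpace ℝ (Fin d) × EuclideanSpace ℝ (Fin d)) => g t z.1 * g t (z.1 - z.2))
      (Ico 0 T ×ˢ univ) := by
    refine ContinuousOn.mul ?_ ?_
    · exact hg.comp (f := fun p : ℝ × (EuclideanSpace ℝ (Fin d) × EuclideanSpace ℝ (Fin d)) =>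
        (p.1, p.2.1)) (by fun_prop) fun p hp => ⟨hp.1, mem_univ _⟩
    · exact hg.comp (f := fun p : ℝ × (EuclideanSpace ℝ (Fin d) × EuclideanSpace ℝ (Fin d)) =>
        (p.1, p.2.1 - p.2.2)) (by fun_prop) fun p hp => ⟨hp.1, mem_univ _⟩
  refine (continuousOn_integral_smul_of_ae_mem_compact (integrable_rieszKernel_pair hα hαd)
    (isCompact_pair d) (ae_mem_pair d) exists_compact_nhdsWithin_Ico hc).congr fun t ht => ?_
  have hgt := continuous_slice hg ht
  exact setIntegral_mul_rieszConv_eq hα hαd hgt hgt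

/-- Over pairs `(x, y)` the singular kernel is a time-independent weight, and the product rule acts
on `g(x) g(x-y)`. The two terms agree because the bilinear form is symmetric. -/
theorem hasDerivAt_potential {g : ℝ → EuclideanSpace ℝ (Fin d) → ℝ} (hα : 0 < α) (hαd : α < d)
    (hg : ContDiffOn ℝ 1 (fun z : ℝ × EuclideanSpace ℝ (Fin d) => g z.1 z.2) (Ioo 0 T ×ˢ univ))
    (hp : ∀ t ∈ Ioo 0 T, UnitPeriodic (g t)) {t : ℝ} (ht : t ∈ Ioo 0 T) :
    HasDerivAt (fun t => ∫ x in cell d, g t x * rieszConv α (g t) x)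
      (2 * ∫ x in cell d, deriv (fun s => g s x) t * rieszConv α (g t) x) t := by
  have hc : ContDiffOn ℝ 1 (Function.uncurry fun t
      (z : EuclideanSpace ℝ (Fin d) × EuclideanSpace ℝ (Fin d)) => g t z.1 * g t (z.1 - z.2))
      (Ioo 0 T ×ˢ univ) := by
    refine ContDiffOn.mul ?_ ?_
    · exact hg.comp (f := fun p : ℝ × (EuclideanSpace ℝ (Fin d) × EuclideanSpace ℝ (Fin d)) =>
        (p.1, p.2.1)) (by fun_prop) fun p hp => ⟨hp.1, mem_univ _⟩
    · exact hg.comp (f := fun p : ℝ × (EuclideanSpace ℝ (Fin d) × EuclideanSpace ℝ (Fin d)) =>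
        (p.1, p.2.1 - p.2.2)) (by fun_prop) fun p hp => ⟨hp.1, mem_univ _⟩
  have h := (hasFDerivAt_integral_mul_of_ae_mem_compact (integrable_rieszKernel_pair hα hαd)
    (isCompact_pair d) (ae_mem_pair d) isOpen_Ioo hc ht).differentiableAt.hasDerivAt
  rw [← fderiv_apply_one_eq_deriv, fderiv_integral_mul_apply (integrable_rieszKernel_pair hα hαd)
    (isCompact_pair d) (ae_mem_pair d) isOpen_Ioo hc ht 1] at h
  have hgt : ∀ s ∈ Ioo 0 T, Continuous (g s) := fun s hs => (contDiff_slice hg hs).continuous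
  have hg't : Continuous fun x => deriv (fun s => g s x) t := continuous_deriv_time hg ht
  refine (h.congr_deriv ?_).congr_of_eventuallyEq ?_
  · have hd : ∀ x, HasDerivAt (fun s => g s x) (deriv (fun s => g s x) t) t := fun x =>
      (differentiableAt_time hg ht x).hasDerivAt
    have hpt : ∀ z : EuclideanSpace ℝ (Fin d) × EuclideanSpace ℝ (Fin d),
        rieszKernel α z.2 * fderiv ℝ (fun s => g s z.1 * g s (z.1 - z.2)) t 1
        = rieszKernel α z.2 * (deriv (fun s => g s z.1) t * g t (z.1 - z.2))
          + rieszKernel α z.2 * (g t z.1 * deriv (fun s => g s (z.1 - z.2)) t) := by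
      intro z
      rw [fderiv_apply_one_eq_deriv, ((hd z.1).fun_mul (hd (z.1 - z.2))).deriv, mul_add]
    simp only [hpt]
    rw [integral_add (integrable_pair_interaction hα hαd hg't (hgt t ht))
      (integrable_pair_interaction hα hαd (hgt t ht) hg't),
      ← setIntegral_mul_rieszConv_eq hα hαd hg't (hgt t ht),
      ← setIntegral_mul_rieszConv_eq hα hαd (hgt t ht) hg't,
      setIntegral_mul_rieszConv_comm hα hαd (hgt t ht) hg't (hp t ht)
        (unitPeriodic_deriv_time hp ht), two_mul]
  · filter_upwards [isOpen_Ioo.mem_nhds ht] with s hs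
    exact setIntegral_mul_rieszConv_eq hα hαd (hgt s hs) (hgt s hs)

end Pair

end EulerRiesz

/-! ### The integrated relative energy identity, Grönwall's inequality and conservation of mass -/

namespace EulerRiesz

open scoped Topology

variable {d : ℕ} {α γ κ T : ℝ} {ρ σ : ℝ → EuclideanSpace ℝ (Fin d) → ℝ}
  {u v : ℝ → EuclideanSpace ℝ (Fin d) → EuclideanSpace ℝ (Fin d)}

theorem continuousOn_relEnergy (hα : 0 < α) (hαd : α < d) (hγ : 1 < γ)
    (h₁ : IsPeriodicSolution α γ κ T ρ u) (h₂ : IsPeriodicSolution α γ κ T σ v) :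
    ContinuousOn (fun t => relEnergy α γ κ (ρ t) (u t) (σ t) (v t)) (Ico 0 T) := by
  have he := continuousOn_relEnergyDensity hγ h₁ h₂
  refine ((continuousOn_setIntegral_time he).add ((continuousOn_const (c := κ * (1 / 2))).mul
    (continuousOn_potential (g := fun t x => ρ t x - σ t x) hα hαd
      (h₁.continuousOn_density.sub h₂.continuousOn_density)))).congr fun t ht => ?_
  exact relEnergy_eq_add hα hαd (continuous_slice h₁.continuousOn_density ht)
    (continuous_slice h₂.continuousOn_density ht) (continuous_slice (w := fun t x =>
      relEnergyDensity γ (ρ t x) (u t x) (σ t x) (v t x)) he ht)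

theorem continuous_relEnergyRate (hα : 0 < α) (hαd : α < d) (hγ : 1 < γ)
    (h₁ : IsPeriodicSolution α γ κ T ρ u) (h₂ : IsPeriodicSolution α γ κ T σ v)
    {t : ℝ} (ht : t ∈ Ioo 0 T) :
    Continuous (relEnergyRate α γ κ (ρ t) (u t) (σ t) (v t)) := by
  have hρ := (h₁.contDiff_density ht).continuous
  have hσ := (h₂.contDiff_density ht).continuous
  have hu := fun i => (h₁.contDiff_velocity ht i).continuous
  have hv := fun i => (h₂.contDiff_velocity ht i).continuous
  have hD := fun i j => continuous_partialX (h₂.contDiff_velocity ht i) j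
  have hS := fun i j => continuous_rieszTensor hα hαd (hρ.sub hσ) i j
  unfold relEnergyRate relInternalEnergy internalEnergy internalEnergy'
  refine ((hρ.mul (continuous_finsetSum _ fun i _ => ((hu i).sub (hv i)).mul
    (continuous_finsetSum _ fun j _ => (hD i j).mul ((hu j).sub (hv j))))).neg.sub
    ((continuous_const.mul (((continuous_const.mul (hρ.rpow_const fun _ => Or.inr (by linarith))).sub
      (continuous_const.mul (hσ.rpow_const fun _ => Or.inr (by linarith)))).sub
      ((continuous_const.mul (hσ.rpow_const fun _ => Or.inr (by linarith))).mul (hρ.sub hσ)))).mul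
      (continuous_finsetSum _ fun j _ => hD j j))).sub
    (continuous_const.mul (continuous_finsetSum _ fun i _ => continuous_finsetSum _ fun j _ =>
      (hD i j).mul (hS i j)))

/-- The relative energy identity. -/
theorem hasDerivAt_relEnergy (hα : 0 < α) (hαd : α < d) (hγ : 1 < γ)
    (h₁ : IsPeriodicSolution α γ κ T ρ u) (h₂ : IsPeriodicSolution α γ κ T σ v)
    (hpos : ∀ t ∈ Ioo 0 T, ∀ x, 0 < σ t x) {t : ℝ} (ht : t ∈ Ioo 0 T) :
    HasDerivAt (fun t => relEnergy α γ κ (ρ t) (u t) (σ t) (v t))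
      (∫ x in cell d, relEnergyRate α γ κ (ρ t) (u t) (σ t) (v t) x) t := by
  have he := contDiffOn_relEnergyDensity hγ h₁ h₂ hpos
  have hg : ContDiffOn ℝ 1 (fun z : ℝ × EuclideanSpace ℝ (Fin d) => ρ z.1 z.2 - σ z.1 z.2)
      (Ioo 0 T ×ˢ univ) := h₁.contDiffOn_density.sub h₂.contDiffOn_density
  have hgp : ∀ t ∈ Ioo 0 T, UnitPeriodic fun x => ρ t x - σ t x := fun t ht =>
    (h₁.periodic_density t (Ioo_subset_Ico_self ht)).map₂
      (h₂.periodic_density t (Ioo_subset_Ico_self ht)) (· - ·)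
  have h := (hasDerivAt_setIntegral_time he ht).add
    ((hasDerivAt_potential (g := fun t x => ρ t x - σ t x) hα hαd hg hgp ht).const_mul
      (κ * (1 / 2)))
  refine (h.congr_deriv ?_).congr_of_eventuallyEq ?_
  · have hflux := fun j => contDiff_relEnergyFlux (κ := κ) hα hαd hγ (h₁.contDiff_density ht)
      (h₂.contDiff_density ht) (h₁.contDiff_velocity ht) (h₂.contDiff_velocity ht) (hpos t ht) j
    have ht' := Ioo_subset_Ico_self ht
    -- The flux is periodic and `C¹`, so its divergence has zero integral.
    have hdiv : ∫ x in cell d, ∑ j, partialX j (relEnergyFlux α γ κ (ρ t) (u t) (σ t) (v t) j) x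
        = 0 := by
      rw [integral_finsetSum _ fun j _ => integrableOn_cell_of_continuous
        (continuous_partialX (hflux j) j)]
      refine Finset.sum_eq_zero fun j _ => setIntegral_partialX_eq_zero (hflux j) j fun x _ => ?_
      exact (h₁.periodic_density t ht').relEnergyFlux (h₂.periodic_density t ht')
        (h₁.periodic_velocity t ht') (h₂.periodic_velocity t ht') j x j
    have hgc : Continuous fun x => ρ t x - σ t x :=
      (h₁.contDiff_density ht).continuous.sub (h₂.contDiff_density ht).continuous
    have hi1 : IntegrableOn (fun x =>
        deriv (fun s => relEnergyDensity γ (ρ s x) (u s x) (σ s x) (v s x)) t) (cell d) :=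
      integrableOn_cell_of_continuous (continuous_deriv_time he ht)
    have hi2 : IntegrableOn (fun x => κ * (deriv (fun s => ρ s x - σ s x) t *
        rieszConv α (fun z => ρ t z - σ t z) x)) (cell d) :=
      integrableOn_cell_of_continuous (continuous_const.mul ((continuous_deriv_time (w := fun t x => ρ t x - σ t x) hg ht).mul
        (continuous_rieszConv hα hαd hgc)))
    have hi3 : IntegrableOn (fun x => ∑ j,
        partialX j (relEnergyFlux α γ κ (ρ t) (u t) (σ t) (v t) j) x) (cell d) :=
      integrableOn_cell_of_continuous (continuous_finsetSum _ fun j _ => continuous_partialX (hflux j) j)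
    simp only [← deriv_relEnergyDensity_add_div_flux hα hαd hγ h₁ h₂ ht (hpos t ht)]
    have hi12 : IntegrableOn (fun x =>
        deriv (fun s => relEnergyDensity γ (ρ s x) (u s x) (σ s x) (v s x)) t
          + κ * (deriv (fun s => ρ s x - σ s x) t * rieszConv α (fun z => ρ t z - σ t z) x))
        (cell d) := hi1.add hi2
    rw [integral_add hi12 hi3, integral_add hi1 hi2, hdiv, integral_const_mul]
    ring
  · filter_upwards [isOpen_Ioo.mem_nhds ht] with s hs
    exact relEnergy_eq_add hα hαd (h₁.contDiff_density hs).continuous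
      (h₂.contDiff_density hs).continuous
      (continuous_slice (w := fun t x =>
      relEnergyDensity γ (ρ t x) (u t x) (σ t x) (v t x)) (continuousOn_relEnergyDensity hγ h₁ h₂) (Ioo_subset_Ico_self hs))

/-- Grönwall's inequality on a half-open interval. -/
theorem le_exp_mul_of_hasDerivAt_le {f f' : ℝ → ℝ} {C : ℝ} (hf : ContinuousOn f (Ico 0 T))
    (hd : ∀ t ∈ Ioo 0 T, HasDerivAt f (f' t) t) (hle : ∀ t ∈ Ioo 0 T, f' t ≤ C * f t) :
    ∀ t ∈ Ico 0 T, f t ≤ Real.exp (C * t) * f 0 := by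
  intro t ht
  -- The function `e^(-Cs) f(s)` has nonpositive derivative in the interior and is continuous down
  -- to `s = 0`, hence is nonincreasing.
  have hder : ∀ s ∈ Ioo 0 T, HasDerivAt (fun s => Real.exp (-(C * s)) * f s)
      (Real.exp (-(C * s)) * (f' s - C * f s)) s := by
    intro s hs
    have h1 : HasDerivAt (fun s => Real.exp (-(C * s))) (Real.exp (-(C * s)) * -(C * 1)) s :=
      ((hasDerivAt_id s).const_mul C).neg.exp
    refine (h1.fun_mul (hd s hs)).congr_deriv ?_
    ring
  have hanti : AntitoneOn (fun s => Real.exp (-(C * s)) * f s) (Ico 0 T) := by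
    refine antitoneOn_of_deriv_nonpos (convex_Ico 0 T) (by fun_prop) ?_ ?_
    · rw [interior_Ico]
      exact fun s hs => (hder s hs).differentiableAt.differentiableWithinAt
    · rw [interior_Ico]
      intro s hs
      rw [(hder s hs).deriv]
      exact mul_nonpos_of_nonneg_of_nonpos (Real.exp_pos _).le (by linarith [hle s hs])
  have h := hanti ⟨le_rfl, ht.1.trans_lt ht.2⟩ ht ht.1
  simp only [mul_zero, neg_zero, Real.exp_zero, one_mul] at h
  rw [Real.exp_neg, inv_mul_le_iff₀ (Real.exp_pos _)] at h
  exact h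

/-- Conservation of mass. -/
theorem IsPeriodicSolution.setIntegral_density (h : IsPeriodicSolution α γ κ T ρ u) {t : ℝ}
    (ht : t ∈ Ico 0 T) : ∫ x in cell d, ρ t x = ∫ x in cell d, ρ 0 x := by
  have hder : ∀ s ∈ Ioo 0 T, HasDerivAt (fun s => ∫ x in cell d, ρ s x) 0 s := by
    intro s hs
    refine (hasDerivAt_setIntegral_time h.contDiffOn_density hs).congr_deriv ?_
    have hs' := Ioo_subset_Ico_self hs
    have hf := fun j => (h.contDiff_density hs).mul (h.contDiff_velocity hs j)
    have e : ∀ x, deriv (fun s => ρ s x) s = -∑ j, partialX j (fun z => ρ s z * u s z j) x :=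
      fun x => eq_neg_of_add_eq_zero_left (h.mass s hs x)
    simp only [e]
    rw [integral_neg, integral_finsetSum _ fun j _ => integrableOn_cell_of_continuous
      (continuous_partialX (hf j) j), neg_eq_zero]
    refine Finset.sum_eq_zero fun j _ => setIntegral_partialX_eq_zero (hf j) j fun x _ => ?_
    simp only [h.periodic_density s hs' x j, h.periodic_velocity s hs' x j]
  have hcont := continuousOn_setIntegral_time h.continuousOn_density
  -- Grönwall with constant 0, for the mass and for its negative, gives both inequalities.
  have h1 := le_exp_mul_of_hasDerivAt_le (C := 0) hcont hder (by simp) t ht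
  have h2 := le_exp_mul_of_hasDerivAt_le (C := 0) hcont.neg (fun s hs => (hder s hs).neg)
    (by simp) t ht
  simp only [zero_mul, Real.exp_zero, one_mul, Pi.neg_apply] at h1 h2
  linarith

end EulerRiesz

/-! ### Bounds for `S_α` and for the rate of change of the relative energy -/

namespace EulerRiesz

open scoped Topology

variable {d : ℕ} {α : ℝ}

/-- For fixed `θ` and `y`, Tonelli and the shift `x ↦ x + θy` turn the two-point product into
`|g(x)| |g(x-y)|`. Nothing then depends on `θ`, whose range has length 1. -/
theorem lintegral_enorm_rieszTensor_le (hα : 0 < α) (hαd : α < d)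
    {g : EuclideanSpace ℝ (Fin d) → ℝ} (hg : Continuous g) (hp : UnitPeriodic g) (i j : Fin d) :
    ∫⁻ x in cell d, ‖rieszTensor α g x i j‖ₑ ≤ ENNReal.ofReal (1 / 2) * absInteraction α g := by
  have hk := measurable_singularWeight (d := d) α
  have : SFinite (stripMeasure d) := by unfold stripMeasure; infer_instance
  calc ∫⁻ x in cell d, ‖rieszTensor α g x i j‖ₑ
      ≤ ∫⁻ x in cell d, ENNReal.ofReal (1 / 2) * ∫⁻ z, singularWeight α z.2 *
          (‖g (x + (z.1 - 1) • z.2)‖ₑ * ‖g (x + z.1 • z.2)‖ₑ) ∂stripMeasure d := by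
        refine lintegral_mono fun x => ?_
        rw [rieszTensor_eq hα hαd hg, enorm_mul, Real.enorm_of_nonneg (by norm_num)]
        gcongr
        refine (enorm_integral_le_lintegral_enorm _).trans (lintegral_mono fun z => ?_)
        rw [enorm_mul, twoPoint, enorm_mul]
        gcongr
        rw [← ofReal_norm]
        exact ENNReal.ofReal_le_ofReal (abs_tensorKernel_le hαd i j z.2)
    _ = ENNReal.ofReal (1 / 2) * ∫⁻ z, ∫⁻ x in cell d, singularWeight α z.2 *
          (‖g (x + (z.1 - 1) • z.2)‖ₑ * ‖g (x + z.1 • z.2)‖ₑ) ∂volume ∂stripMeasure d := by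
        rw [lintegral_const_mul' _ _ (by simp), lintegral_lintegral_swap]
        · exact Measurable.aemeasurable (by unfold Function.uncurry; fun_prop)
    _ = ENNReal.ofReal (1 / 2) * ∫⁻ z, ∫⁻ x in cell d, singularWeight α z.2 *
          (‖g x‖ₑ * ‖g (x - z.2)‖ₑ) ∂volume ∂stripMeasure d := by
        congr 1
        refine lintegral_congr fun z => ?_
        have hq : UnitPeriodic fun x => singularWeight α z.2 * (‖g x‖ₑ * ‖g (x - z.2)‖ₑ) :=
          hp.map₂ (hp.comp_add (-z.2)) fun s t => singularWeight α z.2 * (‖s‖ₑ * ‖t‖ₑ)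
        rw [← hq.setLIntegral_add (z.1 • z.2)]
        refine lintegral_congr fun x => ?_
        rw [mul_comm ‖g (x + z.1 • z.2)‖ₑ, sub_smul, one_smul, add_sub_assoc]
    _ = ENNReal.ofReal (1 / 2) * absInteraction α g := by
        congr 1
        have hm : Measurable fun p : EuclideanSpace ℝ (Fin d) × EuclideanSpace ℝ (Fin d) =>
            singularWeight α p.1 * (‖g p.2‖ₑ * ‖g (p.2 - p.1)‖ₑ) := by fun_prop
        have hF : Measurable fun y => ∫⁻ x in cell d, singularWeight α y * (‖g x‖ₑ * ‖g (x - y)‖ₑ) :=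
          hm.lintegral_prod_right'
        rw [stripMeasure, lintegral_prod (fun z : ℝ × EuclideanSpace ℝ (Fin d) =>
          ∫⁻ x in cell d, singularWeight α z.2 * (‖g x‖ₑ * ‖g (x - z.2)‖ₑ))
          (hF.comp measurable_snd).aemeasurable]
        simp only [lintegral_const, Measure.restrict_apply_univ, Real.volume_Ioc, sub_zero,
          ENNReal.ofReal_one, mul_one]
        exact (lintegral_lintegral_swap (f := fun x y =>
          singularWeight α y * (‖g x‖ₑ * ‖g (x - y)‖ₑ)) (hm.comp measurable_swap).aemeasurable).symm

theorem sum_setIntegral_abs_rieszTensor_le (hα : 0 < α) (hαd : α < d)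
    {g : EuclideanSpace ℝ (Fin d) → ℝ} (hg : Continuous g) (hp : UnitPeriodic g) {B : ℝ}
    (hB0 : 0 ≤ B) (hB : absInteraction α g ≤ ENNReal.ofReal B) :
    ∑ i, ∑ j, ∫ x in cell d, |rieszTensor α g x i j| ≤ (d : ℝ) ^ 2 * B := by
  have h : ∀ i j, ∫ x in cell d, |rieszTensor α g x i j| ≤ B := by
    intro i j
    have hint := integrableOn_cell_of_continuous (continuous_rieszTensor hα hαd hg i j)
    rw [← ENNReal.ofReal_le_ofReal_iff hB0]
    calc ENNReal.ofReal (∫ x in cell d, |rieszTensor α g x i j|)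
        = ∫⁻ x in cell d, ‖rieszTensor α g x i j‖ₑ :=
          ofReal_integral_norm_eq_lintegral_enorm hint
      _ ≤ ENNReal.ofReal (1 / 2) * absInteraction α g := lintegral_enorm_rieszTensor_le hα hαd hg hp i j
      _ ≤ 1 * ENNReal.ofReal B := by
          gcongr
          rw [← ENNReal.ofReal_one]
          exact ENNReal.ofReal_le_ofReal (by norm_num)
      _ = _ := one_mul _
  calc _ ≤ ∑ _i : Fin d, ∑ _j : Fin d, B := Finset.sum_le_sum fun i _ => Finset.sum_le_sum fun j _ => h i j
    _ = _ := by simp; ring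

theorem memLp_of_continuous {f : EuclideanSpace ℝ (Fin d) → ℝ} (hf : Continuous f) (p : ENNReal) :
    MemLp f p (volume.restrict (cell d)) := by
  obtain ⟨B, hB⟩ := (isCompact_closedCell d).exists_bound_of_continuousOn hf.continuousOn
  exact MemLp.of_bound hf.aestronglyMeasurable B ((ae_mem_closedCell d).mono hB)

/-- The pointwise bound for the right-hand side of the relative energy identity. -/
theorem relEnergyRate_le {γ κ L : ℝ} (hγ : 1 < γ) {ρ σ : EuclideanSpace ℝ (Fin d) → ℝ}
    {u v : EuclideanSpace ℝ (Fin d) → EuclideanSpace ℝ (Fin d)} {x : EuclideanSpace ℝ (Fin d)}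
    (hρ : 0 ≤ ρ x) (hσ : 0 < σ x) (hv : DifferentiableAt ℝ v x) (hL : ‖fderiv ℝ v x‖ ≤ L) :
    relEnergyRate α γ κ ρ u σ v x
      ≤ 2 * L * (1 / 2 * ρ x * ‖u x - v x‖ ^ 2)
        + (γ - 1) * (d * L) * relInternalEnergy γ (ρ x) (σ x)
        + |κ| * L * ∑ i, ∑ j, |rieszTensor α (fun z => ρ z - σ z) x i j| := by
  have hD : ∀ i j, partialX j (fun z => v z i) x = fderiv ℝ v x (EuclideanSpace.single j 1) i := by
    intro i j
    have h := ((EuclideanSpace.proj i : EuclideanSpace ℝ (Fin d) →L[ℝ] ℝ).hasFDerivAt.comp x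
      hv.hasFDerivAt).fderiv
    rw [partialX]
    exact congrArg (fun T : EuclideanSpace ℝ (Fin d) →L[ℝ] ℝ => T (EuclideanSpace.single j 1)) h
  have habs : ∀ i j, |partialX j (fun z => v z i) x| ≤ L := by
    intro i j
    rw [hD]
    refine (abs_coord_le_norm _ i).trans (((fderiv ℝ v x).le_opNorm _).trans ?_)
    simpa using hL
  have h1 : -(ρ x * ∑ i, (u x i - v x i) * ∑ j, partialX j (fun z => v z i) x * (u x j - v x j))
      ≤ 2 * L * (1 / 2 * ρ x * ‖u x - v x‖ ^ 2) := by
    -- The double sum is the quadratic form of the derivative of `v`, so the operator norm bounds it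
    -- without a dimensional constant.
    have e : ∑ i, (u x i - v x i) * ∑ j, partialX j (fun z => v z i) x * (u x j - v x j)
        = inner ℝ (fderiv ℝ v x (u x - v x)) (u x - v x) := by
      rw [PiLp.inner_apply]
      refine Finset.sum_congr rfl fun i _ => ?_
      have : ∑ j, partialX j (fun z => v z i) x * (u x j - v x j)
          = fderiv ℝ v x (u x - v x) i := by
        conv_rhs => rw [← sum_smul_single (u x - v x)]
        rw [map_sum, WithLp.ofLp_sum, Finset.sum_apply]
        refine Finset.sum_congr rfl fun j _ => ?_
        rw [hD, map_smul]
        simp [mul_comm]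
      rw [this]
      simp
    rw [e, ← mul_neg]
    have h2 : -inner ℝ (fderiv ℝ v x (u x - v x)) (u x - v x) ≤ L * ‖u x - v x‖ ^ 2 := by
      refine (neg_le_abs _).trans ((abs_real_inner_le_norm _ _).trans ?_)
      calc ‖fderiv ℝ v x (u x - v x)‖ * ‖u x - v x‖ ≤ L * ‖u x - v x‖ * ‖u x - v x‖ := by
            gcongr
            exact (fderiv ℝ v x).le_of_opNorm_le hL _
        _ = _ := by ring
    calc _ ≤ ρ x * (L * ‖u x - v x‖ ^ 2) := by gcongr
      _ = _ := by ring
  have h2 : -((γ - 1) * relInternalEnergy γ (ρ x) (σ x) * ∑ j, partialX j (fun z => v z j) x)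
      ≤ (γ - 1) * (d * L) * relInternalEnergy γ (ρ x) (σ x) := by
    have h0 := relInternalEnergy_nonneg hγ hρ hσ
    have hs : -∑ j, partialX j (fun z => v z j) x ≤ d * L := by
      rw [← Finset.sum_neg_distrib]
      calc _ ≤ ∑ _j : Fin d, L := Finset.sum_le_sum fun j _ => (neg_le_abs _).trans (habs j j)
        _ = _ := by simp
    have hg : 0 ≤ γ - 1 := by linarith
    calc _ = (γ - 1) * relInternalEnergy γ (ρ x) (σ x) * (-∑ j, partialX j (fun z => v z j) x) := by ring
      _ ≤ (γ - 1) * relInternalEnergy γ (ρ x) (σ x) * (d * L) := by gcongr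
      _ = _ := by ring
  have h3 : -(κ * ∑ i, ∑ j, partialX j (fun z => v z i) x * rieszTensor α (fun z => ρ z - σ z) x i j)
      ≤ |κ| * L * ∑ i, ∑ j, |rieszTensor α (fun z => ρ z - σ z) x i j| := by
    refine (neg_le_abs _).trans ?_
    rw [abs_mul, mul_assoc, Finset.mul_sum]
    gcongr
    refine (Finset.abs_sum_le_sum_abs _ _).trans (Finset.sum_le_sum fun i _ => ?_)
    rw [Finset.mul_sum]
    refine (Finset.abs_sum_le_sum_abs _ _).trans (Finset.sum_le_sum fun j _ => ?_)
    rw [abs_mul]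
    gcongr
    exact habs i j
  unfold relEnergyRate
  linarith

end EulerRiesz

/-! ### Coercivity, the dissipation inequality and stability -/

namespace EulerRiesz

variable {d : ℕ} {α γ κ T : ℝ} {ρ σ : ℝ → EuclideanSpace ℝ (Fin d) → ℝ}
  {u v : ℝ → EuclideanSpace ℝ (Fin d) → EuclideanSpace ℝ (Fin d)}

section State

variable {r s : EuclideanSpace ℝ (Fin d) → ℝ}
  {w z : EuclideanSpace ℝ (Fin d) → EuclideanSpace ℝ (Fin d)}

theorem continuous_relInternalEnergy (hγ : 1 < γ) (hr : Continuous r) (hs : Continuous s) :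
    Continuous fun x => relInternalEnergy γ (r x) (s x) := by
  unfold relInternalEnergy internalEnergy internalEnergy'
  exact ((continuous_const.mul (hr.rpow_const fun _ => Or.inr (by linarith))).sub
    (continuous_const.mul (hs.rpow_const fun _ => Or.inr (by linarith)))).sub
    ((continuous_const.mul (hs.rpow_const fun _ => Or.inr (by linarith))).mul (hr.sub hs))

theorem relKineticEnergy_nonneg (h : ∀ x, 0 ≤ r x) : 0 ≤ relKineticEnergy r w z :=
  integral_nonneg fun x => by have := h x; positivity

/-- Coercivity of the relative energy. -/
theorem relKineticEnergy_add_le_relEnergy (hα : 0 < α) (hαd : α < d) (hγ : 1 < γ)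
    (hr : Continuous r) (hs : Continuous s) (hw : Continuous w) (hz : Continuous z) {C : ℝ}
    (hC : IsInteractionConstant α γ C r s) :
    relKineticEnergy r w z + (1 - |κ| * C / 2) * totalRelInternalEnergy γ r s
      ≤ relEnergy α γ κ r w s z := by
  have hK : Continuous fun x => 1 / 2 * r x * ‖w x - z x‖ ^ 2 := by fun_prop
  have hH := continuous_relInternalEnergy hγ hr hs
  rw [relEnergy_eq_add hα hαd hr hs (hK.add hH)]
  unfold relEnergyDensity
  rw [integral_add (integrableOn_cell_of_continuous hK) (integrableOn_cell_of_continuous hH)]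
  have h1 : |κ * (1 / 2) * ∫ x in cell d, (r x - s x) * rieszConv α (fun z => r z - s z) x|
      ≤ |κ| * (1 / 2) * (C * totalRelInternalEnergy γ r s) := by
    rw [abs_mul, abs_mul, abs_of_nonneg (by norm_num : (0 : ℝ) ≤ 1 / 2)]
    gcongr
    exact abs_integral_le_integral_abs.trans hC.2
  have h2 := (abs_le.1 h1).1
  unfold relKineticEnergy
  unfold totalRelInternalEnergy at *
  linarith

end State

/-- The dissipation inequality for the relative energy. -/
theorem setIntegral_relEnergyRate_le (hα : 0 < α) (hαd : α < d) (hγ : 1 < γ)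
    (h₁ : IsPeriodicSolution α γ κ T ρ u) (h₂ : IsPeriodicSolution α γ κ T σ v)
    {t L : ℝ} (ht : t ∈ Ioo 0 T) (hpos : ∀ x, 0 < σ t x) (hL : ∀ x, ‖fderiv ℝ (v t) x‖ ≤ L) :
    ∫ x in cell d, relEnergyRate α γ κ (ρ t) (u t) (σ t) (v t) x
      ≤ 2 * L * relKineticEnergy (ρ t) (u t) (v t)
        + (γ - 1) * (d * L) * totalRelInternalEnergy γ (ρ t) (σ t)
        + |κ| * L * ∑ i, ∑ j, ∫ x in cell d, |rieszTensor α (fun z => ρ t z - σ t z) x i j| := by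
  have ht' := Ioo_subset_Ico_self ht
  have hρ := continuous_slice h₁.continuousOn_density ht'
  have hσ := continuous_slice h₂.continuousOn_density ht'
  have hu := continuous_slice h₁.continuousOn_velocity ht'
  have hv := continuous_slice h₂.continuousOn_velocity ht'
  have hK : IntegrableOn (fun x => 2 * L * (1 / 2 * ρ t x * ‖u t x - v t x‖ ^ 2)) (cell d) :=
    integrableOn_cell_of_continuous (by fun_prop)
  have hH : IntegrableOn (fun x => (γ - 1) * (d * L) * relInternalEnergy γ (ρ t x) (σ t x))
      (cell d) := integrableOn_cell_of_continuous
    (continuous_const.mul (continuous_relInternalEnergy hγ hρ hσ))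
  have hS : ∀ i j, IntegrableOn (fun x => |rieszTensor α (fun z => ρ t z - σ t z) x i j|)
      (cell d) := fun i j =>
    integrableOn_cell_of_continuous (continuous_rieszTensor hα hαd (hρ.sub hσ) i j).abs
  have hSS : IntegrableOn (fun x => |κ| * L *
      ∑ i, ∑ j, |rieszTensor α (fun z => ρ t z - σ t z) x i j|) (cell d) :=
    (integrable_finsetSum _ fun i _ => integrable_finsetSum _ fun j _ => hS i j).const_mul _
  have hKH : IntegrableOn (fun x => 2 * L * (1 / 2 * ρ t x * ‖u t x - v t x‖ ^ 2)
      + (γ - 1) * (d * L) * relInternalEnergy γ (ρ t x) (σ t x)) (cell d) := hK.add hH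
  calc _ ≤ ∫ x in cell d, (2 * L * (1 / 2 * ρ t x * ‖u t x - v t x‖ ^ 2)
        + (γ - 1) * (d * L) * relInternalEnergy γ (ρ t x) (σ t x)
        + |κ| * L * ∑ i, ∑ j, |rieszTensor α (fun z => ρ t z - σ t z) x i j|) := by
        refine integral_mono (integrableOn_cell_of_continuous
          (continuous_relEnergyRate hα hαd hγ h₁ h₂ ht)) (hKH.add hSS) fun x => ?_
        exact relEnergyRate_le hγ (h₁.density_nonneg t ht' x) (hpos x)
          ((contDiff_slice h₂.contDiffOn_velocity ht).differentiable one_ne_zero x) (hL x)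
    _ = _ := by
        rw [integral_add hKH hSS, integral_add hK hH, integral_const_mul, integral_const_mul,
          integral_const_mul, integral_finsetSum _ fun i _ => integrable_finsetSum _ fun j _ => hS i j]
        simp only [integral_finsetSum _ fun j _ => hS _ j]
        rfl

/-- Stability of classical solutions in relative energy. -/
theorem exists_relEnergy_le_exp_mul (hα : 0 < α) (hαd : α < d) (hγ : 2 - α / (d : ℝ) ≤ γ)
    {δ : ℝ} (M m : ℝ) (hδ : 0 < δ) {Cs κ : ℝ} (L : ℝ) (hCs : 0 < Cs) (hκ : |κ| < 2 / Cs) :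
    ∃ C : ℝ, 0 < C ∧
      ∀ (T : ℝ) (ρ : ℝ → EuclideanSpace ℝ (Fin d) → ℝ)
        (u : ℝ → EuclideanSpace ℝ (Fin d) → EuclideanSpace ℝ (Fin d))
        (σ : ℝ → EuclideanSpace ℝ (Fin d) → ℝ)
        (v : ℝ → EuclideanSpace ℝ (Fin d) → EuclideanSpace ℝ (Fin d)),
        0 < T → IsPeriodicSolution α γ κ T ρ u → IsPeriodicSolution α γ κ T σ v →
        (∀ t ∈ Ico 0 T, ∀ x, δ ≤ σ t x ∧ σ t x ≤ M) →
        (∀ t ∈ Ioo 0 T, ∀ x, ‖fderiv ℝ (v t) x‖ ≤ L) →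
        ∫ x in cell d, ρ 0 x ≤ m →
        (∀ t ∈ Ico 0 T, IsInteractionConstant α γ Cs (ρ t) (σ t)) →
        ∀ t ∈ Ico 0 T,
          0 ≤ relEnergy α γ κ (ρ t) (u t) (σ t) (v t) ∧
          relKineticEnergy (ρ t) (u t) (v t)
              + (1 - |κ| * Cs / 2) * totalRelInternalEnergy γ (ρ t) (σ t)
            ≤ relEnergy α γ κ (ρ t) (u t) (σ t) (v t) ∧
          ∑ i, ∑ j, ∫ x in cell d, |rieszTensor α (fun z => ρ t z - σ t z) x i j|
            ≤ C * totalRelInternalEnergy γ (ρ t) (σ t) ∧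
          relEnergy α γ κ (ρ t) (u t) (σ t) (v t)
            ≤ Real.exp (C * T) * relEnergy α γ κ (ρ 0) (u 0) (σ 0) (v 0) := by
  have hγ1 := one_lt_of_two_sub_div_le hα hαd hγ
  obtain ⟨C₀, hC₀, hint⟩ := exists_absInteraction_le hα hαd hγ M m hδ
  -- The smallness of `κ` is exactly positivity of this coercivity factor.
  have hlam : 0 < 1 - |κ| * Cs / 2 := by
    rw [lt_div_iff₀ hCs] at hκ
    linarith
  set lam := 1 - |κ| * Cs / 2
  have hB0 : 0 ≤ (γ - 1) * (d * |L|) + |κ| * |L| * ((d : ℝ) ^ 2 * C₀) := by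
    have : 0 ≤ γ - 1 := by linarith
    positivity
  -- The total coefficient of the internal energy in the rate, after `S_α` is absorbed. Dividing by
  -- `lam` trades it for the coercive quantity, which explains `C₁` below.
  set B := (γ - 1) * (d * |L|) + |κ| * |L| * ((d : ℝ) ^ 2 * C₀)
  have hC1 : 0 ≤ 2 * |L| + B / lam := by positivity
  set C₁ := 2 * |L| + B / lam
  -- One constant serves both the tensor bound (`d² C₀`) and the Grönwall rate (`C₁`); the 1 makes
  -- it positive.
  refine ⟨C₁ + (d : ℝ) ^ 2 * C₀ + 1, by positivity, ?_⟩
  intro T ρ u σ v hT h₁ h₂ hσ hL hm hI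
  have hρc := fun t (ht : t ∈ Ico 0 T) => continuous_slice h₁.continuousOn_density ht
  have hσc := fun t (ht : t ∈ Ico 0 T) => continuous_slice h₂.continuousOn_density ht
  have hH : ∀ t ∈ Ico 0 T, 0 ≤ totalRelInternalEnergy γ (ρ t) (σ t) := fun t ht =>
    totalRelInternalEnergy_nonneg hγ1 hδ (h₁.density_nonneg t ht) fun x => (hσ t ht x).1
  have hK : ∀ t ∈ Ico 0 T, 0 ≤ relKineticEnergy (ρ t) (u t) (v t) := fun t ht =>
    relKineticEnergy_nonneg (h₁.density_nonneg t ht)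
  have hcoer : ∀ t ∈ Ico 0 T, relKineticEnergy (ρ t) (u t) (v t)
      + lam * totalRelInternalEnergy γ (ρ t) (σ t) ≤ relEnergy α γ κ (ρ t) (u t) (σ t) (v t) :=
    fun t ht => relKineticEnergy_add_le_relEnergy hα hαd hγ1 (hρc t ht) (hσc t ht)
      (continuous_slice h₁.continuousOn_velocity ht)
      (continuous_slice h₂.continuousOn_velocity ht) (hI t ht)
  have hΨ : ∀ t ∈ Ico 0 T, 0 ≤ relEnergy α γ κ (ρ t) (u t) (σ t) (v t) := fun t ht =>
    (add_nonneg (hK t ht) (mul_nonneg hlam.le (hH t ht))).trans (hcoer t ht)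
  have hS : ∀ t ∈ Ico 0 T,
      ∑ i, ∑ j, ∫ x in cell d, |rieszTensor α (fun z => ρ t z - σ t z) x i j|
        ≤ (d : ℝ) ^ 2 * C₀ * totalRelInternalEnergy γ (ρ t) (σ t) := by
    intro t ht
    rw [mul_assoc]
    refine sum_setIntegral_abs_rieszTensor_le hα hαd ((hρc t ht).sub (hσc t ht))
      ((h₁.periodic_density t ht).map₂ (h₂.periodic_density t ht) (· - ·))
      (mul_nonneg hC₀.le (hH t ht)) ?_
    -- The mass bound is assumed at time 0 only; conservation of mass carries it to time `t`.
    exact hint _ _ (h₁.periodic_density t ht) (h₂.periodic_density t ht)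
      (memLp_of_continuous (hρc t ht) _) (memLp_of_continuous (hσc t ht) _)
      (h₁.density_nonneg t ht) (hσ t ht) ((h₁.setIntegral_density ht).trans_le hm)
  have hrate : ∀ t ∈ Ioo 0 T, ∫ x in cell d, relEnergyRate α γ κ (ρ t) (u t) (σ t) (v t) x
      ≤ C₁ * relEnergy α γ κ (ρ t) (u t) (σ t) (v t) := by
    intro t ht
    have ht' := Ioo_subset_Ico_self ht
    calc _ ≤ 2 * |L| * relKineticEnergy (ρ t) (u t) (v t)
          + (γ - 1) * (d * |L|) * totalRelInternalEnergy γ (ρ t) (σ t)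
          + |κ| * |L| * ∑ i, ∑ j,
              ∫ x in cell d, |rieszTensor α (fun z => ρ t z - σ t z) x i j| :=
          setIntegral_relEnergyRate_le hα hαd hγ1 h₁ h₂ ht
            (fun x => hδ.trans_le (hσ t ht' x).1) fun x => (hL t ht x).trans (le_abs_self L)
      _ ≤ 2 * |L| * relKineticEnergy (ρ t) (u t) (v t)
          + (γ - 1) * (d * |L|) * totalRelInternalEnergy γ (ρ t) (σ t)
          + |κ| * |L| * ((d : ℝ) ^ 2 * C₀ * totalRelInternalEnergy γ (ρ t) (σ t)) := by
          gcongr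
          exact hS t ht'
      _ = 2 * |L| * relKineticEnergy (ρ t) (u t) (v t)
          + B / lam * (lam * totalRelInternalEnergy γ (ρ t) (σ t)) := by
          rw [← mul_assoc (B / lam), div_mul_cancel₀ _ hlam.ne']
          ring
      _ ≤ C₁ * relKineticEnergy (ρ t) (u t) (v t)
          + C₁ * (lam * totalRelInternalEnergy γ (ρ t) (σ t)) := by
          have hBl : 0 ≤ B / lam := by positivity
          have := hK t ht'
          have := hH t ht'
          gcongr
          · exact le_add_of_nonneg_right hBl
          · exact le_add_of_nonneg_left (by positivity)
      _ ≤ _ := by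
          rw [← mul_add]
          exact mul_le_mul_of_nonneg_left (hcoer t ht') hC1
  intro t ht
  refine ⟨hΨ t ht, hcoer t ht, (hS t ht).trans ?_, ?_⟩
  · exact mul_le_mul_of_nonneg_right (by linarith) (hH t ht)
  · refine (le_exp_mul_of_hasDerivAt_le (continuousOn_relEnergy hα hαd hγ1 h₁ h₂)
      (fun s hs => hasDerivAt_relEnergy hα hαd hγ1 h₁ h₂
        (fun s hs x => hδ.trans_le (hσ s (Ioo_subset_Ico_self hs) x).1) hs) hrate t ht).trans ?_
    -- Enlarging `C₁ t` to `C T` in the exponent is allowed because the initial relative energy is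
    -- nonnegative.
    refine mul_le_mul_of_nonneg_right (Real.exp_le_exp.2 ?_) (hΨ 0 ⟨le_rfl, hT⟩)
    refine mul_le_mul ?_ ht.2.le ht.1 (by positivity)
    have : 0 ≤ (d : ℝ) ^ 2 * C₀ := by positivity
    linarith

end EulerRiesz

/-! ### The theorem -/

theorem mainTheorem5 (d : ℕ) (α γ : ℝ) (hα : 0 < α) (hαd : α < (d : ℝ))
    (hγ : 2 - α / (d : ℝ) ≤ γ) :
    -- the momentum equation may equivalently be written with `ρ ∇ δℰ/δρ (ρ)` or with `∇ · R_α(ρ)`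
    (∀ (κ : ℝ) (f : EuclideanSpace ℝ (Fin d) → ℝ), ContDiff ℝ 1 f →
      EulerRiesz.UnitPeriodic f → (∀ x, 0 ≤ f x) →
      ∀ (x : EuclideanSpace ℝ (Fin d)) (i : Fin d),
        f x * EulerRiesz.partialX i (EulerRiesz.energyVariation α γ κ f) x
          = ∑ j, EulerRiesz.partialX j (fun z => EulerRiesz.stress α γ κ f z i j) x) ∧
    ∀ (δ M m : ℝ), 0 < δ →
      -- the constant `C_*` exists
      (∃ Cs : ℝ, 0 < Cs ∧ ∀ (ρ ρb : EuclideanSpace ℝ (Fin d) → ℝ),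
        EulerRiesz.UnitPeriodic ρ → EulerRiesz.UnitPeriodic ρb →
        MemLp ρ (ENNReal.ofReal γ) (volume.restrict (EulerRiesz.cell d)) →
        MemLp ρb ⊤ (volume.restrict (EulerRiesz.cell d)) →
        (∀ x, 0 ≤ ρ x) → (∀ x, δ ≤ ρb x ∧ ρb x ≤ M) →
        ∫ x in EulerRiesz.cell d, ρ x ≤ m →
        EulerRiesz.IsInteractionConstant α γ Cs ρ ρb) ∧
      -- stability
      (∀ (Cs κ L : ℝ), 0 < Cs → |κ| < 2 / Cs →
        ∃ C : ℝ, 0 < C ∧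
          ∀ (T : ℝ) (ρ : ℝ → EuclideanSpace ℝ (Fin d) → ℝ)
            (u : ℝ → EuclideanSpace ℝ (Fin d) → EuclideanSpace ℝ (Fin d))
            (ρb : ℝ → EuclideanSpace ℝ (Fin d) → ℝ)
            (ub : ℝ → EuclideanSpace ℝ (Fin d) → EuclideanSpace ℝ (Fin d)),
            0 < T →
            EulerRiesz.IsPeriodicSolution α γ κ T ρ u →
            EulerRiesz.IsPeriodicSolution α γ κ T ρb ub →
            (∀ t ∈ Ico 0 T, ∀ x, δ ≤ ρb t x ∧ ρb t x ≤ M) →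
            (∀ t ∈ Ioo 0 T, ∀ x, ‖fderiv ℝ (ub t) x‖ ≤ L) →
            ∫ x in EulerRiesz.cell d, ρ 0 x ≤ m →
            (∀ t ∈ Ico 0 T, EulerRiesz.IsInteractionConstant α γ Cs (ρ t) (ρb t)) →
            ∀ t ∈ Ico 0 T,
              0 ≤ EulerRiesz.relEnergy α γ κ (ρ t) (u t) (ρb t) (ub t) ∧
              EulerRiesz.relKineticEnergy (ρ t) (u t) (ub t)
                  + (1 - |κ| * Cs / 2) * EulerRiesz.totalRelInternalEnergy γ (ρ t) (ρb t)
                ≤ EulerRiesz.relEnergy α γ κ (ρ t) (u t) (ρb t) (ub t) ∧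
              ∑ i, ∑ j, ∫ x in EulerRiesz.cell d,
                  |EulerRiesz.rieszTensor α (fun z => ρ t z - ρb t z) x i j|
                ≤ C * EulerRiesz.totalRelInternalEnergy γ (ρ t) (ρb t) ∧
              EulerRiesz.relEnergy α γ κ (ρ t) (u t) (ρb t) (ub t)
                ≤ Real.exp (C * T)
                  * EulerRiesz.relEnergy α γ κ (ρ 0) (u 0) (ρb 0) (ub 0)) := by
  have hγ1 := EulerRiesz.one_lt_of_two_sub_div_le hα hαd hγ
  exact ⟨fun κ f hf hp hf0 x i =>
      EulerRiesz.mul_partialX_energyVariation hα hαd hγ1 κ hf hp hf0 x i,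
    fun δ M m hδ => ⟨EulerRiesz.exists_isInteractionConstant hα hαd hγ M m hδ,
      fun Cs κ L hCs hκ => EulerRiesz.exists_relEnergy_le_exp_mul hα hαd hγ M m hδ L hCs hκ⟩⟩
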